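/- **Setting.** Let $a<b$, let $n_x,m,n_1,n_2,n_3\ge 0$ be integers, $n_z=n_1+n_2+n_3$, and consider the coupled ODE–PDE system with input $w(t)\in\mathbb R^{m}$ and output $y(t)\in\mathbb R^{m}$ $$\dot x=Ax+\mathcal E z+B_{wo}w,\qquad \dot z=A_0z+A_1\begin{bmatrix}\partial_s z_2\\ \partial_s z_3\end{bmatrix}+A_2\,\partial_s^2z_3+E x+B_{wp}w,\qquad y=Cx+\mathcal C z+D_ww,$$ $$Bz_b=B_1x+B_2w,\qquad z_b=\mathrm{col}\big(z_2(a),z_2(b),z_3(a),z_3(b),\partial_sz_3(a),\partial_sz_3(b)\big),\qquad x(0)=0,\ z(\cdot,0)=0,$$ where $x(t)\in\mathbb R^{n_x}$, $z=\mathrm{col}(z_1,z_2,z_3)$, $z(\cdot,t)\in L_2^{n_1}[a,b]\times W^{1,n_2}[a,b]\times W^{2,n_3}[a,b]$, $$\mathcal E z=E_1z_b+\int_a^b\Big(E_a(s)z(s)+E_b(s)\begin{bmatrix}\partial_sz_2(s)\\ \partial_sz_3(s)\end{bmatrix}\Big)ds,\qquad \mathcal C z=C_1z_b+\int_a^b\Big(C_a(s)z(s)+C_b(s)\begin{bmatrix}\partial_sz_2(s)\\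 \partial_sz_3(s)\end{bmatrix}\Big)ds .$$ Here $A,B_{wo},C,D_w,E_1,C_1,B,B_1,B_2$ are constant matrices, $A_0,A_1,A_2,E,B_{wp},E_a,E_b,C_a,C_b$ are matrix-valued polynomials in $s$, $B$ has $n_2+2n_3$ rows, and $BT$ is invertible, with $T$ given below. A *trajectory* is a quadruple $(w,y,x,z)$ in which $t\mapsto(x(t),z(t))\in\mathbb R^{n_x}\times L_2^{n_z}[a,b]$ is absolutely continuous on every $[0,\tau]$, vanishes at $t=0$, and for almost every $t\ge 0$ satisfies $z(t)\in L_2^{n_1}\times W^{1,n_2}\times W^{2,n_3}$, is differentiable in $t$ (in $\mathbb R^{n_x}\times L_2^{n_z}$), and satisfies the boundary condition and the three equations. **PQRS tuples.** A tuple $\begin{bmatrix}P,Q_1,Q_2\\S,R_1,R_2\end{bmatrix}$ consists of a matrix $P$, functions $Q_1,Q_2,S$ of $s\in[a,b]$ and $R_1,R_2$ of $(s,\theta)\in[a,b]^2$; it represents the operator $$(x,z)\mapsto\Big(Px+\int_a^bQ_1z\,ds,\ \ Q_2(s)x+S(s)z(s)+\int_a^sR_1(s,\theta)z(\theta)d\theta+\int_s^bR_2(s,\theta)z(\theta)d\theta\Big).$$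 The adjoint $X^*$ has components $P^\top$, $Q_2(s)^\top$, $Q_1(s)^\top$, $S(s)^\top$, $R_2(\eta,s)^\top$, $R_1(\eta,s)^\top$ (in the order $P,Q_1,Q_2,S,R_1,R_2$). The product $\begin{bmatrix}A,B_1,B_2\\D,C_1,C_2\end{bmatrix}\times\begin{bmatrix}P,Q_1,Q_2\\S,R_1,R_2\end{bmatrix}$ has components $$\hat P=AP+\int_a^bB_1Q_2\,ds,\qquad \hat S=DS,$$ $$\hat Q_1(s)=AQ_1(s)+B_1(s)S(s)+\int_s^bB_1(\eta)R_1(\eta,s)d\eta+\int_a^sB_1(\eta)R_2(\eta,s)d\eta,$$ $$\hat Q_2(s)=B_2(s)P+D(s)Q_2(s)+\int_a^sC_1(s,\eta)Q_2(\eta)d\eta+\int_s^bC_2(s,\eta)Q_2(\eta)d\eta,$$ $$\hat R_1(s,\eta)=B_2(s)Q_1(\eta)+D(s)R_1(s,\eta)+C_1(s,\eta)S(\eta)+\int_a^\eta C_1(s,\theta)R_2(\theta,\eta)d\theta+\int_\eta^sC_1(s,\theta)R_1(\theta,\eta)d\theta+\int_s^bC_2(s,\theta)R_1(\theta,\eta)d\theta,$$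 $$\hat R_2(s,\eta)=B_2(s)Q_1(\eta)+D(s)R_2(s,\eta)+C_2(s,\eta)S(\eta)+\int_a^sC_1(s,\theta)R_2(\theta,\eta)d\theta+\int_s^\eta C_2(s,\theta)R_2(\theta,\eta)d\theta+\int_\eta^bC_2(s,\theta)R_1(\theta,\eta)d\theta .$$ Sums and negatives are componentwise. **The set $\Phi_d$.** For $d\ge0$ let $Z_1(s)=(1,s,\dots,s^d)^\top\otimes I$. Given $g:[a,b]\to[0,\infty)$, a matrix-valued polynomial $Z_2$ in two variables and $T=(T_{ij})_{i,j=1}^4\succeq0$, let $\begin{bmatrix}P,Q,Q^\top\\S,R_1,R_2\end{bmatrix}$ be the tuple with $P=T_{11}\int_a^bg$, $S(s)=g(s)Z_1(s)^\top T_{22}Z_1(s)$, $$Q(\eta)=g(\eta)T_{12}Z_1(\eta)+\int_\eta^bg(s)T_{13}Z_2(s,\eta)ds+\int_a^\eta g(s)T_{14}Z_2(s,\eta)ds,$$ $$R_1(s,\eta)=g(s)Z_1(s)^\top T_{23}Z_2(s,\eta)+g(\eta)Z_2(\eta,s)^\top T_{42}Z_1(\eta)+\Big(\int_s^bT_{33}+\int_\eta^sT_{43}+\int_a^\eta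 T_{44}\Big),$$ $$R_2(s,\eta)=g(s)Z_1(s)^\top T_{24}Z_2(s,\eta)+g(\eta)Z_2(\eta,s)^\top T_{32}Z_1(\eta)+\Big(\int_\eta^bT_{33}+\int_s^\eta T_{34}+\int_a^sT_{44}\Big),$$ where $\int_c^d T_{ij}$ abbreviates $\int_c^dg(\theta)Z_2(\theta,s)^\top T_{ij}Z_2(\theta,\eta)d\theta$. Then $\Phi_d$ is the set of sums of one such tuple with $g=1$ and one such tuple with $g(s)=(s-a)(b-s)$ (each with its own $Z_2$ and $T$). **Matrices of the system.** Put $$T=\begin{bmatrix}I&0&0\\I&0&0\\0&I&0\\0&I&(b-a)I\\0&0&I\\0&0&I\end{bmatrix},\quad Q_b(\theta)=\begin{bmatrix}0&0&0\\0&I&0\\0&0&0\\0&0&(b-\theta)I\\0&0&0\\0&0&I\end{bmatrix},\quad K(s)=\begin{bmatrix}0&0&0\\I&0&0\\0&I&(s-a)I\end{bmatrix},\quad V=\begin{bmatrix}0&0&0\\0&0&I\end{bmatrix},$$ $H_0=K(BT)^{-1}[B_2\ B_1]$, $H_1=V(BT)^{-1}[B_2\ B_1]$, $G_0=\mathrm{diag}(I,0,0)$,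 $G_3=\begin{bmatrix}0&I&0\\0&0&0\end{bmatrix}$, $G_2(s,\theta)=-K(s)(BT)^{-1}BQ_b(\theta)$, $G_5(s,\theta)=-V(BT)^{-1}BQ_b(\theta)$, $G_1(s,\theta)=\mathrm{diag}(0,I,(s-\theta)I)+G_2(s,\theta)$, $G_4(s,\theta)=\begin{bmatrix}0&0&0\\0&0&I\end{bmatrix}+G_5(s,\theta)$, $T_1=T(BT)^{-1}[B_2\ B_1]$, $T_2(\theta)=Q_b(\theta)-T(BT)^{-1}BQ_b(\theta)$, $I_0=[I\ 0]$, $I_1=[0\ I]$ (acting on $\mathrm{col}(w,x)$), and $$\begin{bmatrix}\hat A_0,\hat A_1,\hat A_2\\\hat A_3,\hat A_4,\hat A_5\end{bmatrix}=\begin{bmatrix}0,E_a,0\\A_0,0,0\end{bmatrix}\times\begin{bmatrix}0,0,H_0\\G_0,G_1,G_2\end{bmatrix}+\begin{bmatrix}0,E_b,0\\A_1,0,0\end{bmatrix}\times\begin{bmatrix}0,0,H_1\\G_3,G_4,G_5\end{bmatrix}+\begin{bmatrix}E_1,0,0\\0,0,0\end{bmatrix}\times\begin{bmatrix}T_1,T_2,0\\0,0,0\end{bmatrix}+\begin{bmatrix}[0\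 A],0,[0\ E]\\ [0\ 0\ A_2],0,0\end{bmatrix},$$ $$\begin{bmatrix}\hat C_0,\hat C_1,0\\0,0,0\end{bmatrix}=\begin{bmatrix}0,C_a,0\\0,0,0\end{bmatrix}\times\begin{bmatrix}0,0,H_0\\G_0,G_1,G_2\end{bmatrix}+\begin{bmatrix}0,C_b,0\\0,0,0\end{bmatrix}\times\begin{bmatrix}0,0,H_1\\G_3,G_4,G_5\end{bmatrix}+\begin{bmatrix}C_1,0,0\\0,0,0\end{bmatrix}\times\begin{bmatrix}T_1,T_2,0\\0,0,0\end{bmatrix}+\begin{bmatrix}[0\ C],0,0\\0,0,0\end{bmatrix},$$ $\hat B_0=[B_{wo}\ 0]$, $\hat B_2(s)=[B_{wp}(s)\ 0]$, $\hat D_0=[D_w\ 0]$. **Theorem.** Let $\epsilon>0$, $d_1,d_2\ge0$, let $P\in\mathbb S^{n_x}$ and let $Q:\mathbb R\to\mathbb R^{n_x\times n_z}$, $S:\mathbb R\to\mathbb S^{n_z}$, $R_1,R_2:\mathbb R\times\mathbb R\to\mathbb R^{n_z\times n_z}$ be matrix-valued polynomials with $$\begin{bmatrix}P-\epsilon I,Q,Q^\top\\S-\epsilon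 I,R_1,R_2\end{bmatrix}\in\Phi_{d_1}.$$ Let $\mathbf K=\begin{bmatrix}I_1,0,H_0\\G_0,G_1,G_2\end{bmatrix}^*\times\begin{bmatrix}P,Q,Q^\top\\S,R_1,R_2\end{bmatrix}$ and $$J=\mathbf K\times\begin{bmatrix}\hat A_0+\hat B_0,\hat A_1,\hat A_2+\hat B_2\\\hat A_3,\hat A_4,\hat A_5\end{bmatrix}-\begin{bmatrix}(\hat C_0+\hat D_0)^\top I_0,0,\hat C_1^\top I_0\\0,0,0\end{bmatrix}.$$ If $-J-J^*\in\Phi_{d_2}$, then every trajectory $(w,y,x,z)$ with $w,y\in L_2^{m}[0,\infty)$ satisfies $$\langle w,y\rangle_{L_2}=\int_0^\infty w(t)^\top y(t)\,dt\ \ge\ 0 .$$ -/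

import Mathlib

open MeasureTheory

noncomputable section

/-! ### Matrix-valued polynomials -/

/-- The value at `s` of a matrix-valued polynomial in one variable. -/
def polyEval {α β : Type*} (M : Matrix α β (Polynomial ℝ)) (s : ℝ) : Matrix α β ℝ :=
  M.map (Polynomial.eval s)

/-- The value at `(s, θ)` of a matrix-valued polynomial in two variables. -/
def polyEval₂ {α β : Type*} (M : Matrix α β (Polynomial (Polynomial ℝ))) (s θ : ℝ) :
    Matrix α β ℝ :=
  M.map (Polynomial.evalEval s θ)

/-- The entrywise integral of a matrix-valued function over the oriented interval from `c` to `d`. -/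
def matIntegral {α β : Type*} (c d : ℝ) (M : ℝ → Matrix α β ℝ) : Matrix α β ℝ :=
  Matrix.of fun i j => ∫ θ in c..d, M θ i j

/-! ### PQRS tuples -/

/-- A tuple `[P, Q₁, Q₂; S, R₁, R₂]`. It parametrizes the operator
`ℝ^m × L₂^q[a,b] → ℝ^n × L₂^r[a,b]` which sends `(x, z)` to the pair with components
`P x + ∫_a^b Q₁(s) z(s) ds` and
`Q₂(s) x + S(s) z(s) + ∫_a^s R₁(s,θ) z(θ) dθ + ∫_s^b R₂(s,θ) z(θ) dθ`. -/
structure PQRS (m q n r : Type) where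
  P : Matrix n m ℝ
  Q₁ : ℝ → Matrix n q ℝ
  Q₂ : ℝ → Matrix r m ℝ
  S : ℝ → Matrix r q ℝ
  R₁ : ℝ → ℝ → Matrix r q ℝ
  R₂ : ℝ → ℝ → Matrix r q ℝ

namespace PQRS

instance instAdd {m q n r : Type} : Add (PQRS m q n r) :=
  ⟨fun X Y => ⟨X.P + Y.P, X.Q₁ + Y.Q₁, X.Q₂ + Y.Q₂, X.S + Y.S, X.R₁ + Y.R₁, X.R₂ + Y.R₂⟩⟩

instance instNeg {m q n r : Type} : Neg (PQRS m q n r) :=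
  ⟨fun X => ⟨-X.P, -X.Q₁, -X.Q₂, -X.S, -X.R₁, -X.R₂⟩⟩

instance instSub {m q n r : Type} : Sub (PQRS m q n r) :=
  ⟨fun X Y => ⟨X.P - Y.P, X.Q₁ - Y.Q₁, X.Q₂ - Y.Q₂, X.S - Y.S, X.R₁ - Y.R₁, X.R₂ - Y.R₂⟩⟩

/-- The adjoint tuple. -/
def adj {m q n r : Type} (X : PQRS m q n r) : PQRS n r m q where
  P := X.P.transpose
  Q₁ := fun s => (X.Q₂ s).transpose
  Q₂ := fun s => (X.Q₁ s).transpose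
  S := fun s => (X.S s).transpose
  R₁ := fun s η => (X.R₂ η s).transpose
  R₂ := fun s η => (X.R₁ η s).transpose

/-- The product `X × Y` of two tuples on the interval `[a, b]`. -/
def comp {m q n r k l : Type} [Fintype n] [Fintype r] (a b : ℝ)
    (X : PQRS n r k l) (Y : PQRS m q n r) : PQRS m q k l where
  P := X.P * Y.P + matIntegral a b fun s => X.Q₁ s * Y.Q₂ s
  Q₁ := fun s => X.P * Y.Q₁ s + X.Q₁ s * Y.S s
    + matIntegral s b (fun η => X.Q₁ η * Y.R₁ η s)
    + matIntegral a s (fun η => X.Q₁ η * Y.R₂ η s)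
  Q₂ := fun s => X.Q₂ s * Y.P + X.S s * Y.Q₂ s
    + matIntegral a s (fun η => X.R₁ s η * Y.Q₂ η)
    + matIntegral s b (fun η => X.R₂ s η * Y.Q₂ η)
  S := fun s => X.S s * Y.S s
  R₁ := fun s η => X.Q₂ s * Y.Q₁ η + X.S s * Y.R₁ s η + X.R₁ s η * Y.S η
    + matIntegral a η (fun θ => X.R₁ s θ * Y.R₂ θ η)
    + matIntegral η s (fun θ => X.R₁ s θ * Y.R₁ θ η)
    + matIntegral s b (fun θ => X.R₂ s θ * Y.R₁ θ η)
  R₂ := fun s η => X.Q₂ s * Y.Q₁ η + X.S s * Y.R₂ s η + X.R₂ s η * Y.S η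
    + matIntegral a s (fun θ => X.R₁ s θ * Y.R₂ θ η)
    + matIntegral s η (fun θ => X.R₂ s θ * Y.R₂ θ η)
    + matIntegral η b (fun θ => X.R₂ s θ * Y.R₁ θ η)

/-- The tuple `[P, Q, Qᵀ; S, R₁, R₂]`. -/
def symm {m n : Type} (P : Matrix m m ℝ) (Q : ℝ → Matrix m n ℝ) (S : ℝ → Matrix n n ℝ)
    (R₁ R₂ : ℝ → ℝ → Matrix n n ℝ) : PQRS m n m n where
  P := P
  Q₁ := Q
  Q₂ := fun s => (Q s).transpose
  S := S
  R₁ := R₁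
  R₂ := R₂

/-- Equality of two tuples as matrices and functions on `[a, b]` and on `[a, b] × [a, b]`. -/
def EqOn {m q n r : Type} (a b : ℝ) (X Y : PQRS m q n r) : Prop :=
  X.P = Y.P ∧
  (∀ s ∈ Set.Icc a b, X.Q₁ s = Y.Q₁ s ∧ X.Q₂ s = Y.Q₂ s ∧ X.S s = Y.S s) ∧
  ∀ s ∈ Set.Icc a b, ∀ η ∈ Set.Icc a b, X.R₁ s η = Y.R₁ s η ∧ X.R₂ s η = Y.R₂ s η

end PQRS

/-! ### The cone `Φ_d` -/

/-- `Z_d(s) = (1, s, …, s^d)ᵀ ⊗ I`, the monomials of degree at most `d`. -/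
def monomialBasis (n : Type) [DecidableEq n] (d : ℕ) (s : ℝ) : Matrix (Fin (d + 1) × n) n ℝ :=
  Matrix.of fun i j => if i.2 = j then s ^ (i.1 : ℕ) else 0

/-- The `4 × 4` block matrix with blocks `T₁₁, …, T₄₄`; its index set is partitioned as
`m ⊕ p ⊕ k ⊕ k`. The functions below extract the blocks. -/
abbrev GramMatrix (m p k : Type) := Matrix (m ⊕ p ⊕ k ⊕ k) (m ⊕ p ⊕ k ⊕ k) ℝ

/-- The embeddings of the four blocks of indices. -/
abbrev ix₁ {m p k : Type} : m → m ⊕ p ⊕ k ⊕ k := Sum.inl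
abbrev ix₂ {m p k : Type} : p → m ⊕ p ⊕ k ⊕ k := fun i => Sum.inr (Sum.inl i)
abbrev ix₃ {m p k : Type} : k → m ⊕ p ⊕ k ⊕ k := fun i => Sum.inr (Sum.inr (Sum.inl i))
abbrev ix₄ {m p k : Type} : k → m ⊕ p ⊕ k ⊕ k := fun i => Sum.inr (Sum.inr (Sum.inr i))

/-- The tuple `[P, Q, Qᵀ; S, R₁, R₂]` built from a weight `g`, functions `Z₁`, `Z₂` and a block
matrix `T`; it parametrizes the quadratic form `∫_a^b g(s) v(s)ᵀ T v(s) ds` in `(x, z)`, where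
`v(s)` stacks `x`, `Z₁(s) z(s)`, `∫_a^s Z₂(s,θ) z(θ) dθ` and `∫_s^b Z₂(s,θ) z(θ) dθ`. -/
def gramTuple {m n p k : Type} [Fintype p] [Fintype k] (a b : ℝ) (g : ℝ → ℝ)
    (Z₁ : ℝ → Matrix p n ℝ) (Z₂ : ℝ → ℝ → Matrix k n ℝ) (T : GramMatrix m p k) :
    PQRS m n m n :=
  PQRS.symm
    ((∫ s in a..b, g s) • T.submatrix ix₁ ix₁)
    (fun η => g η • (T.submatrix ix₁ ix₂ * Z₁ η)
      + matIntegral η b (fun s => g s • (T.submatrix ix₁ ix₃ * Z₂ s η))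
      + matIntegral a η (fun s => g s • (T.submatrix ix₁ ix₄ * Z₂ s η)))
    (fun s => g s • ((Z₁ s).transpose * T.submatrix ix₂ ix₂ * Z₁ s))
    (fun s η => g s • ((Z₁ s).transpose * T.submatrix ix₂ ix₃ * Z₂ s η)
      + g η • ((Z₂ η s).transpose * T.submatrix ix₄ ix₂ * Z₁ η)
      + matIntegral s b (fun θ => g θ • ((Z₂ θ s).transpose * T.submatrix ix₃ ix₃ * Z₂ θ η))
      + matIntegral η s (fun θ => g θ • ((Z₂ θ s).transpose * T.submatrix ix₄ ix₃ * Z₂ θ η))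
      + matIntegral a η (fun θ => g θ • ((Z₂ θ s).transpose * T.submatrix ix₄ ix₄ * Z₂ θ η)))
    (fun s η => g s • ((Z₁ s).transpose * T.submatrix ix₂ ix₄ * Z₂ s η)
      + g η • ((Z₂ η s).transpose * T.submatrix ix₃ ix₂ * Z₁ η)
      + matIntegral η b (fun θ => g θ • ((Z₂ θ s).transpose * T.submatrix ix₃ ix₃ * Z₂ θ η))
      + matIntegral s η (fun θ => g θ • ((Z₂ θ s).transpose * T.submatrix ix₃ ix₄ * Z₂ θ η))
      + matIntegral a s (fun θ => g θ • ((Z₂ θ s).transpose * T.submatrix ix₄ ix₄ * Z₂ θ η)))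

/-- `X` is the tuple of some positive semidefinite `T` for the weight `g`, with `Z₁ = Z_d` and some
matrix-valued polynomial `Z₂` in two variables. -/
def IsGramTuple {m n : Type} [Fintype m] [Fintype n] [DecidableEq n] (a b : ℝ) (d : ℕ)
    (g : ℝ → ℝ) (X : PQRS m n m n) : Prop :=
  ∃ (k : ℕ) (Z₂ : Matrix (Fin k) n (Polynomial (Polynomial ℝ)))
    (T : GramMatrix m (Fin (d + 1) × n) (Fin k)),
    T.PosSemidef ∧ X = gramTuple a b g (monomialBasis n d) (polyEval₂ Z₂) T

/-- The set `Φ_d`. -/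
def PhiCone (m n : Type) [Fintype m] [Fintype n] [DecidableEq n] (a b : ℝ) (d : ℕ) :
    Set (PQRS m n m n) :=
  {X | ∃ Xa Xb : PQRS m n m n,
    IsGramTuple a b d (fun _ => 1) Xa ∧
    IsGramTuple a b d (fun s => (s - a) * (b - s)) Xb ∧
    PQRS.EqOn a b X (Xa + Xb)}

/-! ### Index sets for the distributed state -/

/-- Components of `col(z₁, z₂, z₃)`. -/
abbrev ZIdx (n₁ n₂ n₃ : ℕ) := Fin n₁ ⊕ Fin n₂ ⊕ Fin n₃

/-- Components of `col(z₂, z₃)`. -/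
abbrev DIdx (n₂ n₃ : ℕ) := Fin n₂ ⊕ Fin n₃

/-- Components of `z_b = col(z₂(a), z₂(b), z₃(a), z₃(b), ∂ₛz₃(a), ∂ₛz₃(b))`. -/
abbrev BIdx (n₂ n₃ : ℕ) := Fin n₂ ⊕ Fin n₂ ⊕ Fin n₃ ⊕ Fin n₃ ⊕ Fin n₃ ⊕ Fin n₃

/-- A set with `n₂ + 2 n₃` elements: the components of `col(z₂(a), z₃(a), ∂ₛz₃(a))`, and also the
rows of the boundary condition. -/
abbrev YIdx (n₂ n₃ : ℕ) := Fin n₂ ⊕ Fin n₃ ⊕ Fin n₃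

/-- The column `col(u, v, w)`. -/
def stack₃ {α β γ : Type} (u : EuclideanSpace ℝ α) (v : EuclideanSpace ℝ β)
    (w : EuclideanSpace ℝ γ) : α ⊕ β ⊕ γ → ℝ :=
  Sum.elim u.ofLp (Sum.elim v.ofLp w.ofLp)

/-- The column `col(u, v)`. -/
def stack₂ {α β : Type} (u : EuclideanSpace ℝ α) (v : EuclideanSpace ℝ β) : α ⊕ β → ℝ :=
  Sum.elim u.ofLp v.ofLp

/-- The block row `[X Y Z]`. -/
def row₃ {ρ α β γ : Type} (X : Matrix ρ α ℝ) (Y : Matrix ρ β ℝ) (Z : Matrix ρ γ ℝ) :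
    Matrix ρ (α ⊕ β ⊕ γ) ℝ :=
  Matrix.fromCols X (Matrix.fromCols Y Z)

/-! ### The coupled ODE-PDE system -/

/-- The coefficients of the system
`ẋ = A x + 𝓔 z + B_wo w`,
`ż = A₀ z + A₁ col(∂ₛz₂, ∂ₛz₃) + A₂ ∂ₛ²z₃ + E x + B_wp w`,
`y = C x + 𝓒 z + D_w w`, with the boundary condition `B z_b = B₁ x + B₂ w`, where
`𝓔 z = E₁ z_b + ∫_a^b (E_a z + E_b col(∂ₛz₂, ∂ₛz₃)) ds` and likewise for `𝓒`. -/
structure ODEPDESystem (nx nw ny n₁ n₂ n₃ : ℕ) where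
  A : Matrix (Fin nx) (Fin nx) ℝ
  Bwo : Matrix (Fin nx) (Fin nw) ℝ
  E₁ : Matrix (Fin nx) (BIdx n₂ n₃) ℝ
  Ea : Matrix (Fin nx) (ZIdx n₁ n₂ n₃) (Polynomial ℝ)
  Eb : Matrix (Fin nx) (DIdx n₂ n₃) (Polynomial ℝ)
  A₀ : Matrix (ZIdx n₁ n₂ n₃) (ZIdx n₁ n₂ n₃) (Polynomial ℝ)
  A₁ : Matrix (ZIdx n₁ n₂ n₃) (DIdx n₂ n₃) (Polynomial ℝ)
  A₂ : Matrix (ZIdx n₁ n₂ n₃) (Fin n₃) (Polynomial ℝ)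
  E : Matrix (ZIdx n₁ n₂ n₃) (Fin nx) (Polynomial ℝ)
  Bwp : Matrix (ZIdx n₁ n₂ n₃) (Fin nw) (Polynomial ℝ)
  C : Matrix (Fin ny) (Fin nx) ℝ
  C₁ : Matrix (Fin ny) (BIdx n₂ n₃) ℝ
  Ca : Matrix (Fin ny) (ZIdx n₁ n₂ n₃) (Polynomial ℝ)
  Cb : Matrix (Fin ny) (DIdx n₂ n₃) (Polynomial ℝ)
  Dw : Matrix (Fin ny) (Fin nw) ℝ
  B : Matrix (YIdx n₂ n₃) (BIdx n₂ n₃) ℝ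
  B₁ : Matrix (YIdx n₂ n₃) (Fin nx) ℝ
  B₂ : Matrix (YIdx n₂ n₃) (Fin nw) ℝ

/-! ### Spaces and trajectories -/

/-- `L₂[a,b]` with values in Euclidean space. -/
abbrev L2 (ι : Type) [Fintype ι] (a b : ℝ) :=
  Lp (EuclideanSpace ℝ ι) 2 ((volume : Measure ℝ).restrict (Set.Icc a b))

/-- `u` is (the continuous representative of) an element of the Sobolev space `W^{1,n}[a,b]` and
`v` is its derivative: `u` is absolutely continuous with derivative `v ∈ L₂`. -/
structure IsSobolev {n : ℕ} (a b : ℝ) (u v : ℝ → EuclideanSpace ℝ (Fin n)) : Prop where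
  ac : AbsolutelyContinuousOnInterval u a b
  deriv_ae : ∀ᵐ s ∂((volume : Measure ℝ).restrict (Set.Icc a b)), HasDerivAt u (v s) s
  memLp : MemLp v 2 ((volume : Measure ℝ).restrict (Set.Icc a b))

/-- An element `(z₁, z₂, z₃)` of `L₂^{n₁} × W^{1,n₂} × W^{2,n₃}`, together with the derivatives
`∂ₛz₂`, `∂ₛz₃` and `∂ₛ²z₃`. -/
structure PrimalState (n₁ n₂ n₃ : ℕ) (a b : ℝ) where
  z₁ : ℝ → EuclideanSpace ℝ (Fin n₁)
  z₂ : ℝ → EuclideanSpace ℝ (Fin n₂)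
  z₃ : ℝ → EuclideanSpace ℝ (Fin n₃)
  z₂s : ℝ → EuclideanSpace ℝ (Fin n₂)
  z₃s : ℝ → EuclideanSpace ℝ (Fin n₃)
  z₃ss : ℝ → EuclideanSpace ℝ (Fin n₃)
  memLp_z₁ : MemLp z₁ 2 ((volume : Measure ℝ).restrict (Set.Icc a b))
  sobolev_z₂ : IsSobolev a b z₂ z₂s
  sobolev_z₃ : IsSobolev a b z₃ z₃s
  sobolev_z₃s : IsSobolev a b z₃s z₃ss

namespace PrimalState

/-- `col(z₁, z₂, z₃)` at the point `s`. -/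
def val {n₁ n₂ n₃ : ℕ} {a b : ℝ} (ζ : PrimalState n₁ n₂ n₃ a b) (s : ℝ) : ZIdx n₁ n₂ n₃ → ℝ :=
  stack₃ (ζ.z₁ s) (ζ.z₂ s) (ζ.z₃ s)

/-- `col(∂ₛz₂, ∂ₛz₃)` at the point `s`. -/
def der {n₁ n₂ n₃ : ℕ} {a b : ℝ} (ζ : PrimalState n₁ n₂ n₃ a b) (s : ℝ) : DIdx n₂ n₃ → ℝ :=
  stack₂ (ζ.z₂s s) (ζ.z₃s s)

/-- The vector `z_b` of boundary values. -/
def bdry {n₁ n₂ n₃ : ℕ} {a b : ℝ} (ζ : PrimalState n₁ n₂ n₃ a b) : BIdx n₂ n₃ → ℝ :=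
  Sum.elim (ζ.z₂ a).ofLp (Sum.elim (ζ.z₂ b).ofLp (Sum.elim (ζ.z₃ a).ofLp
    (Sum.elim (ζ.z₃ b).ofLp (Sum.elim (ζ.z₃s a).ofLp (ζ.z₃s b).ofLp))))

/-- `M₁ z_b + ∫_a^b (M_a z + M_b col(∂ₛz₂, ∂ₛz₃)) ds`, the common form of `𝓔 z` and `𝓒 z`. -/
def functional {k n₁ n₂ n₃ : ℕ} {a b : ℝ} (M₁ : Matrix (Fin k) (BIdx n₂ n₃) ℝ)
    (Ma : Matrix (Fin k) (ZIdx n₁ n₂ n₃) (Polynomial ℝ))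
    (Mb : Matrix (Fin k) (DIdx n₂ n₃) (Polynomial ℝ))
    (ζ : PrimalState n₁ n₂ n₃ a b) : Fin k → ℝ :=
  fun i => M₁.mulVec ζ.bdry i
    + ∫ s in a..b, ((polyEval Ma s).mulVec (ζ.val s) i + (polyEval Mb s).mulVec (ζ.der s) i)

end PrimalState

namespace ODEPDESystem

/-- The first component of `𝓐 (x, z) + 𝓑 w`. -/
def odeRHS {nx nw ny n₁ n₂ n₃ : ℕ} {a b : ℝ} (sys : ODEPDESystem nx nw ny n₁ n₂ n₃)
    (x : EuclideanSpace ℝ (Fin nx)) (ζ : PrimalState n₁ n₂ n₃ a b)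
    (w : EuclideanSpace ℝ (Fin nw)) : EuclideanSpace ℝ (Fin nx) :=
  WithLp.toLp 2 (sys.A.mulVec x.ofLp + PrimalState.functional sys.E₁ sys.Ea sys.Eb ζ
    + sys.Bwo.mulVec w.ofLp)

/-- The second component of `𝓐 (x, z) + 𝓑 w`, at the point `s`. -/
def pdeRHS {nx nw ny n₁ n₂ n₃ : ℕ} {a b : ℝ} (sys : ODEPDESystem nx nw ny n₁ n₂ n₃)
    (x : EuclideanSpace ℝ (Fin nx)) (ζ : PrimalState n₁ n₂ n₃ a b)
    (w : EuclideanSpace ℝ (Fin nw)) (s : ℝ) : EuclideanSpace ℝ (ZIdx n₁ n₂ n₃) :=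
  WithLp.toLp 2 ((polyEval sys.A₀ s).mulVec (ζ.val s) + (polyEval sys.A₁ s).mulVec (ζ.der s)
    + (polyEval sys.A₂ s).mulVec (ζ.z₃ss s).ofLp + (polyEval sys.E s).mulVec x.ofLp
    + (polyEval sys.Bwp s).mulVec w.ofLp)

/-- The output `𝓒 (x, z) + 𝓓 w`. -/
def output {nx nw ny n₁ n₂ n₃ : ℕ} {a b : ℝ} (sys : ODEPDESystem nx nw ny n₁ n₂ n₃)
    (x : EuclideanSpace ℝ (Fin nx)) (ζ : PrimalState n₁ n₂ n₃ a b)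
    (w : EuclideanSpace ℝ (Fin nw)) : EuclideanSpace ℝ (Fin ny) :=
  WithLp.toLp 2 (sys.C.mulVec x.ofLp + PrimalState.functional sys.C₁ sys.Ca sys.Cb ζ
    + sys.Dw.mulVec w.ofLp)

/-- `(x, z)` is a (strong) solution on `[0, ∞)` with input `w`, output `y` and zero initial state.
The state is a locally absolutely continuous curve in `ℝ^{nx} × L₂^{nz}[a,b]`, and at almost every
time it lies in `ℝ^{nx} × L₂^{n₁} × W^{1,n₂} × W^{2,n₃}`, satisfies the boundary condition, is
differentiable in time and satisfies the equations. -/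
structure IsTrajectory {nx nw ny n₁ n₂ n₃ : ℕ} (sys : ODEPDESystem nx nw ny n₁ n₂ n₃) (a b : ℝ)
    (w : ℝ → EuclideanSpace ℝ (Fin nw)) (y : ℝ → EuclideanSpace ℝ (Fin ny))
    (x : ℝ → EuclideanSpace ℝ (Fin nx)) (z : ℝ → L2 (ZIdx n₁ n₂ n₃) a b) : Prop where
  x_zero : x 0 = 0
  z_zero : z 0 = 0
  x_ac : ∀ τ : ℝ, 0 < τ → AbsolutelyContinuousOnInterval x 0 τ
  z_ac : ∀ τ : ℝ, 0 < τ → AbsolutelyContinuousOnInterval z 0 τ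
  dynamics : ∀ᵐ t ∂((volume : Measure ℝ).restrict (Set.Ici 0)),
    ∃ (ζ : PrimalState n₁ n₂ n₃ a b) (z' : L2 (ZIdx n₁ n₂ n₃) a b),
      (∀ᵐ s ∂((volume : Measure ℝ).restrict (Set.Icc a b)), (z t s).ofLp = ζ.val s) ∧
      sys.B.mulVec ζ.bdry = sys.B₁.mulVec (x t).ofLp + sys.B₂.mulVec (w t).ofLp ∧
      HasDerivAt x (sys.odeRHS (x t) ζ (w t)) t ∧
      HasDerivAt z z' t ∧
      (∀ᵐ s ∂((volume : Measure ℝ).restrict (Set.Icc a b)), z' s = sys.pdeRHS (x t) ζ (w t) s) ∧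
      y t = sys.output (x t) ζ (w t)

end ODEPDESystem

/-! ### Representation in the fundamental state `z_f = col(z₁, ∂ₛz₂, ∂ₛ²z₃)` -/

/-- `T = [I 0 0; I 0 0; 0 I 0; 0 I (b-a)I; 0 0 I; 0 0 I]`. -/
def bdryT (n₂ n₃ : ℕ) (a b : ℝ) : Matrix (BIdx n₂ n₃) (YIdx n₂ n₃) ℝ :=
  Matrix.fromRows (row₃ 1 0 0) (Matrix.fromRows (row₃ 1 0 0)
    (Matrix.fromRows (row₃ 0 1 0) (Matrix.fromRows (row₃ 0 1 ((b - a) • 1))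
      (Matrix.fromRows (row₃ 0 0 1) (row₃ 0 0 1)))))

/-- `Q(θ) = [0 0 0; 0 I 0; 0 0 0; 0 0 (b-θ)I; 0 0 0; 0 0 I]`. -/
def bdryQ (n₁ n₂ n₃ : ℕ) (b θ : ℝ) : Matrix (BIdx n₂ n₃) (ZIdx n₁ n₂ n₃) ℝ :=
  Matrix.fromRows (row₃ 0 0 0) (Matrix.fromRows (row₃ 0 1 0)
    (Matrix.fromRows (row₃ 0 0 0) (Matrix.fromRows (row₃ 0 0 ((b - θ) • 1))
      (Matrix.fromRows (row₃ 0 0 0) (row₃ 0 0 1)))))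

/-- `K(s) = [0 0 0; I 0 0; 0 I (s-a)I]`. -/
def ftcK (n₁ n₂ n₃ : ℕ) (a s : ℝ) : Matrix (ZIdx n₁ n₂ n₃) (YIdx n₂ n₃) ℝ :=
  Matrix.fromRows (row₃ 0 0 0) (Matrix.fromRows (row₃ 1 0 0) (row₃ 0 1 ((s - a) • 1)))

/-- `V = [0 0 0; 0 0 I]`. -/
def ftcV (n₂ n₃ : ℕ) : Matrix (DIdx n₂ n₃) (YIdx n₂ n₃) ℝ :=
  Matrix.fromRows (row₃ 0 0 0) (row₃ 0 0 1)

namespace ODEPDESystem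

/-- The components of `w_r = col(w, x)`. -/
abbrev WIdx (nw nx : ℕ) := Fin nw ⊕ Fin nx

/-- `(BT)⁻¹ [B₂ B₁]`. -/
def bcInput {nx nw ny n₁ n₂ n₃ : ℕ} (sys : ODEPDESystem nx nw ny n₁ n₂ n₃) (a b : ℝ) :
    Matrix (YIdx n₂ n₃) (WIdx nw nx) ℝ :=
  (sys.B * bdryT n₂ n₃ a b)⁻¹ * Matrix.fromCols sys.B₂ sys.B₁

/-- `(BT)⁻¹ B Q(θ)`. -/
def bcKernel {nx nw ny n₁ n₂ n₃ : ℕ} (sys : ODEPDESystem nx nw ny n₁ n₂ n₃) (a b θ : ℝ) :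
    Matrix (YIdx n₂ n₃) (ZIdx n₁ n₂ n₃) ℝ :=
  (sys.B * bdryT n₂ n₃ a b)⁻¹ * sys.B * bdryQ n₁ n₂ n₃ b θ

def H₀ {nx nw ny n₁ n₂ n₃ : ℕ} (sys : ODEPDESystem nx nw ny n₁ n₂ n₃) (a b s : ℝ) :
    Matrix (ZIdx n₁ n₂ n₃) (WIdx nw nx) ℝ :=
  ftcK n₁ n₂ n₃ a s * sys.bcInput a b

def H₁ {nx nw ny n₁ n₂ n₃ : ℕ} (sys : ODEPDESystem nx nw ny n₁ n₂ n₃) (a b : ℝ) (_s : ℝ) :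
    Matrix (DIdx n₂ n₃) (WIdx nw nx) ℝ :=
  ftcV n₂ n₃ * sys.bcInput a b

def G₀ (n₁ n₂ n₃ : ℕ) (_s : ℝ) : Matrix (ZIdx n₁ n₂ n₃) (ZIdx n₁ n₂ n₃) ℝ :=
  Matrix.fromRows (row₃ 1 0 0) (Matrix.fromRows (row₃ 0 0 0) (row₃ 0 0 0))

def G₂ {nx nw ny n₁ n₂ n₃ : ℕ} (sys : ODEPDESystem nx nw ny n₁ n₂ n₃) (a b s θ : ℝ) :
    Matrix (ZIdx n₁ n₂ n₃) (ZIdx n₁ n₂ n₃) ℝ :=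
  -(ftcK n₁ n₂ n₃ a s * sys.bcKernel a b θ)

def G₁ {nx nw ny n₁ n₂ n₃ : ℕ} (sys : ODEPDESystem nx nw ny n₁ n₂ n₃) (a b s θ : ℝ) :
    Matrix (ZIdx n₁ n₂ n₃) (ZIdx n₁ n₂ n₃) ℝ :=
  Matrix.fromRows (row₃ 0 0 0) (Matrix.fromRows (row₃ 0 1 0) (row₃ 0 0 ((s - θ) • 1)))
    + sys.G₂ a b s θ

def G₃ (n₁ n₂ n₃ : ℕ) (_s : ℝ) : Matrix (DIdx n₂ n₃) (ZIdx n₁ n₂ n₃) ℝ :=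
  Matrix.fromRows (row₃ 0 1 0) (row₃ 0 0 0)

def G₅ {nx nw ny n₁ n₂ n₃ : ℕ} (sys : ODEPDESystem nx nw ny n₁ n₂ n₃) (a b : ℝ) (_s θ : ℝ) :
    Matrix (DIdx n₂ n₃) (ZIdx n₁ n₂ n₃) ℝ :=
  -(ftcV n₂ n₃ * sys.bcKernel a b θ)

def G₄ {nx nw ny n₁ n₂ n₃ : ℕ} (sys : ODEPDESystem nx nw ny n₁ n₂ n₃) (a b s θ : ℝ) :
    Matrix (DIdx n₂ n₃) (ZIdx n₁ n₂ n₃) ℝ :=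
  Matrix.fromRows (row₃ 0 0 0) (row₃ 0 0 1) + sys.G₅ a b s θ

/-- `I₀ = [I 0]`. -/
def I₀ (nw nx : ℕ) : Matrix (Fin nw) (WIdx nw nx) ℝ := Matrix.fromCols 1 0

/-- `I₁ = [0 I]`. -/
def I₁ (nw nx : ℕ) : Matrix (Fin nx) (WIdx nw nx) ℝ := Matrix.fromCols 0 1

/-- `[0, 0, H₀; G₀, G₁, G₂]`, taking `(w_r, z_f)` to `z`. -/
def primalTuple {nx nw ny n₁ n₂ n₃ : ℕ} (sys : ODEPDESystem nx nw ny n₁ n₂ n₃) (a b : ℝ) :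
    PQRS (WIdx nw nx) (ZIdx n₁ n₂ n₃) (Fin 0) (ZIdx n₁ n₂ n₃) :=
  ⟨0, 0, sys.H₀ a b, G₀ n₁ n₂ n₃, sys.G₁ a b, sys.G₂ a b⟩

/-- `[0, 0, H₁; G₃, G₄, G₅]`, taking `(w_r, z_f)` to `col(∂ₛz₂, ∂ₛz₃)`. -/
def derivTuple {nx nw ny n₁ n₂ n₃ : ℕ} (sys : ODEPDESystem nx nw ny n₁ n₂ n₃) (a b : ℝ) :
    PQRS (WIdx nw nx) (ZIdx n₁ n₂ n₃) (Fin 0) (DIdx n₂ n₃) :=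
  ⟨0, 0, sys.H₁ a b, G₃ n₁ n₂ n₃, sys.G₄ a b, sys.G₅ a b⟩

/-- `[T₁, T₂, 0; 0, 0, 0]` with `T₁ = T (BT)⁻¹ [B₂ B₁]` and `T₂(θ) = Q(θ) - T (BT)⁻¹ B Q(θ)`,
taking `(w_r, z_f)` to the vector `z_b`. -/
def bdryTuple {nx nw ny n₁ n₂ n₃ : ℕ} (sys : ODEPDESystem nx nw ny n₁ n₂ n₃) (a b : ℝ) :
    PQRS (WIdx nw nx) (ZIdx n₁ n₂ n₃) (BIdx n₂ n₃) (Fin 0) :=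
  ⟨bdryT n₂ n₃ a b * sys.bcInput a b,
    fun θ => bdryQ n₁ n₂ n₃ b θ - bdryT n₂ n₃ a b * sys.bcKernel a b θ, 0, 0, 0, 0⟩

/-- `[Â₀, Â₁, Â₂; Â₃, Â₄, Â₅]`. -/
def AHat {nx nw ny n₁ n₂ n₃ : ℕ} (sys : ODEPDESystem nx nw ny n₁ n₂ n₃) (a b : ℝ) :
    PQRS (WIdx nw nx) (ZIdx n₁ n₂ n₃) (Fin nx) (ZIdx n₁ n₂ n₃) :=
  PQRS.comp a b ⟨0, polyEval sys.Ea, 0, polyEval sys.A₀, 0, 0⟩ (sys.primalTuple a b)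
    + PQRS.comp a b ⟨0, polyEval sys.Eb, 0, polyEval sys.A₁, 0, 0⟩ (sys.derivTuple a b)
    + PQRS.comp a b ⟨sys.E₁, 0, 0, 0, 0, 0⟩ (sys.bdryTuple a b)
    + ⟨Matrix.fromCols 0 sys.A, 0, fun s => Matrix.fromCols 0 (polyEval sys.E s),
        fun s => row₃ 0 0 (polyEval sys.A₂ s), 0, 0⟩

/-- `[B̂₀, 0, B̂₂; 0, 0, 0]` with `B̂₀ = [B_wo 0]` and `B̂₂ = [B_wp 0]`. -/
def BHat {nx nw ny n₁ n₂ n₃ : ℕ} (sys : ODEPDESystem nx nw ny n₁ n₂ n₃) :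
    PQRS (WIdx nw nx) (ZIdx n₁ n₂ n₃) (Fin nx) (ZIdx n₁ n₂ n₃) :=
  ⟨Matrix.fromCols sys.Bwo 0, 0, fun s => Matrix.fromCols (polyEval sys.Bwp s) 0, 0, 0, 0⟩

/-- `[Ĉ₀, Ĉ₁, 0; 0, 0, 0]`. -/
def CHat {nx nw ny n₁ n₂ n₃ : ℕ} (sys : ODEPDESystem nx nw ny n₁ n₂ n₃) (a b : ℝ) :
    PQRS (WIdx nw nx) (ZIdx n₁ n₂ n₃) (Fin ny) (Fin 0) :=
  PQRS.comp a b ⟨0, polyEval sys.Ca, 0, 0, 0, 0⟩ (sys.primalTuple a b)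
    + PQRS.comp a b ⟨0, polyEval sys.Cb, 0, 0, 0, 0⟩ (sys.derivTuple a b)
    + PQRS.comp a b ⟨sys.C₁, 0, 0, 0, 0, 0⟩ (sys.bdryTuple a b)
    + ⟨Matrix.fromCols 0 sys.C, 0, 0, 0, 0, 0⟩

/-- `D̂₀ = [D_w 0]`. -/
def DHat {nx nw ny n₁ n₂ n₃ : ℕ} (sys : ODEPDESystem nx nw ny n₁ n₂ n₃) :
    Matrix (Fin ny) (WIdx nw nx) ℝ :=
  Matrix.fromCols sys.Dw 0

/-- `[K₀, K₁, K₂; K₃, K₄, K₅] = [I₁, 0, H₀; G₀, G₁, G₂]^* × [P, Q, Qᵀ; S, R₁, R₂]`. -/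
def KTuple {nx nw ny n₁ n₂ n₃ : ℕ} (sys : ODEPDESystem nx nw ny n₁ n₂ n₃) (a b : ℝ)
    (X : PQRS (Fin nx) (ZIdx n₁ n₂ n₃) (Fin nx) (ZIdx n₁ n₂ n₃)) :
    PQRS (Fin nx) (ZIdx n₁ n₂ n₃) (WIdx nw nx) (ZIdx n₁ n₂ n₃) :=
  PQRS.comp a b
    (PQRS.adj ⟨I₁ nw nx, 0, sys.H₀ a b, G₀ n₁ n₂ n₃, sys.G₁ a b, sys.G₂ a b⟩) X

/-- `J = K × (Â + B̂) - [(Ĉ₀ + D̂₀)ᵀ I₀, 0, Ĉ₁ᵀ I₀; 0, 0, 0]`, for a system with as many outputs as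
inputs. -/
def JTuple {nx m n₁ n₂ n₃ : ℕ} (sys : ODEPDESystem nx m m n₁ n₂ n₃) (a b : ℝ)
    (X : PQRS (Fin nx) (ZIdx n₁ n₂ n₃) (Fin nx) (ZIdx n₁ n₂ n₃)) :
    PQRS (WIdx m nx) (ZIdx n₁ n₂ n₃) (WIdx m nx) (ZIdx n₁ n₂ n₃) :=
  PQRS.comp a b (sys.KTuple a b X) (sys.AHat a b + sys.BHat)
    - ⟨((sys.CHat a b).P + sys.DHat).transpose * I₀ m nx, 0,
        fun s => ((sys.CHat a b).Q₁ s).transpose * I₀ m nx, 0, 0, 0⟩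

end ODEPDESystem

end

/-!
The proof is a dissipation argument. A PQRS tuple `X` acts on `ℝ^m × L₂[a,b]` with components
`PQRS.fst` and `PQRS.snd`, and `PQRS.form` is the bilinear form of this operator. The two triangular
kernels `R₁`, `R₂` are treated as one bounded kernel `PQRS.kern` on the square. By Fubini's theorem,
the tuple product then represents composition (`PQRS.fst_comp`, `PQRS.snd_comp`) and the adjoint
tuple represents the adjoint (`PQRS.form_adj`).

A Gram tuple factors as `F^* (g T) F` (`gramTuple_eq_comp`), so its form is `∫ g vᵀ T v`. Hence the
members of `Φ_d` have symmetric, nonnegative forms (`form_comm_of_mem_phiCone`,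
`form_nonneg_of_mem_phiCone`). In particular the tuple `X = [P, Q, Qᵀ; S, R₁, R₂]` gives a
self-adjoint nonnegative operator `𝒫`, which is bounded by the Hellinger–Toeplitz theorem, and
`V = ½ ⟨(x, z), 𝒫 (x, z)⟩` is a storage function.

The fundamental theorem of calculus and the invertibility of `B T` recover `z`, its first
derivatives and its boundary values from `w_r = (w, x)` and the fundamental state
`z_f = (z₁, ∂ₛz₂, ∂ₛ²z₃)` (`snd_primalTuple`, `snd_derivTuple`, `fst_bdryTuple`). Therefore `Â + B̂`
represents the right-hand sides of the equations, and the quadratic form of `J` at `(w_r, z_f)` is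
`dV/dt - wᵀ y` (`form_JTuple`). It is nonpositive because `-J - J^*` lies in the cone. Since the
state is absolutely continuous, so is `V`; integrating `dV/dt ≤ wᵀ y` from `V(0) = 0` gives
`0 ≤ V(τ) ≤ ∫_0^τ wᵀ y`, and `τ → ∞` finishes the proof.
-/

noncomputable section

/-! ### Square-integrable vector functions and bounded kernels -/

/-- Lebesgue measure on `[a, b]`. -/
abbrev lebIcc (a b : ℝ) : Measure ℝ := (volume : Measure ℝ).restrict (Set.Icc a b)

/-- All components of `z` are square integrable on `[a, b]`. -/
def L2Vec {n : Type} (a b : ℝ) (z : ℝ → n → ℝ) : Prop :=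
  ∀ j, MemLp (fun s => z s j) 2 (lebIcc a b)

theorem memLp_mul_of_continuous {a b : ℝ} {f g : ℝ → ℝ} (hf : Continuous f)
    (hg : MemLp g 2 (lebIcc a b)) : MemLp (fun s => f s * g s) 2 (lebIcc a b) := by
  obtain ⟨C, hC⟩ := isCompact_Icc.exists_bound_of_continuousOn (s := Set.Icc a b) hf.continuousOn
  refine hg.of_le_mul (c := C) (hf.aestronglyMeasurable.mul hg.1) ?_
  filter_upwards [ae_restrict_mem measurableSet_Icc] with s hs
  rw [norm_mul]
  exact mul_le_mul_of_nonneg_right (hC s hs) (norm_nonneg _)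

theorem dotProduct_integral {n : Type} [Fintype n] {μ : Measure ℝ} {z : ℝ → n → ℝ} (v : n → ℝ)
    (hz : ∀ j, Integrable (fun s => z s j) μ) :
    v ⬝ᵥ (fun j => ∫ s, z s j ∂μ) = ∫ s, v ⬝ᵥ z s ∂μ := by
  simp only [dotProduct]
  rw [integral_finsetSum _ fun j _ => (hz j).const_mul _]
  simp only [integral_const_mul]

namespace L2Vec

theorem integrable {n : Type} {a b : ℝ} {z : ℝ → n → ℝ} (hz : L2Vec a b z) (j : n) :
    Integrable (fun s => z s j) (lebIcc a b) :=
  (hz j).integrable (by norm_num)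

theorem of_continuousOn {n : Type} {a b : ℝ} {z : ℝ → n → ℝ}
    (hz : ContinuousOn z (Set.Icc a b)) : L2Vec a b z := by
  intro j
  have hj : ContinuousOn (fun s => z s j) (Set.Icc a b) :=
    (continuous_apply j).comp_continuousOn hz
  obtain ⟨C, hC⟩ := isCompact_Icc.exists_bound_of_continuousOn hj
  exact MemLp.of_bound (hj.aestronglyMeasurable measurableSet_Icc) C
    ((ae_restrict_mem measurableSet_Icc).mono hC)

theorem of_continuous {n : Type} {a b : ℝ} {z : ℝ → n → ℝ} (hz : Continuous z) : L2Vec a b z :=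
  of_continuousOn hz.continuousOn

theorem add {n : Type} {a b : ℝ} {z z' : ℝ → n → ℝ} (hz : L2Vec a b z) (hz' : L2Vec a b z') :
    L2Vec a b fun s => z s + z' s :=
  fun j => (hz j).add (hz' j)

theorem dotProduct_integrable {n : Type} [Fintype n] {a b : ℝ} {u z : ℝ → n → ℝ}
    (hu : L2Vec a b u) (hz : L2Vec a b z) :
    Integrable (fun s => u s ⬝ᵥ z s) (lebIcc a b) :=
  integrable_finsetSum _ fun j _ => (hu j).integrable_mul (hz j)

theorem mulVec {n q : Type} [Fintype q] {a b : ℝ} {z : ℝ → q → ℝ} (hz : L2Vec a b z)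
    {M : ℝ → Matrix n q ℝ} (hM : Continuous M) :
    L2Vec a b fun s => (M s).mulVec (z s) := fun i =>
  memLp_finsetSum _ fun j _ => memLp_mul_of_continuous (hM.matrix_elem i j) (hz j)

end L2Vec

/-- A measurable matrix kernel which is bounded on `[a, b] × [a, b]`. -/
structure IsBddKernel {n q : Type} (a b : ℝ) (k : ℝ → ℝ → Matrix n q ℝ) : Prop where
  meas : ∀ i j, Measurable fun p : ℝ × ℝ => k p.1 p.2 i j
  bdd : ∃ C, ∀ s ∈ Set.Icc a b, ∀ θ ∈ Set.Icc a b, ∀ i j, |k s θ i j| ≤ C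

/-- The integral operator `z ↦ ∫_a^b k(·, θ) z(θ) dθ`. -/
def kernelInt {n q : Type} [Fintype q] (a b : ℝ) (k : ℝ → ℝ → Matrix n q ℝ) (z : ℝ → q → ℝ)
    (s : ℝ) : n → ℝ :=
  fun i => ∫ θ, (k s θ).mulVec (z θ) i ∂lebIcc a b

namespace IsBddKernel

theorem transpose {n q : Type} {a b : ℝ} {k : ℝ → ℝ → Matrix n q ℝ} (hk : IsBddKernel a b k) :
    IsBddKernel a b fun s θ => (k θ s).transpose := by
  obtain ⟨C, hC⟩ := hk.bdd
  exact ⟨fun i j => (hk.meas j i).comp measurable_swap,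
    C, fun s hs θ hθ i j => hC θ hθ s hs j i⟩

theorem row {n q : Type} {a b : ℝ} {k : ℝ → ℝ → Matrix n q ℝ} (hk : IsBddKernel a b k) {s : ℝ}
    (hs : s ∈ Set.Icc a b) (i : n) : L2Vec a b fun θ => k s θ i := by
  obtain ⟨C, hC⟩ := hk.bdd
  intro j
  refine MemLp.of_bound ((hk.meas i j).comp measurable_prodMk_left).aestronglyMeasurable C ?_
  filter_upwards [ae_restrict_mem measurableSet_Icc] with θ hθ
  exact hC s hs θ hθ i j

theorem integrable_prod {n q : Type} [Fintype n] [Fintype q] {a b : ℝ}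
    {k : ℝ → ℝ → Matrix n q ℝ} (hk : IsBddKernel a b k) {u : ℝ → n → ℝ} {z : ℝ → q → ℝ}
    (hu : L2Vec a b u) (hz : L2Vec a b z) :
    Integrable (fun p : ℝ × ℝ => u p.1 ⬝ᵥ (k p.1 p.2).mulVec (z p.2))
      ((lebIcc a b).prod (lebIcc a b)) := by
  obtain ⟨C, hC⟩ := hk.bdd
  have h : ∀ i j, Integrable (fun p : ℝ × ℝ => k p.1 p.2 i j * (u p.1 i * z p.2 j))
      ((lebIcc a b).prod (lebIcc a b)) := by
    intro i j
    refine ((hu.integrable i).mul_prod (hz.integrable j)).bdd_mul (c := C)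
      (hk.meas i j).aestronglyMeasurable ?_
    rw [Measure.prod_restrict]
    filter_upwards [ae_restrict_mem (measurableSet_Icc.prod measurableSet_Icc)] with p hp
    exact hC _ hp.1 _ hp.2 i j
  refine (integrable_finsetSum Finset.univ fun i _ =>
    integrable_finsetSum Finset.univ fun j _ => h i j).congr (Filter.Eventually.of_forall ?_)
  intro p
  simp only [dotProduct, Matrix.mulVec, Finset.mul_sum]
  refine Finset.sum_congr rfl fun i _ => Finset.sum_congr rfl fun j _ => ?_
  ring

theorem integrable_mulVec {n q : Type} [Fintype q] {a b : ℝ} {k : ℝ → ℝ → Matrix n q ℝ}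
    (hk : IsBddKernel a b k) {z : ℝ → q → ℝ} (hz : L2Vec a b z) {s : ℝ}
    (hs : s ∈ Set.Icc a b) (i : n) :
    Integrable (fun θ => (k s θ).mulVec (z θ) i) (lebIcc a b) :=
  (hk.row hs i).dotProduct_integrable hz

theorem l2Vec {n q : Type} [Fintype n] [Fintype q] {a b : ℝ} {k : ℝ → ℝ → Matrix n q ℝ}
    (hk : IsBddKernel a b k) {z : ℝ → q → ℝ} (hz : L2Vec a b z) :
    L2Vec a b (kernelInt a b k z) := by
  classical
  obtain ⟨C, hC⟩ := hk.bdd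
  intro i
  refine MemLp.of_bound ?_ (∫ θ, ∑ j, C * |z θ j| ∂lebIcc a b) ?_
  · have := (hk.integrable_prod (u := fun _ => Pi.single i 1)
      (L2Vec.of_continuous continuous_const) hz).1.integral_prod_right'
    simpa only [single_one_dotProduct] using! this
  · filter_upwards [ae_restrict_mem measurableSet_Icc] with s hs
    refine norm_integral_le_of_norm_le
      (integrable_finsetSum _ fun j _ => (hz.integrable j).abs.const_mul C) ?_
    filter_upwards [ae_restrict_mem measurableSet_Icc] with θ hθ
    refine (norm_sum_le _ _).trans (Finset.sum_le_sum fun j _ => ?_)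
    rw [norm_mul]
    exact mul_le_mul_of_nonneg_right (hC s hs θ hθ i j) (abs_nonneg _)

/-- Fubini's theorem for the bilinear form of a bounded kernel. -/
theorem integral_dotProduct_kernelInt {n q : Type} [Fintype n] [Fintype q] {a b : ℝ}
    {k : ℝ → ℝ → Matrix n q ℝ} (hk : IsBddKernel a b k) {u : ℝ → n → ℝ} {z : ℝ → q → ℝ}
    (hu : L2Vec a b u) (hz : L2Vec a b z) :
    ∫ s, u s ⬝ᵥ kernelInt a b k z s ∂lebIcc a b
      = ∫ θ, kernelInt a b (fun θ s => (k s θ).transpose) u θ ⬝ᵥ z θ ∂lebIcc a b := by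
  have h₁ : ∫ s, u s ⬝ᵥ kernelInt a b k z s ∂lebIcc a b
      = ∫ s, ∫ θ, u s ⬝ᵥ (k s θ).mulVec (z θ) ∂lebIcc a b ∂lebIcc a b := by
    refine integral_congr_ae ?_
    filter_upwards [ae_restrict_mem measurableSet_Icc] with s hs
    exact dotProduct_integral _ (hk.integrable_mulVec hz hs)
  have h₂ : ∫ θ, kernelInt a b (fun θ s => (k s θ).transpose) u θ ⬝ᵥ z θ ∂lebIcc a b
      = ∫ θ, ∫ s, u s ⬝ᵥ (k s θ).mulVec (z θ) ∂lebIcc a b ∂lebIcc a b := by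
    refine integral_congr_ae ?_
    filter_upwards [ae_restrict_mem measurableSet_Icc] with θ hθ
    rw [dotProduct_comm]
    refine (dotProduct_integral _ (hk.transpose.integrable_mulVec hu hθ)).trans ?_
    refine integral_congr_ae (Filter.Eventually.of_forall fun s => ?_)
    simp only [Matrix.mulVec_transpose, Matrix.dotProduct_mulVec, dotProduct_comm (z θ)]
  rw [h₁, h₂]
  exact integral_integral_swap (hk.integrable_prod hu hz)

end IsBddKernel

/-! ### Splitting integrals at the diagonal -/

theorem integral_lebIcc {a b : ℝ} (hab : a ≤ b) (f : ℝ → ℝ) :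
    ∫ s, f s ∂lebIcc a b = ∫ s in a..b, f s := by
  rw [intervalIntegral.integral_of_le hab, integral_Icc_eq_integral_Ioc]

theorem integral_lebIcc_split₃ {a b c d : ℝ} {h f₁ f₂ f₃ : ℝ → ℝ} (hac : a ≤ c) (hcd : c ≤ d)
    (hdb : d ≤ b) (hf₁ : Continuous f₁) (hf₂ : Continuous f₂) (hf₃ : Continuous f₃)
    (h₁ : Set.EqOn f₁ h (Set.Ioo a c)) (h₂ : Set.EqOn f₂ h (Set.Ioo c d))
    (h₃ : Set.EqOn f₃ h (Set.Ioo d b)) :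
    ∫ s, h s ∂lebIcc a b
      = (∫ s in a..c, f₁ s) + (∫ s in c..d, f₂ s) + ∫ s in d..b, f₃ s := by
  rw [integral_lebIcc (hac.trans (hcd.trans hdb)),
    intervalIntegral.integral_congr_Ioo_of_le hac h₁,
    intervalIntegral.integral_congr_Ioo_of_le hcd h₂,
    intervalIntegral.integral_congr_Ioo_of_le hdb h₃]
  have i₁ := (hf₁.intervalIntegrable (μ := volume) a c).congr_uIoo (Set.uIoo_of_le hac ▸ h₁)
  have i₂ := (hf₂.intervalIntegrable (μ := volume) c d).congr_uIoo (Set.uIoo_of_le hcd ▸ h₂)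
  have i₃ := (hf₃.intervalIntegrable (μ := volume) d b).congr_uIoo (Set.uIoo_of_le hdb ▸ h₃)
  rw [intervalIntegral.integral_add_adjacent_intervals i₁ i₂,
    intervalIntegral.integral_add_adjacent_intervals (i₁.trans i₂) i₃]

theorem integral_lebIcc_split₂ {a b c : ℝ} {h f₁ f₂ : ℝ → ℝ} (hc : c ∈ Set.Icc a b)
    (hf₁ : Continuous f₁) (hf₂ : Continuous f₂)
    (h₁ : Set.EqOn f₁ h (Set.Ioo a c)) (h₂ : Set.EqOn f₂ h (Set.Ioo c b)) :
    ∫ s, h s ∂lebIcc a b = (∫ s in a..c, f₁ s) + ∫ s in c..b, f₂ s := by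
  rw [integral_lebIcc_split₃ hc.1 le_rfl hc.2 hf₁ hf₁ hf₂ h₁ (by simp) h₂]
  simp

/-! ### The operator represented by a PQRS tuple -/

theorem continuous_matIntegral {α β X : Type} [TopologicalSpace X]
    {F : X → ℝ → Matrix α β ℝ} (hF : Continuous fun p : X × ℝ => F p.1 p.2) {c d : X → ℝ}
    (hc : Continuous c) (hd : Continuous d) :
    Continuous fun x => matIntegral (c x) (d x) (F x) := by
  refine continuous_matrix fun i j => ?_
  have h : Continuous (Function.uncurry fun (x : X) (θ : ℝ) => F x θ i j) :=
    hF.matrix_elem i j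
  have e : (fun x => matIntegral (c x) (d x) (F x) i j)
      = fun x => (∫ θ in (0 : ℝ)..d x, F x θ i j) - ∫ θ in (0 : ℝ)..c x, F x θ i j := by
    funext x
    have hx : Continuous fun θ => F x θ i j := h.comp (Continuous.prodMk_right x)
    exact (intervalIntegral.integral_interval_sub_left (hx.intervalIntegrable _ _)
      (hx.intervalIntegrable _ _)).symm
  rw [e]
  exact (intervalIntegral.continuous_parametric_intervalIntegral_of_continuous h hd).sub
    (intervalIntegral.continuous_parametric_intervalIntegral_of_continuous h hc)

theorem matIntegral_mulVec {α β : Type} [Fintype β] {c d : ℝ} {M : ℝ → Matrix α β ℝ}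
    (hM : Continuous M) (v : β → ℝ) (i : α) :
    (matIntegral c d M).mulVec v i = ∫ θ in c..d, (M θ).mulVec v i := by
  simp only [Matrix.mulVec, dotProduct, matIntegral, Matrix.of_apply]
  have h : ∀ j ∈ Finset.univ, IntervalIntegrable (fun θ => M θ i j * v j) volume c d :=
    fun j _ => ((hM.matrix_elem i j).mul continuous_const).intervalIntegrable _ _
  rw [intervalIntegral.integral_finsetSum h]
  simp only [intervalIntegral.integral_mul_const]

namespace PQRS

/-- All components of the tuple are continuous. -/
structure IsCont {m q n r : Type} (X : PQRS m q n r) : Prop where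
  Q₁ : Continuous X.Q₁
  Q₂ : Continuous X.Q₂
  S : Continuous X.S
  R₁ : Continuous fun p : ℝ × ℝ => X.R₁ p.1 p.2
  R₂ : Continuous fun p : ℝ × ℝ => X.R₂ p.1 p.2

/-- The integral kernel of the tuple: `R₁` below the diagonal and `R₂` above it. -/
def kern {m q n r : Type} (X : PQRS m q n r) (s θ : ℝ) : Matrix r q ℝ :=
  if θ ≤ s then X.R₁ s θ else X.R₂ s θ

/-- The first component of the operator represented by the tuple. -/
def fst {m q n r : Type} [Fintype m] [Fintype q] (X : PQRS m q n r) (a b : ℝ) (x : m → ℝ)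
    (z : ℝ → q → ℝ) : n → ℝ :=
  fun i => X.P.mulVec x i + ∫ s, (X.Q₁ s).mulVec (z s) i ∂lebIcc a b

/-- The second component of the operator represented by the tuple. -/
def snd {m q n r : Type} [Fintype m] [Fintype q] (X : PQRS m q n r) (a b : ℝ) (x : m → ℝ)
    (z : ℝ → q → ℝ) (s : ℝ) : r → ℝ :=
  (X.Q₂ s).mulVec x + (X.S s).mulVec (z s) + kernelInt a b X.kern z s

/-- The bilinear form of the tuple, the `ℝ^n × L₂` inner product of `(p, u)` with the image of
`(x, z)`. -/
def form {m q n r : Type} [Fintype m] [Fintype q] [Fintype n] [Fintype r] (X : PQRS m q n r)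
    (a b : ℝ) (p : n → ℝ) (u : ℝ → r → ℝ) (x : m → ℝ) (z : ℝ → q → ℝ) : ℝ :=
  p ⬝ᵥ X.fst a b x z + ∫ s, u s ⬝ᵥ X.snd a b x z s ∂lebIcc a b

theorem IsCont.kern {m q n r : Type} [Finite q] [Finite r] {X : PQRS m q n r} (hX : X.IsCont)
    (a b : ℝ) : IsBddKernel a b X.kern := by
  have hb : ∀ {M : ℝ × ℝ → Matrix r q ℝ}, Continuous M →
      ∃ C, ∀ p ∈ Set.Icc a b ×ˢ Set.Icc a b, ∀ i j, |M p i j| ≤ C := by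
    intro M hM
    have h : ∀ ij : r × q, ∃ C, ∀ p ∈ Set.Icc a b ×ˢ Set.Icc a b, |M p ij.1 ij.2| ≤ C :=
      fun ij => (isCompact_Icc.prod isCompact_Icc).exists_bound_of_continuousOn
        (hM.matrix_elem ij.1 ij.2).continuousOn
    choose C hC using h
    obtain ⟨D, hD⟩ := (Set.finite_range C).bddAbove
    exact ⟨D, fun p hp i j => (hC (i, j) p hp).trans (hD ⟨(i, j), rfl⟩)⟩
  constructor
  · intro i j
    have h : (fun p : ℝ × ℝ => X.kern p.1 p.2 i j)
        = fun p => if p.2 ≤ p.1 then X.R₁ p.1 p.2 i j else X.R₂ p.1 p.2 i j := by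
      funext p
      rw [PQRS.kern]
      split_ifs <;> rfl
    rw [h]
    exact Measurable.ite (measurableSet_le measurable_snd measurable_fst)
      (hX.R₁.matrix_elem i j).measurable (hX.R₂.matrix_elem i j).measurable
  · obtain ⟨C, hC⟩ := hb hX.R₁
    obtain ⟨D, hD⟩ := hb hX.R₂
    refine ⟨max C D, fun s hs θ hθ i j => ?_⟩
    rw [PQRS.kern]
    split_ifs
    · exact (hC (s, θ) ⟨hs, hθ⟩ i j).trans (le_max_left _ _)
    · exact (hD (s, θ) ⟨hs, hθ⟩ i j).trans (le_max_right _ _)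

theorem IsCont.snd {m q n r : Type} [Fintype m] [Fintype q] [Fintype r]
    {X : PQRS m q n r} (hX : X.IsCont) {a b : ℝ} (x : m → ℝ) {z : ℝ → q → ℝ}
    (hz : L2Vec a b z) : L2Vec a b (X.snd a b x z) :=
  ((L2Vec.of_continuous (hX.Q₂.matrix_mulVec continuous_const)).add (hz.mulVec hX.S)).add
    ((hX.kern a b).l2Vec hz)

/-- The bilinear form as a sum over the components of the tuple. -/
theorem form_eq {m q n r : Type} [Fintype m] [Fintype q] [Fintype n] [Fintype r]
    {X : PQRS m q n r} (hX : X.IsCont) {a b : ℝ} (p : n → ℝ) {u : ℝ → r → ℝ}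
    (hu : L2Vec a b u) (x : m → ℝ) {z : ℝ → q → ℝ} (hz : L2Vec a b z) :
    X.form a b p u x z = p ⬝ᵥ X.P.mulVec x + (∫ s, p ⬝ᵥ (X.Q₁ s).mulVec (z s) ∂lebIcc a b)
      + (∫ s, u s ⬝ᵥ (X.Q₂ s).mulVec x ∂lebIcc a b)
      + (∫ s, u s ⬝ᵥ (X.S s).mulVec (z s) ∂lebIcc a b)
      + ∫ s, u s ⬝ᵥ kernelInt a b X.kern z s ∂lebIcc a b := by
  have h₁ : p ⬝ᵥ X.fst a b x z
      = p ⬝ᵥ X.P.mulVec x + ∫ s, p ⬝ᵥ (X.Q₁ s).mulVec (z s) ∂lebIcc a b := by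
    rw [← dotProduct_integral _ (hz.mulVec hX.Q₁).integrable, ← dotProduct_add]
    rfl
  have i₁ := hu.dotProduct_integrable
    (L2Vec.of_continuous (hX.Q₂.matrix_mulVec (continuous_const (y := x))))
  have i₂ := hu.dotProduct_integrable (hz.mulVec hX.S)
  have i₃ := hu.dotProduct_integrable ((hX.kern a b).l2Vec hz)
  rw [form, h₁]
  simp only [PQRS.snd, dotProduct_add]
  rw [integral_add (i₁.fun_add i₂) i₃, integral_add i₁ i₂]
  ring

theorem kern_adj {m q n r : Type} (X : PQRS m q n r) {s θ : ℝ} (h : s ≠ θ) :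
    X.adj.kern s θ = (X.kern θ s).transpose := by
  rcases lt_or_gt_of_ne h with h | h <;> simp [kern, adj, h.le, h.not_ge]

theorem IsCont.adj {m q n r : Type} {X : PQRS m q n r} (hX : X.IsCont) : X.adj.IsCont where
  Q₁ := hX.Q₂.matrix_transpose
  Q₂ := hX.Q₁.matrix_transpose
  S := hX.S.matrix_transpose
  R₁ := (hX.R₂.comp continuous_swap).matrix_transpose
  R₂ := (hX.R₁.comp continuous_swap).matrix_transpose

theorem kernelInt_kern_adj {m q n r : Type} [Fintype r] (X : PQRS m q n r) (a b : ℝ)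
    (u : ℝ → r → ℝ) (s : ℝ) :
    kernelInt a b X.adj.kern u s = kernelInt a b (fun s θ => (X.kern θ s).transpose) u s := by
  funext i
  refine integral_congr_ae ?_
  filter_upwards [Measure.ae_ne (lebIcc a b) s] with θ hθ
  rw [kern_adj X hθ.symm]

/-- The adjoint tuple represents the adjoint operator; its kernel is the transposed kernel off the
diagonal, a null set. -/
theorem form_adj {m q n r : Type} [Fintype m] [Fintype q] [Fintype n] [Fintype r]
    {X : PQRS m q n r} (hX : X.IsCont) {a b : ℝ} (p : n → ℝ) {u : ℝ → r → ℝ}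
    (hu : L2Vec a b u) (x : m → ℝ) {z : ℝ → q → ℝ} (hz : L2Vec a b z) :
    X.adj.form a b x z p u = X.form a b p u x z := by
  have key : ∀ {α β : Type} [Fintype α] [Fintype β] (M : Matrix α β ℝ) (v : α → ℝ) (w : β → ℝ),
      w ⬝ᵥ M.transpose.mulVec v = v ⬝ᵥ M.mulVec w := fun M v w => by
    rw [Matrix.mulVec_transpose, Matrix.dotProduct_mulVec, dotProduct_comm]
  rw [form_eq hX.adj _ hz _ hu, form_eq hX _ hu _ hz,
    (hX.kern a b).integral_dotProduct_kernelInt hu hz]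
  simp only [kernelInt_kern_adj]
  simp only [adj, key, dotProduct_comm (kernelInt a b _ u _)]
  ring

end PQRS

/-! ### Products of tuples -/

namespace PQRS

/-- The kernel of a product: the formulas for `R̂₁` and `R̂₂` are one integral over `[a, b]`, split
where the kernels of the factors cross their diagonals. -/
theorem kern_comp_apply {m q n r k l : Type} [Fintype n] [Fintype r] [Fintype q] {a b : ℝ}
    {X : PQRS n r k l} (hX : X.IsCont) {Y : PQRS m q n r} (hY : Y.IsCont) {s η : ℝ}
    (hs : s ∈ Set.Icc a b) (hη : η ∈ Set.Icc a b) (i : l) (j : q) :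
    (comp a b X Y).kern s η i j = (X.Q₂ s * Y.Q₁ η) i j + (X.S s * Y.kern s η) i j
      + (X.kern s η * Y.S η) i j + ∫ θ, (X.kern s θ * Y.kern θ η) i j ∂lebIcc a b := by
  have c₁ : Continuous fun θ => X.R₁ s θ := hX.R₁.comp (Continuous.prodMk_right s)
  have c₂ : Continuous fun θ => X.R₂ s θ := hX.R₂.comp (Continuous.prodMk_right s)
  have d₁ : Continuous fun θ => Y.R₁ θ η := hY.R₁.comp (Continuous.prodMk_left η)
  have d₂ : Continuous fun θ => Y.R₂ θ η := hY.R₂.comp (Continuous.prodMk_left η)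
  by_cases h : η ≤ s
  · rw [integral_lebIcc_split₃ (f₁ := fun θ => (X.R₁ s θ * Y.R₂ θ η) i j)
      (f₂ := fun θ => (X.R₁ s θ * Y.R₁ θ η) i j) (f₃ := fun θ => (X.R₂ s θ * Y.R₁ θ η) i j)
      hη.1 h hs.2 ((c₁.matrix_mul d₂).matrix_elem i j) ((c₁.matrix_mul d₁).matrix_elem i j)
      ((c₂.matrix_mul d₁).matrix_elem i j)]
    · simp only [kern, comp, h, if_true, Matrix.add_apply, matIntegral, Matrix.of_apply]
      ring
    · intro θ hθ
      simp [kern, hθ.2.not_ge, (hθ.2.trans_le h).le]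
    · intro θ hθ
      simp [kern, hθ.1.le, hθ.2.le]
    · intro θ hθ
      simp [kern, (h.trans_lt hθ.1).le, hθ.1.not_ge]
  · have h' : s ≤ η := (not_le.1 h).le
    rw [integral_lebIcc_split₃ (f₁ := fun θ => (X.R₁ s θ * Y.R₂ θ η) i j)
      (f₂ := fun θ => (X.R₂ s θ * Y.R₂ θ η) i j) (f₃ := fun θ => (X.R₂ s θ * Y.R₁ θ η) i j)
      hs.1 h' hη.2 ((c₁.matrix_mul d₂).matrix_elem i j) ((c₂.matrix_mul d₂).matrix_elem i j)
      ((c₂.matrix_mul d₁).matrix_elem i j)]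
    · simp only [kern, comp, h, if_false, Matrix.add_apply, matIntegral, Matrix.of_apply]
      ring
    · intro θ hθ
      simp [kern, (hθ.2.trans_le h').not_ge, hθ.2.le]
    · intro θ hθ
      simp [kern, hθ.1.not_ge, hθ.2.not_ge]
    · intro θ hθ
      simp [kern, (h'.trans_lt hθ.1).not_ge, hθ.1.le]

/-- Row `i` of `A`, integrated against a transposed kernel, is row `i` of `∫ A k`. -/
theorem kernelInt_transpose_apply {n q l : Type} [Fintype n] (a b : ℝ) (A : ℝ → Matrix l n ℝ)
    (k : ℝ → ℝ → Matrix n q ℝ) (i : l) (j : q) (s : ℝ) :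
    kernelInt a b (fun s θ => (k θ s).transpose) (fun θ => A θ i) s j
      = ∫ θ, (A θ * k θ s) i j ∂lebIcc a b := by
  simp only [kernelInt, Matrix.mulVec_transpose]
  rfl

theorem mulVec_mul_apply {l n q : Type} [Fintype n] [Fintype q] (A : Matrix l n ℝ)
    (B : Matrix n q ℝ) (v : q → ℝ) (i : l) : (A * B).mulVec v i = A i ⬝ᵥ B.mulVec v := by
  rw [← Matrix.mulVec_mulVec]
  rfl

/-- The component `Q̂₁` of a product in terms of the kernel of the second factor. -/
theorem Q₁_comp_apply {m q n r k l : Type} [Fintype n] [Fintype r] {a b : ℝ}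
    {X : PQRS n r k l} (hX : X.IsCont) {Y : PQRS m q n r} (hY : Y.IsCont) {s : ℝ}
    (hs : s ∈ Set.Icc a b) (i : k) (j : q) :
    (comp a b X Y).Q₁ s i j = (X.P * Y.Q₁ s) i j + (X.Q₁ s * Y.S s) i j
      + ∫ η, (X.Q₁ η * Y.kern η s) i j ∂lebIcc a b := by
  have d₁ : Continuous fun θ => Y.R₁ θ s := hY.R₁.comp (Continuous.prodMk_left s)
  have d₂ : Continuous fun θ => Y.R₂ θ s := hY.R₂.comp (Continuous.prodMk_left s)
  rw [integral_lebIcc_split₂ (f₁ := fun θ => (X.Q₁ θ * Y.R₂ θ s) i j)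
      (f₂ := fun θ => (X.Q₁ θ * Y.R₁ θ s) i j) hs ((hX.Q₁.matrix_mul d₂).matrix_elem i j)
      ((hX.Q₁.matrix_mul d₁).matrix_elem i j)]
  · simp only [comp, Matrix.add_apply, matIntegral, Matrix.of_apply]
    ring
  · intro θ hθ
    simp [kern, hθ.2.not_ge]
  · intro θ hθ
    simp [kern, hθ.1.le]

/-- The component `Q̂₂` of a product in terms of the kernel of the first factor. -/
theorem Q₂_comp_mulVec {m q n r k l : Type} [Fintype m] [Fintype n] [Fintype r] {a b : ℝ}
    {X : PQRS n r k l} (hX : X.IsCont) {Y : PQRS m q n r} (hY : Y.IsCont) {s : ℝ}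
    (hs : s ∈ Set.Icc a b) (x : m → ℝ) (i : l) :
    ((comp a b X Y).Q₂ s).mulVec x i = X.Q₂ s i ⬝ᵥ Y.P.mulVec x
      + X.S s i ⬝ᵥ (Y.Q₂ s).mulVec x
      + ∫ η, X.kern s η i ⬝ᵥ (Y.Q₂ η).mulVec x ∂lebIcc a b := by
  have c₁ : Continuous fun θ => X.R₁ s θ := hX.R₁.comp (Continuous.prodMk_right s)
  have c₂ : Continuous fun θ => X.R₂ s θ := hX.R₂.comp (Continuous.prodMk_right s)
  have e₁ := c₁.matrix_mul hY.Q₂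
  have e₂ := c₂.matrix_mul hY.Q₂
  rw [integral_lebIcc_split₂ (f₁ := fun θ => (X.R₁ s θ * Y.Q₂ θ).mulVec x i)
      (f₂ := fun θ => (X.R₂ s θ * Y.Q₂ θ).mulVec x i) hs
      ((continuous_apply i).comp (e₁.matrix_mulVec continuous_const))
      ((continuous_apply i).comp (e₂.matrix_mulVec continuous_const)),
      ← matIntegral_mulVec e₁, ← matIntegral_mulVec e₂]
  · simp only [comp, Matrix.add_mulVec, Pi.add_apply, mulVec_mul_apply]
    ring
  · intro θ hθ
    simp only [kern, hθ.2.le, if_true, mulVec_mul_apply]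
  · intro θ hθ
    simp only [kern, hθ.1.not_ge, if_false, mulVec_mul_apply]

/-- The expanded bilinear form, with the variable of `z` integrated last. -/
theorem form_eq_fubini {m q n r : Type} [Fintype m] [Fintype q] [Fintype n] [Fintype r]
    {X : PQRS m q n r} (hX : X.IsCont) {a b : ℝ} (p : n → ℝ) {u : ℝ → r → ℝ}
    (hu : L2Vec a b u) (x : m → ℝ) {z : ℝ → q → ℝ} (hz : L2Vec a b z) :
    X.form a b p u x z = p ⬝ᵥ X.P.mulVec x + (∫ s, u s ⬝ᵥ (X.Q₂ s).mulVec x ∂lebIcc a b)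
      + ∫ s, (p ⬝ᵥ (X.Q₁ s).mulVec (z s) + u s ⬝ᵥ (X.S s).mulVec (z s)
        + kernelInt a b (fun s θ => (X.kern θ s).transpose) u s ⬝ᵥ z s) ∂lebIcc a b := by
  have i₁ := (L2Vec.of_continuous (continuous_const (y := p))).dotProduct_integrable
    (hz.mulVec hX.Q₁)
  have i₂ := hu.dotProduct_integrable (hz.mulVec hX.S)
  have i₃ := ((hX.kern a b).transpose.l2Vec hu).dotProduct_integrable hz
  rw [form_eq hX _ hu _ hz, (hX.kern a b).integral_dotProduct_kernelInt hu hz,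
    integral_add (i₁.fun_add i₂) i₃, integral_add i₁ i₂]
  ring

/-- A product represents the composition: first component. The `i`-th entry of the image under `X`
is the form of `Y` at the `i`-th rows of `X.P` and `X.Q₁`. -/
theorem fst_comp {m q n r k l : Type} [Fintype m] [Fintype q] [Fintype n] [Fintype r] {a b : ℝ}
    (hab : a ≤ b) {X : PQRS n r k l} (hX : X.IsCont) {Y : PQRS m q n r} (hY : Y.IsCont)
    (x : m → ℝ) {z : ℝ → q → ℝ} (hz : L2Vec a b z) :
    (comp a b X Y).fst a b x z = X.fst a b (Y.fst a b x z) (Y.snd a b x z) := by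
  funext i
  have hu : L2Vec a b fun s => X.Q₁ s i := L2Vec.of_continuous
    ((continuous_apply i).comp hX.Q₁)
  refine Eq.trans ?_ (form_eq_fubini hY (X.P i) hu x hz).symm
  have h₁ : (comp a b X Y).P.mulVec x i = X.P i ⬝ᵥ Y.P.mulVec x
      + ∫ s, X.Q₁ s i ⬝ᵥ (Y.Q₂ s).mulVec x ∂lebIcc a b := by
    rw [integral_lebIcc hab]
    simp only [comp, Matrix.add_mulVec, Pi.add_apply, mulVec_mul_apply,
      matIntegral_mulVec (hX.Q₁.matrix_mul hY.Q₂)]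
  rw [fst, h₁]
  congr 1
  refine integral_congr_ae ?_
  filter_upwards [ae_restrict_mem measurableSet_Icc] with s hs
  have h₂ : (comp a b X Y).Q₁ s i = (X.P * Y.Q₁ s) i + (X.Q₁ s * Y.S s) i
      + kernelInt a b (fun s θ => (Y.kern θ s).transpose) (fun θ => X.Q₁ θ i) s := by
    funext j
    rw [Q₁_comp_apply hX hY hs, ← kernelInt_transpose_apply]
    rfl
  calc ((comp a b X Y).Q₁ s).mulVec (z s) i = (comp a b X Y).Q₁ s i ⬝ᵥ z s := rfl
    _ = (X.P * Y.Q₁ s).mulVec (z s) i + (X.Q₁ s * Y.S s).mulVec (z s) i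
      + kernelInt a b (fun s θ => (Y.kern θ s).transpose) (fun θ => X.Q₁ θ i) s ⬝ᵥ z s := by
      rw [h₂, add_dotProduct, add_dotProduct]
      rfl
    _ = _ := by rw [mulVec_mul_apply, mulVec_mul_apply]

/-- A product represents the composition: second component. -/
theorem snd_comp {m q n r k l : Type} [Fintype m] [Fintype q] [Fintype n] [Fintype r] [Finite l]
    {a b : ℝ} {X : PQRS n r k l} (hX : X.IsCont) {Y : PQRS m q n r}
    (hY : Y.IsCont) (x : m → ℝ) {z : ℝ → q → ℝ} (hz : L2Vec a b z) {s : ℝ}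
    (hs : s ∈ Set.Icc a b) :
    (comp a b X Y).snd a b x z s = X.snd a b (Y.fst a b x z) (Y.snd a b x z) s := by
  funext i
  have hu : L2Vec a b fun θ => X.kern s θ i := (hX.kern a b).row hs i
  have hY' := hY.kern a b
  have i₀ := hY'.integrable_mulVec hz hs
  have i₁ := (L2Vec.of_continuous (continuous_const (y := X.Q₂ s i))).dotProduct_integrable
    (hz.mulVec hY.Q₁)
  have i₂ := hu.dotProduct_integrable (hz.mulVec hY.S)
  have i₃ := (hY'.transpose.l2Vec hu).dotProduct_integrable hz
  have i₄ : Integrable (fun θ => X.S s i ⬝ᵥ (Y.kern s θ).mulVec (z θ)) (lebIcc a b) :=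
    integrable_finsetSum _ fun j _ => (i₀ j).const_mul _
  have h₁ : kernelInt a b (comp a b X Y).kern z s i
      = (∫ θ, (X.Q₂ s i ⬝ᵥ (Y.Q₁ θ).mulVec (z θ) + X.kern s θ i ⬝ᵥ (Y.S θ).mulVec (z θ)
          + kernelInt a b (fun s θ => (Y.kern θ s).transpose) (fun θ => X.kern s θ i) θ ⬝ᵥ z θ)
          ∂lebIcc a b) + X.S s i ⬝ᵥ kernelInt a b Y.kern z s := by
    have h₂ : X.S s i ⬝ᵥ kernelInt a b Y.kern z s
        = ∫ θ, X.S s i ⬝ᵥ (Y.kern s θ).mulVec (z θ) ∂lebIcc a b := dotProduct_integral _ i₀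
    rw [h₂, ← integral_add ((i₁.fun_add i₂).fun_add i₃) i₄]
    refine integral_congr_ae ?_
    filter_upwards [ae_restrict_mem measurableSet_Icc] with η hη
    have h₃ : (comp a b X Y).kern s η i = (X.Q₂ s * Y.Q₁ η) i + (X.S s * Y.kern s η) i
        + (X.kern s η * Y.S η) i
        + kernelInt a b (fun s θ => (Y.kern θ s).transpose) (fun θ => X.kern s θ i) η := by
      funext j
      rw [kern_comp_apply hX hY hs hη, ← kernelInt_transpose_apply]
      rfl
    calc ((comp a b X Y).kern s η).mulVec (z η) i = (comp a b X Y).kern s η i ⬝ᵥ z η := rfl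
      _ = (X.Q₂ s * Y.Q₁ η).mulVec (z η) i + (X.S s * Y.kern s η).mulVec (z η) i
        + (X.kern s η * Y.S η).mulVec (z η) i
        + kernelInt a b (fun s θ => (Y.kern θ s).transpose) (fun θ => X.kern s θ i) η ⬝ᵥ z η := by
        rw [h₃, add_dotProduct, add_dotProduct, add_dotProduct]
        rfl
      _ = _ := by
        simp only [mulVec_mul_apply]
        ring
  have h₄ : X.snd a b (Y.fst a b x z) (Y.snd a b x z) s i
      = X.S s i ⬝ᵥ Y.snd a b x z s + Y.form a b (X.Q₂ s i) (fun θ => X.kern s θ i) x z := by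
    change X.Q₂ s i ⬝ᵥ Y.fst a b x z + X.S s i ⬝ᵥ Y.snd a b x z s
      + (∫ θ, X.kern s θ i ⬝ᵥ Y.snd a b x z θ ∂lebIcc a b) = _
    rw [form]
    ring
  rw [h₄, form_eq_fubini hY _ hu _ hz]
  change ((comp a b X Y).Q₂ s).mulVec x i + (X.S s * Y.S s).mulVec (z s) i
    + kernelInt a b (comp a b X Y).kern z s i = _
  rw [h₁, Q₂_comp_mulVec hX hY hs, mulVec_mul_apply]
  simp only [snd, dotProduct_add]
  ring

theorem form_comp {m q n r k l : Type} [Fintype m] [Fintype q] [Fintype n] [Fintype r]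
    [Fintype k] [Fintype l] {a b : ℝ} (hab : a ≤ b) {X : PQRS n r k l} (hX : X.IsCont)
    {Y : PQRS m q n r} (hY : Y.IsCont) (p : k → ℝ) (u : ℝ → l → ℝ) (x : m → ℝ)
    {z : ℝ → q → ℝ} (hz : L2Vec a b z) :
    (comp a b X Y).form a b p u x z = X.form a b p u (Y.fst a b x z) (Y.snd a b x z) := by
  rw [form, form, fst_comp hab hX hY x hz]
  congr 1
  refine integral_congr_ae ?_
  filter_upwards [ae_restrict_mem measurableSet_Icc] with s hs
  rw [snd_comp hX hY x hz hs]

theorem IsCont.comp {m q n r k l : Type} [Fintype n] [Fintype r] {X : PQRS n r k l}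
    (hX : X.IsCont) {Y : PQRS m q n r} (hY : Y.IsCont) (a b : ℝ) : (comp a b X Y).IsCont := by
  have hX₁ := hX.Q₁
  have hX₂ := hX.Q₂
  have hX₃ := hX.S
  have hY₁ := hY.Q₁
  have hY₂ := hY.Q₂
  have hY₃ := hY.S
  have c : ∀ {E α β : Type} [TopologicalSpace E] {R : ℝ → ℝ → Matrix α β ℝ} {f g : E → ℝ},
      Continuous (fun p : ℝ × ℝ => R p.1 p.2) → Continuous f → Continuous g →
      Continuous fun p => R (f p) (g p) := fun h hf hg => h.comp (hf.prodMk hg)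
  constructor
  · refine (((continuous_const.matrix_mul hY₁).add (hX₁.matrix_mul hY₃)).add
      (continuous_matIntegral ?_ continuous_id continuous_const)).add
      (continuous_matIntegral ?_ continuous_const continuous_id)
    · exact (hX₁.comp continuous_snd).matrix_mul (c hY.R₁ continuous_snd continuous_fst)
    · exact (hX₁.comp continuous_snd).matrix_mul (c hY.R₂ continuous_snd continuous_fst)
  · refine (((hX₂.matrix_mul continuous_const).add (hX₃.matrix_mul hY₂)).add
      (continuous_matIntegral ?_ continuous_const continuous_id)).add
      (continuous_matIntegral ?_ continuous_id continuous_const)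
    · exact (c hX.R₁ continuous_fst continuous_snd).matrix_mul (hY₂.comp continuous_snd)
    · exact (c hX.R₂ continuous_fst continuous_snd).matrix_mul (hY₂.comp continuous_snd)
  · exact hX₃.matrix_mul hY₃
  · refine ((((((hX₂.comp continuous_fst).matrix_mul (hY₁.comp continuous_snd)).add
      ((hX₃.comp continuous_fst).matrix_mul hY.R₁)).add
      (hX.R₁.matrix_mul (hY₃.comp continuous_snd))).add
      (continuous_matIntegral ?_ continuous_const continuous_snd)).add
      (continuous_matIntegral ?_ continuous_snd continuous_fst)).add
      (continuous_matIntegral ?_ continuous_fst continuous_const)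
    · exact (c hX.R₁ (continuous_fst.comp continuous_fst) continuous_snd).matrix_mul
        (c hY.R₂ continuous_snd (continuous_snd.comp continuous_fst))
    · exact (c hX.R₁ (continuous_fst.comp continuous_fst) continuous_snd).matrix_mul
        (c hY.R₁ continuous_snd (continuous_snd.comp continuous_fst))
    · exact (c hX.R₂ (continuous_fst.comp continuous_fst) continuous_snd).matrix_mul
        (c hY.R₁ continuous_snd (continuous_snd.comp continuous_fst))
  · refine ((((((hX₂.comp continuous_fst).matrix_mul (hY₁.comp continuous_snd)).add
      ((hX₃.comp continuous_fst).matrix_mul hY.R₂)).add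
      (hX.R₂.matrix_mul (hY₃.comp continuous_snd))).add
      (continuous_matIntegral ?_ continuous_const continuous_fst)).add
      (continuous_matIntegral ?_ continuous_fst continuous_snd)).add
      (continuous_matIntegral ?_ continuous_snd continuous_const)
    · exact (c hX.R₁ (continuous_fst.comp continuous_fst) continuous_snd).matrix_mul
        (c hY.R₂ continuous_snd (continuous_snd.comp continuous_fst))
    · exact (c hX.R₂ (continuous_fst.comp continuous_fst) continuous_snd).matrix_mul
        (c hY.R₂ continuous_snd (continuous_snd.comp continuous_fst))
    · exact (c hX.R₂ (continuous_fst.comp continuous_fst) continuous_snd).matrix_mul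
        (c hY.R₁ continuous_snd (continuous_snd.comp continuous_fst))

end PQRS

/-! ### Sums of tuples and equality on `[a, b]` -/

namespace PQRS

theorem kern_add {m q n r : Type} (X Y : PQRS m q n r) (s θ : ℝ) :
    (X + Y).kern s θ = X.kern s θ + Y.kern s θ := by
  unfold kern
  split_ifs <;> rfl

theorem kern_neg {m q n r : Type} (X : PQRS m q n r) (s θ : ℝ) :
    (-X).kern s θ = -X.kern s θ := by
  unfold kern
  split_ifs <;> rfl

theorem sub_eq_add_neg {m q n r : Type} (X Y : PQRS m q n r) : X - Y = X + -Y := by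
  change PQRS.mk _ _ _ _ _ _ = PQRS.mk _ _ _ _ _ _
  congr 1

theorem IsCont.add {m q n r : Type} {X Y : PQRS m q n r} (hX : X.IsCont) (hY : Y.IsCont) :
    (X + Y).IsCont :=
  ⟨hX.Q₁.add hY.Q₁, hX.Q₂.add hY.Q₂, hX.S.add hY.S, hX.R₁.add hY.R₁, hX.R₂.add hY.R₂⟩

theorem IsCont.neg {m q n r : Type} {X : PQRS m q n r} (hX : X.IsCont) : (-X).IsCont :=
  ⟨hX.Q₁.neg, hX.Q₂.neg, hX.S.neg, hX.R₁.neg, hX.R₂.neg⟩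

theorem fst_add {m q n r : Type} [Fintype m] [Fintype q] {X Y : PQRS m q n r} (hX : X.IsCont)
    (hY : Y.IsCont) {a b : ℝ} (x : m → ℝ) {z : ℝ → q → ℝ} (hz : L2Vec a b z) :
    (X + Y).fst a b x z = X.fst a b x z + Y.fst a b x z := by
  funext i
  have h : ∫ s, ((X + Y).Q₁ s).mulVec (z s) i ∂lebIcc a b
      = (∫ s, (X.Q₁ s).mulVec (z s) i ∂lebIcc a b)
        + ∫ s, (Y.Q₁ s).mulVec (z s) i ∂lebIcc a b := by
    rw [← integral_add ((hz.mulVec hX.Q₁).integrable i) ((hz.mulVec hY.Q₁).integrable i)]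
    refine integral_congr_ae (Filter.Eventually.of_forall fun s => ?_)
    exact congrFun (Matrix.add_mulVec (X.Q₁ s) (Y.Q₁ s) (z s)) i
  have h' : (X + Y).P.mulVec x i = X.P.mulVec x i + Y.P.mulVec x i :=
    congrFun (Matrix.add_mulVec X.P Y.P x) i
  simp only [fst, Pi.add_apply, h, h']
  ring

theorem snd_add {m q n r : Type} [Fintype m] [Fintype q] [Finite r] {X Y : PQRS m q n r}
    (hX : X.IsCont) (hY : Y.IsCont) {a b : ℝ} (x : m → ℝ) {z : ℝ → q → ℝ} (hz : L2Vec a b z)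
    {s : ℝ} (hs : s ∈ Set.Icc a b) :
    (X + Y).snd a b x z s = X.snd a b x z s + Y.snd a b x z s := by
  have h : kernelInt a b (X + Y).kern z s =
      kernelInt a b X.kern z s + kernelInt a b Y.kern z s := by
    funext i
    rw [Pi.add_apply, kernelInt, kernelInt, kernelInt, ← integral_add
      ((hX.kern a b).integrable_mulVec hz hs i) ((hY.kern a b).integrable_mulVec hz hs i)]
    simp only [kern_add, Matrix.add_mulVec, Pi.add_apply]
  have h₁ : ((X + Y).Q₂ s).mulVec x = (X.Q₂ s).mulVec x + (Y.Q₂ s).mulVec x :=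
    Matrix.add_mulVec _ _ _
  have h₂ : ((X + Y).S s).mulVec (z s) = (X.S s).mulVec (z s) + (Y.S s).mulVec (z s) :=
    Matrix.add_mulVec _ _ _
  simp only [snd, h, h₁, h₂]
  abel

theorem fst_neg {m q n r : Type} [Fintype m] [Fintype q] (X : PQRS m q n r) (a b : ℝ)
    (x : m → ℝ) (z : ℝ → q → ℝ) : (-X).fst a b x z = -X.fst a b x z := by
  funext i
  have h : ∀ s, ((-X).Q₁ s).mulVec (z s) i = -(X.Q₁ s).mulVec (z s) i := fun s =>
    congrFun (Matrix.neg_mulVec (z s) (X.Q₁ s)) i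
  have h' : (-X).P.mulVec x i = -X.P.mulVec x i := congrFun (Matrix.neg_mulVec x X.P) i
  simp only [fst, h, h', Pi.neg_apply, integral_neg]
  ring

theorem snd_neg {m q n r : Type} [Fintype m] [Fintype q] (X : PQRS m q n r) (a b : ℝ)
    (x : m → ℝ) (z : ℝ → q → ℝ) (s : ℝ) : (-X).snd a b x z s = -X.snd a b x z s := by
  have h : kernelInt a b (-X).kern z s = -kernelInt a b X.kern z s := by
    funext i
    simp only [kernelInt, kern_neg, Matrix.neg_mulVec, Pi.neg_apply, integral_neg]
  have h₁ : ((-X).Q₂ s).mulVec x = -(X.Q₂ s).mulVec x := Matrix.neg_mulVec _ _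
  have h₂ : ((-X).S s).mulVec (z s) = -(X.S s).mulVec (z s) := Matrix.neg_mulVec _ _
  simp only [snd, h, h₁, h₂]
  abel

theorem form_add {m q n r : Type} [Fintype m] [Fintype q] [Fintype n] [Fintype r]
    {X Y : PQRS m q n r} (hX : X.IsCont) (hY : Y.IsCont) {a b : ℝ} (p : n → ℝ) {u : ℝ → r → ℝ}
    (hu : L2Vec a b u) (x : m → ℝ) {z : ℝ → q → ℝ} (hz : L2Vec a b z) :
    (X + Y).form a b p u x z = X.form a b p u x z + Y.form a b p u x z := by
  have h : ∫ s, u s ⬝ᵥ (X + Y).snd a b x z s ∂lebIcc a b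
      = (∫ s, u s ⬝ᵥ X.snd a b x z s ∂lebIcc a b)
        + ∫ s, u s ⬝ᵥ Y.snd a b x z s ∂lebIcc a b := by
    rw [← integral_add (hu.dotProduct_integrable (hX.snd x hz))
      (hu.dotProduct_integrable (hY.snd x hz))]
    refine integral_congr_ae ?_
    filter_upwards [ae_restrict_mem measurableSet_Icc] with s hs
    rw [snd_add hX hY x hz hs, dotProduct_add]
  rw [form, form, form, h, fst_add hX hY x hz, dotProduct_add]
  ring

theorem form_neg {m q n r : Type} [Fintype m] [Fintype q] [Fintype n] [Fintype r]
    (X : PQRS m q n r) (a b : ℝ) (p : n → ℝ) (u : ℝ → r → ℝ) (x : m → ℝ) (z : ℝ → q → ℝ) :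
    (-X).form a b p u x z = -X.form a b p u x z := by
  simp only [form, fst_neg, snd_neg, dotProduct_neg, integral_neg]
  ring

theorem EqOn.form_eq {m q n r : Type} [Fintype m] [Fintype q] [Fintype n] [Fintype r]
    {X Y : PQRS m q n r} {a b : ℝ} (h : EqOn a b X Y) (p : n → ℝ) (u : ℝ → r → ℝ) (x : m → ℝ)
    (z : ℝ → q → ℝ) : X.form a b p u x z = Y.form a b p u x z := by
  obtain ⟨h₁, h₂, h₃⟩ := h
  have hfst : X.fst a b x z = Y.fst a b x z := by
    funext i
    rw [fst, fst, h₁]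
    congr 1
    refine integral_congr_ae ?_
    filter_upwards [ae_restrict_mem measurableSet_Icc] with s hs
    rw [(h₂ s hs).1]
  have hsnd : ∀ s ∈ Set.Icc a b, X.snd a b x z s = Y.snd a b x z s := by
    intro s hs
    rw [snd, snd, (h₂ s hs).2.1, (h₂ s hs).2.2]
    congr 1
    funext i
    refine integral_congr_ae ?_
    filter_upwards [ae_restrict_mem measurableSet_Icc] with θ hθ
    rw [kern, kern, (h₃ s hs θ hθ).1, (h₃ s hs θ hθ).2]
  rw [form, form, hfst]
  congr 1
  refine integral_congr_ae ?_
  filter_upwards [ae_restrict_mem measurableSet_Icc] with s hs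
  rw [hsnd s hs]

end PQRS

/-! ### The forms of the members of the cone `Φ_d` -/

open Classical in
/-- The inclusion of a block of coordinates. -/
def blockIncl {α ι : Type} (e : α → ι) : Matrix ι α ℝ := (1 : Matrix ι ι ℝ).submatrix id e

theorem blockIncl_transpose_mul_mul {α β ι : Type} [Fintype ι] (e : α → ι) (f : β → ι)
    (T : Matrix ι ι ℝ) : (blockIncl e).transpose * (T * blockIncl f) = T.submatrix e f := by
  classical
  ext i j
  simp [blockIncl, Matrix.mul_apply, Matrix.one_apply]

theorem blockIncl_mul_transpose_mul {α β γ δ ι : Type} [Fintype α] [Fintype β] [Fintype ι]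
    (e : α → ι) (f : β → ι) (T : Matrix ι ι ℝ) (A : Matrix α γ ℝ) (B : Matrix β δ ℝ) (c : ℝ) :
    (blockIncl e * A).transpose * (c • (T * (blockIncl f * B)))
      = c • (A.transpose * T.submatrix e f * B) := by
  rw [Matrix.mul_smul, Matrix.transpose_mul, ← blockIncl_transpose_mul_mul e f T]
  simp only [Matrix.mul_assoc]

theorem blockIncl_transpose_mul_smul {α β δ ι : Type} [Fintype β] [Fintype ι]
    (e : α → ι) (f : β → ι) (T : Matrix ι ι ℝ) (B : Matrix β δ ℝ) (c : ℝ) :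
    (blockIncl e).transpose * (c • (T * (blockIncl f * B))) = c • (T.submatrix e f * B) := by
  rw [Matrix.mul_smul, ← blockIncl_transpose_mul_mul e f T]
  simp only [Matrix.mul_assoc]

theorem blockIncl_mul_transpose_mul_smul {α β γ ι : Type} [Fintype α] [Fintype ι]
    (e : α → ι) (f : β → ι) {T : Matrix ι ι ℝ} (hT : T.IsSymm) (A : Matrix α γ ℝ) (c : ℝ) :
    (blockIncl e * A).transpose * (c • (T * blockIncl f))
      = c • (T.submatrix f e * A).transpose := by
  rw [Matrix.mul_smul, Matrix.transpose_mul, Matrix.transpose_mul, Matrix.mul_assoc,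
    blockIncl_transpose_mul_mul e f T, Matrix.transpose_submatrix, hT.eq]

/-- The factor of a Gram tuple. Its first component is empty; the second sends `(x, z)` to the
function `v` which stacks `x`, `Z₁ z`,
`∫_a^s Z₂(s,θ) z(θ) dθ` and `∫_s^b Z₂(s,θ) z(θ) dθ`. -/
def gramFactor {m n p k : Type} [Fintype p] [Fintype k] (Z₁ : ℝ → Matrix p n ℝ)
    (Z₂ : ℝ → ℝ → Matrix k n ℝ) : PQRS m n (Fin 0) (m ⊕ p ⊕ k ⊕ k) where
  P := 0
  Q₁ := 0
  Q₂ := fun _ => blockIncl ix₁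
  S := fun s => (blockIncl ix₂ : Matrix (m ⊕ p ⊕ k ⊕ k) p ℝ) * Z₁ s
  R₁ := fun s θ => (blockIncl ix₃ : Matrix (m ⊕ p ⊕ k ⊕ k) k ℝ) * Z₂ s θ
  R₂ := fun s θ => (blockIncl ix₄ : Matrix (m ⊕ p ⊕ k ⊕ k) k ℝ) * Z₂ s θ

/-- The tuple of the operator of `X` followed by multiplication with `g T`. -/
def PQRS.weighted {m n l r : Type} [Fintype r] (g : ℝ → ℝ) (T : Matrix r r ℝ)
    (X : PQRS m n l r) : PQRS m n l r where
  P := 0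
  Q₁ := 0
  Q₂ := fun s => g s • (T * X.Q₂ s)
  S := fun s => g s • (T * X.S s)
  R₁ := fun s θ => g s • (T * X.R₁ s θ)
  R₂ := fun s θ => g s • (T * X.R₂ s θ)

/-- The tuple of a Gram matrix factors as `F^* (g T) F`. -/
theorem gramTuple_eq_comp {m n p k : Type} [Fintype m] [Fintype p] [Fintype k] (a b : ℝ)
    (g : ℝ → ℝ) (Z₁ : ℝ → Matrix p n ℝ) (Z₂ : ℝ → ℝ → Matrix k n ℝ) {T : GramMatrix m p k}
    (hT : T.IsSymm) :
    gramTuple a b g Z₁ Z₂ T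
      = PQRS.comp a b (gramFactor Z₁ Z₂).adj ((gramFactor Z₁ Z₂).weighted g T) := by
  have htr : ∀ {α β : Type} (c d : ℝ) (M : ℝ → Matrix α β ℝ),
      (matIntegral c d M).transpose = matIntegral c d fun θ => (M θ).transpose :=
    fun c d M => rfl
  unfold gramTuple PQRS.symm PQRS.comp PQRS.adj PQRS.weighted gramFactor
  congr 1
  · ext i j
    simp [matIntegral, blockIncl_transpose_mul_mul]
  · funext η
    simp only [blockIncl_transpose_mul_smul, Matrix.transpose_zero, Matrix.zero_mul, Pi.zero_apply,
      zero_add]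
  · funext η
    simp only [blockIncl_mul_transpose_mul_smul _ _ hT, Matrix.transpose_zero, Matrix.mul_zero,
      Pi.zero_apply, zero_add,
      Matrix.transpose_add, htr, Matrix.transpose_smul]
    abel
  · funext s
    simp only [blockIncl_mul_transpose_mul]
  · funext s η
    simp only [blockIncl_mul_transpose_mul, Pi.zero_apply, Matrix.mul_zero, zero_add]
    abel
  · funext s η
    simp only [blockIncl_mul_transpose_mul, Pi.zero_apply, Matrix.mul_zero, zero_add]
    abel

theorem isCont_gramFactor {m n p k : Type} [Fintype p] [Fintype k] {Z₁ : ℝ → Matrix p n ℝ}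
    {Z₂ : ℝ → ℝ → Matrix k n ℝ} (h₁ : Continuous Z₁)
    (h₂ : Continuous fun q : ℝ × ℝ => Z₂ q.1 q.2) :
    (gramFactor (m := m) Z₁ Z₂).IsCont :=
  ⟨continuous_const, continuous_const, continuous_const.matrix_mul h₁,
    continuous_const.matrix_mul h₂, continuous_const.matrix_mul h₂⟩

theorem PQRS.IsCont.weighted {m n l r : Type} [Fintype r] {g : ℝ → ℝ} (hg : Continuous g)
    (T : Matrix r r ℝ) {X : PQRS m n l r} (hX : X.IsCont) : (X.weighted g T).IsCont :=
  ⟨continuous_const, hg.smul (continuous_const.matrix_mul hX.Q₂),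
    hg.smul (continuous_const.matrix_mul hX.S),
    (hg.comp continuous_fst).smul (continuous_const.matrix_mul hX.R₁),
    (hg.comp continuous_fst).smul (continuous_const.matrix_mul hX.R₂)⟩

theorem PQRS.snd_weighted {m n l r : Type} [Fintype m] [Fintype n] [Fintype r] (g : ℝ → ℝ)
    (T : Matrix r r ℝ) {X : PQRS m n l r} (hX : X.IsCont) {a b : ℝ} (x : m → ℝ)
    {z : ℝ → n → ℝ} (hz : L2Vec a b z) {s : ℝ} (hs : s ∈ Set.Icc a b) :
    (X.weighted g T).snd a b x z s = g s • T.mulVec (X.snd a b x z s) := by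
  have hk : ∀ θ, (X.weighted g T).kern s θ = g s • (T * X.kern s θ) := by
    intro θ
    unfold kern
    split_ifs <;> rfl
  have h : kernelInt a b (X.weighted g T).kern z s = g s • T.mulVec (kernelInt a b X.kern z s) := by
    funext i
    change _ = g s * (T i ⬝ᵥ fun j => ∫ θ, (X.kern s θ).mulVec (z θ) j ∂lebIcc a b)
    rw [dotProduct_integral _ ((hX.kern a b).integrable_mulVec hz hs), ← integral_const_mul]
    refine integral_congr_ae (Filter.Eventually.of_forall fun θ => ?_)
    simp only [hk, Matrix.smul_mulVec, Pi.smul_apply, PQRS.mulVec_mul_apply, smul_eq_mul]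
  rw [snd, h]
  simp only [weighted, snd, Matrix.smul_mulVec, Matrix.mulVec_add, smul_add,
    Matrix.mulVec_mulVec]

/-- The bilinear form of a Gram tuple is `∫_a^b g vᵀ T v`. -/
theorem form_gramTuple {m n p k : Type} [Fintype m] [Fintype n] [Fintype p] [Fintype k]
    {a b : ℝ} (hab : a ≤ b) {g : ℝ → ℝ} (hg : Continuous g) {Z₁ : ℝ → Matrix p n ℝ}
    {Z₂ : ℝ → ℝ → Matrix k n ℝ} (h₁ : Continuous Z₁)
    (h₂ : Continuous fun q : ℝ × ℝ => Z₂ q.1 q.2) {T : GramMatrix m p k} (hT : T.IsSymm)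
    (y : m → ℝ) {u : ℝ → n → ℝ} (hu : L2Vec a b u) (x : m → ℝ) {z : ℝ → n → ℝ}
    (hz : L2Vec a b z) :
    (gramTuple a b g Z₁ Z₂ T).form a b y u x z
      = ∫ s, g s * (T.mulVec ((gramFactor Z₁ Z₂).snd a b x z s)
          ⬝ᵥ (gramFactor Z₁ Z₂).snd a b y u s) ∂lebIcc a b := by
  have hF := isCont_gramFactor (m := m) h₁ h₂
  have hG := hF.weighted hg T
  have h0 : ∀ v w : Fin 0 → ℝ, v ⬝ᵥ w = 0 := fun v w => by simp [dotProduct]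
  rw [gramTuple_eq_comp a b g Z₁ Z₂ hT, PQRS.form_comp hab hF.adj hG _ _ _ hz,
    PQRS.form_adj hF _ (hG.snd x hz) _ hu, PQRS.form, h0, zero_add]
  refine integral_congr_ae ?_
  filter_upwards [ae_restrict_mem measurableSet_Icc] with s hs
  rw [PQRS.snd_weighted g T hF x hz hs, smul_dotProduct, smul_eq_mul]

theorem isCont_gramTuple {m n p k : Type} [Fintype m] [Fintype p] [Fintype k]
    (a b : ℝ) {g : ℝ → ℝ} (hg : Continuous g) {Z₁ : ℝ → Matrix p n ℝ}
    {Z₂ : ℝ → ℝ → Matrix k n ℝ} (h₁ : Continuous Z₁)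
    (h₂ : Continuous fun q : ℝ × ℝ => Z₂ q.1 q.2) {T : GramMatrix m p k} (hT : T.IsSymm) :
    (gramTuple a b g Z₁ Z₂ T).IsCont := by
  have hF := isCont_gramFactor (m := m) h₁ h₂
  rw [gramTuple_eq_comp a b g Z₁ Z₂ hT]
  exact hF.adj.comp (hF.weighted hg T) a b

theorem continuous_polyEval {α β : Type} (M : Matrix α β (Polynomial ℝ)) :
    Continuous (polyEval M) :=
  continuous_matrix fun i j => (M i j).continuous

theorem continuous_polyEval₂ {α β : Type} (M : Matrix α β (Polynomial (Polynomial ℝ))) :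
    Continuous fun p : ℝ × ℝ => polyEval₂ M p.1 p.2 := by
  refine continuous_matrix fun i j => ?_
  change Continuous fun p : ℝ × ℝ => (M i j).evalEval p.1 p.2
  induction M i j using Polynomial.induction_on' with
  | add p q hp hq => simpa only [Polynomial.evalEval_add] using hp.fun_add hq
  | monomial n q =>
    simp only [Polynomial.evalEval, Polynomial.eval_monomial, Polynomial.eval_mul,
      Polynomial.eval_pow, Polynomial.eval_C]
    exact (q.continuous.comp continuous_fst).mul (continuous_snd.pow n)

theorem continuous_monomialBasis (n : Type) [DecidableEq n] (d : ℕ) :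
    Continuous (monomialBasis n d) := by
  refine continuous_matrix fun i j => ?_
  simp only [monomialBasis, Matrix.of_apply]
  split_ifs
  · exact continuous_pow _
  · exact continuous_const

theorem IsGramTuple.isCont {m n : Type} [Fintype m] [Fintype n] [DecidableEq n] {a b : ℝ} {d : ℕ}
    {g : ℝ → ℝ} (hg : Continuous g) {X : PQRS m n m n} (hX : IsGramTuple a b d g X) :
    X.IsCont := by
  obtain ⟨k, Z₂, T, hT, rfl⟩ := hX
  exact isCont_gramTuple a b hg (continuous_monomialBasis n d) (continuous_polyEval₂ Z₂)
    (Matrix.isHermitian_iff_isSymm.1 hT.isHermitian)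

theorem IsGramTuple.form_comm {m n : Type} [Fintype m] [Fintype n] [DecidableEq n] {a b : ℝ}
    (hab : a ≤ b) {d : ℕ} {g : ℝ → ℝ} (hg : Continuous g) {X : PQRS m n m n}
    (hX : IsGramTuple a b d g X) (y : m → ℝ) {u : ℝ → n → ℝ} (hu : L2Vec a b u) (x : m → ℝ)
    {z : ℝ → n → ℝ} (hz : L2Vec a b z) : X.form a b y u x z = X.form a b x z y u := by
  obtain ⟨k, Z₂, T, hT, rfl⟩ := hX
  have hT' : T.IsSymm := Matrix.isHermitian_iff_isSymm.1 hT.isHermitian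
  rw [form_gramTuple hab hg (continuous_monomialBasis n d) (continuous_polyEval₂ Z₂) hT' _ hu _ hz,
    form_gramTuple hab hg (continuous_monomialBasis n d) (continuous_polyEval₂ Z₂) hT' _ hz _ hu]
  refine integral_congr_ae (Filter.Eventually.of_forall fun s => ?_)
  beta_reduce
  rw [dotProduct_comm, Matrix.dotProduct_mulVec, ← Matrix.mulVec_transpose, hT'.eq]

theorem IsGramTuple.form_nonneg {m n : Type} [Fintype m] [Fintype n] [DecidableEq n] {a b : ℝ}
    (hab : a ≤ b) {d : ℕ} {g : ℝ → ℝ} (hg : Continuous g)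
    (hg0 : ∀ s ∈ Set.Icc a b, 0 ≤ g s) {X : PQRS m n m n}
    (hX : IsGramTuple a b d g X) (x : m → ℝ)
    {z : ℝ → n → ℝ} (hz : L2Vec a b z) : 0 ≤ X.form a b x z x z := by
  obtain ⟨k, Z₂, T, hT, rfl⟩ := hX
  have hT' : T.IsSymm := Matrix.isHermitian_iff_isSymm.1 hT.isHermitian
  rw [form_gramTuple hab hg (continuous_monomialBasis n d) (continuous_polyEval₂ Z₂) hT' _ hz _ hz]
  refine integral_nonneg_of_ae ?_
  filter_upwards [ae_restrict_mem measurableSet_Icc] with s hs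
  refine mul_nonneg (hg0 s hs) ?_
  rw [dotProduct_comm]
  simpa using hT.dotProduct_mulVec_nonneg ((gramFactor _ _).snd a b x z s)

theorem continuous_weight (a b : ℝ) : Continuous fun s : ℝ => (s - a) * (b - s) := by
  fun_prop

/-- Members of `Φ_d` represent self-adjoint operators. -/
theorem form_comm_of_mem_phiCone {m n : Type} [Fintype m] [Fintype n] [DecidableEq n] {a b : ℝ}
    (hab : a ≤ b) {d : ℕ} {X : PQRS m n m n} (hX : X ∈ PhiCone m n a b d) (y : m → ℝ)
    {u : ℝ → n → ℝ} (hu : L2Vec a b u) (x : m → ℝ) {z : ℝ → n → ℝ} (hz : L2Vec a b z) :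
    X.form a b y u x z = X.form a b x z y u := by
  obtain ⟨Xa, Xb, ha, hb, h⟩ := hX
  have ca := ha.isCont continuous_const
  have cb := hb.isCont (continuous_weight a b)
  rw [h.form_eq, h.form_eq, PQRS.form_add ca cb _ hu _ hz, PQRS.form_add ca cb _ hz _ hu,
    ha.form_comm hab continuous_const _ hu _ hz,
    hb.form_comm hab (continuous_weight a b) _ hu _ hz]

/-- Members of `Φ_d` represent positive semidefinite operators. -/
theorem form_nonneg_of_mem_phiCone {m n : Type} [Fintype m] [Fintype n] [DecidableEq n] {a b : ℝ}
    (hab : a ≤ b) {d : ℕ} {X : PQRS m n m n} (hX : X ∈ PhiCone m n a b d) (x : m → ℝ)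
    {z : ℝ → n → ℝ} (hz : L2Vec a b z) : 0 ≤ X.form a b x z x z := by
  obtain ⟨Xa, Xb, ha, hb, h⟩ := hX
  have ca := ha.isCont continuous_const
  have cb := hb.isCont (continuous_weight a b)
  rw [h.form_eq, PQRS.form_add ca cb _ hz _ hz]
  refine add_nonneg (ha.form_nonneg hab continuous_const (fun _ _ => zero_le_one) x hz)
    (hb.form_nonneg hab (continuous_weight a b) (fun s hs => ?_) x hz)
  exact mul_nonneg (sub_nonneg.2 hs.1) (sub_nonneg.2 hs.2)

/-! ### The self-adjoint operator of a symmetric tuple -/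

/-- The Hilbert space `ℝ^m × L₂^n[a,b]`. -/
abbrev StateSpace (m n : Type) [Fintype m] [Fintype n] (a b : ℝ) :=
  WithLp 2 (EuclideanSpace ℝ m × L2 n a b)

/-- A representative of an `L₂` function, as a function with values in `ℝ^n`. -/
def L2.rep {n : Type} [Fintype n] {a b : ℝ} (z : L2 n a b) (s : ℝ) : n → ℝ := (z s).ofLp

theorem L2.l2Vec_rep {n : Type} [Fintype n] {a b : ℝ} (z : L2 n a b) : L2Vec a b (L2.rep z) :=
  fun j => (Lp.memLp z).eval_piLp j

theorem L2Vec.memLp {n : Type} [Fintype n] {a b : ℝ} {z : ℝ → n → ℝ} (hz : L2Vec a b z) :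
    MemLp (fun s => (WithLp.toLp 2 (z s) : EuclideanSpace ℝ n)) 2 (lebIcc a b) :=
  MemLp.of_eval_piLp hz

theorem StateSpace.inner_eq {m n : Type} [Fintype m] [Fintype n] {a b : ℝ}
    (p : StateSpace m n a b) (x : m → ℝ) {z : ℝ → n → ℝ} {v : StateSpace m n a b}
    (hx : v.fst.ofLp = x) (hv : ∀ᵐ s ∂lebIcc a b, L2.rep v.snd s = z s) :
    inner ℝ p v = p.fst.ofLp ⬝ᵥ x + ∫ s, L2.rep p.snd s ⬝ᵥ z s ∂lebIcc a b := by
  rw [WithLp.prod_inner_apply, L2.inner_def, EuclideanSpace.inner_eq_star_dotProduct,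
    dotProduct_comm]
  congr 1
  · rw [← hx]
    rfl
  · refine integral_congr_ae ?_
    filter_upwards [hv] with s hs
    rw [EuclideanSpace.inner_eq_star_dotProduct, dotProduct_comm, ← hs]
    rfl

/-- A tuple with a symmetric bilinear form represents a bounded operator on `ℝ^m × L₂^n[a,b]`;
boundedness comes from the Hellinger–Toeplitz theorem. -/
theorem exists_continuousLinearMap_of_form_comm {m n : Type} [Fintype m] [Fintype n] {a b : ℝ}
    {X : PQRS m n m n} (hX : X.IsCont)
    (hsymm : ∀ (y : m → ℝ) (u : ℝ → n → ℝ) (x : m → ℝ) (z : ℝ → n → ℝ), L2Vec a b u →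
      L2Vec a b z → X.form a b y u x z = X.form a b x z y u) :
    ∃ T : StateSpace m n a b →L[ℝ] StateSpace m n a b, ∀ p v : StateSpace m n a b,
      inner ℝ p (T v) = X.form a b p.fst.ofLp (L2.rep p.snd) v.fst.ofLp (L2.rep v.snd) := by
  have hmem : ∀ v : StateSpace m n a b,
      L2Vec a b (X.snd a b v.fst.ofLp (L2.rep v.snd)) := fun v => hX.snd _ (L2.l2Vec_rep v.snd)
  let F : StateSpace m n a b → StateSpace m n a b := fun v =>
    WithLp.toLp 2 (WithLp.toLp 2 (X.fst a b v.fst.ofLp (L2.rep v.snd)), (hmem v).memLp.toLp _)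
  have hF : ∀ p v, inner ℝ p (F v)
      = X.form a b p.fst.ofLp (L2.rep p.snd) v.fst.ofLp (L2.rep v.snd) := by
    intro p v
    refine StateSpace.inner_eq p _ rfl ?_
    filter_upwards [(hmem v).memLp.coeFn_toLp] with s hs
    exact congrArg WithLp.ofLp hs
  have hFs : ∀ p v, inner ℝ (F p) v = inner ℝ p (F v) := by
    intro p v
    rw [real_inner_comm, hF, hF]
    exact hsymm _ _ _ _ (L2.l2Vec_rep _) (L2.l2Vec_rep _)
  -- a map which is symmetric for the inner product is linear
  let T : StateSpace m n a b →ₗ[ℝ] StateSpace m n a b :=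
    { toFun := F
      map_add' := fun u v => ext_inner_right ℝ fun w => by
        simp only [hFs, inner_add_left]
      map_smul' := fun c u => ext_inner_right ℝ fun w => by
        simp only [hFs, inner_smul_left, RingHom.id_apply] }
  have hT : T.IsSymmetric := hFs
  exact ⟨⟨T, hT.continuous⟩, hF⟩

/-! ### Absolutely continuous curves in a Hilbert space -/

/-- Post-composition with a map which is Lipschitz on the range preserves absolute continuity. -/
theorem LipschitzOnWith.comp_absolutelyContinuousOnInterval {E F : Type*} [PseudoMetricSpace E]
    [PseudoMetricSpace F] {φ : E → F} {K : NNReal} {t : Set E} (hφ : LipschitzOnWith K φ t)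
    {f : ℝ → E} {a b : ℝ} (hf : AbsolutelyContinuousOnInterval f a b)
    (hft : Set.MapsTo f (Set.uIcc a b) t) :
    AbsolutelyContinuousOnInterval (fun s => φ (f s)) a b := by
  rw [absolutelyContinuousOnInterval_iff] at hf ⊢
  intro ε hε
  obtain ⟨δ, hδ, h⟩ := hf (ε / (K + 1)) (by positivity)
  refine ⟨δ, hδ, fun I hI hI' => ?_⟩
  have h₁ := h I hI hI'
  have h₂ : ∑ i ∈ Finset.range I.1, dist (φ (f (I.2 i).1)) (φ (f (I.2 i).2))
      ≤ K * ∑ i ∈ Finset.range I.1, dist (f (I.2 i).1) (f (I.2 i).2) := by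
    rw [Finset.mul_sum]
    refine Finset.sum_le_sum fun i hi => ?_
    exact hφ.dist_le_mul _ (hft (hI.1 i hi).1) _ (hft (hI.1 i hi).2)
  refine h₂.trans_lt ?_
  have h₃ : 0 ≤ ∑ i ∈ Finset.range I.1, dist (f (I.2 i).1) (f (I.2 i).2) :=
    Finset.sum_nonneg fun _ _ => dist_nonneg
  rw [lt_div_iff₀ (by positivity)] at h₁
  nlinarith

theorem ContinuousLinearMap.comp_absolutelyContinuousOnInterval {E F : Type*}
    [NormedAddCommGroup E] [NormedSpace ℝ E] [NormedAddCommGroup F] [NormedSpace ℝ F]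
    (L : E →L[ℝ] F) {f : ℝ → E} {a b : ℝ} (hf : AbsolutelyContinuousOnInterval f a b) :
    AbsolutelyContinuousOnInterval (fun s => L (f s)) a b :=
  (L.lipschitz.lipschitzOnWith (s := Set.univ)).comp_absolutelyContinuousOnInterval hf
    fun _ _ => Set.mem_univ _

/-- A bounded quadratic form is Lipschitz on bounded sets, so it preserves absolute continuity. -/
theorem AbsolutelyContinuousOnInterval.inner_clm {E : Type*} [NormedAddCommGroup E]
    [InnerProductSpace ℝ E] (T : E →L[ℝ] E) {f : ℝ → E} {a b : ℝ}
    (hf : AbsolutelyContinuousOnInterval f a b) :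
    AbsolutelyContinuousOnInterval (fun s => inner ℝ (f s) (T (f s))) a b := by
  obtain ⟨C, hC⟩ := hf.exists_bound
  have hC0 : 0 ≤ C := (norm_nonneg _).trans (hC a Set.left_mem_uIcc)
  have hφ : LipschitzOnWith (2 * C * ‖T‖).toNNReal (fun v : E => inner ℝ v (T v))
      (Metric.closedBall 0 C) := by
    refine LipschitzOnWith.of_dist_le_mul fun u hu v hv => ?_
    rw [mem_closedBall_zero_iff] at hu hv
    rw [Real.coe_toNNReal _ (by positivity), dist_eq_norm, dist_eq_norm]
    have e : inner ℝ u (T u) - inner ℝ v (T v) = inner ℝ (u - v) (T u) + inner ℝ v (T (u - v)) := by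
      rw [map_sub, inner_sub_left, inner_sub_right]
      ring
    have h₁ : ‖inner ℝ (u - v) (T u)‖ ≤ ‖u - v‖ * (‖T‖ * C) :=
      (norm_inner_le_norm _ _).trans (mul_le_mul_of_nonneg_left
        ((T.le_opNorm u).trans (mul_le_mul_of_nonneg_left hu (norm_nonneg _))) (norm_nonneg _))
    have h₂ : ‖inner ℝ v (T (u - v))‖ ≤ C * (‖T‖ * ‖u - v‖) :=
      (norm_inner_le_norm _ _).trans (mul_le_mul hv (T.le_opNorm _) (norm_nonneg _) hC0)
    calc ‖inner ℝ u (T u) - inner ℝ v (T v)‖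
        ≤ ‖inner ℝ (u - v) (T u)‖ + ‖inner ℝ v (T (u - v))‖ := e ▸ norm_add_le _ _
      _ ≤ 2 * C * ‖T‖ * ‖u - v‖ := by linarith
  exact hφ.comp_absolutelyContinuousOnInterval hf
    fun s hs => mem_closedBall_zero_iff.2 (hC s hs)

/-! ### Recovering the primal state from the fundamental state -/

theorem IsSobolev.continuousOn {n : ℕ} {a b : ℝ} (hab : a ≤ b)
    {u v : ℝ → EuclideanSpace ℝ (Fin n)} (h : IsSobolev a b u v) :
    ContinuousOn u (Set.Icc a b) := by
  simpa only [Set.uIcc_of_le hab] using h.ac.continuousOn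

theorem IsSobolev.ac_apply {n : ℕ} {a b : ℝ} {u v : ℝ → EuclideanSpace ℝ (Fin n)}
    (h : IsSobolev a b u v) (i : Fin n) : AbsolutelyContinuousOnInterval (fun s => u s i) a b :=
  (EuclideanSpace.proj (𝕜 := ℝ) i).comp_absolutelyContinuousOnInterval h.ac

theorem IsSobolev.deriv_apply {n : ℕ} {a b : ℝ} {u v : ℝ → EuclideanSpace ℝ (Fin n)}
    (h : IsSobolev a b u v) (i : Fin n) :
    ∀ᵐ s ∂lebIcc a b, deriv (fun s => u s i) s = v s i := by
  filter_upwards [h.deriv_ae] with s hs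
  exact ((EuclideanSpace.proj (𝕜 := ℝ) i).hasFDerivAt.comp_hasDerivAt s hs).deriv

theorem intervalIntegral_congr_lebIcc {a b s : ℝ} (hs : s ∈ Set.Icc a b) {f g : ℝ → ℝ}
    (h : ∀ᵐ θ ∂lebIcc a b, f θ = g θ) : ∫ θ in a..s, f θ = ∫ θ in a..s, g θ := by
  refine intervalIntegral.integral_congr_ae ?_
  filter_upwards [(ae_restrict_iff' measurableSet_Icc).1 h] with θ hθ hθs
  rw [Set.uIoc_of_le hs.1] at hθs
  exact hθ ⟨hθs.1.le, hθs.2.trans hs.2⟩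

/-- The fundamental theorem of calculus in `W^{1,n}`. -/
theorem IsSobolev.apply_eq {n : ℕ} {a b : ℝ} {u v : ℝ → EuclideanSpace ℝ (Fin n)}
    (h : IsSobolev a b u v) {s : ℝ} (hs : s ∈ Set.Icc a b) (i : Fin n) :
    u s i = u a i + ∫ θ in a..s, v θ i := by
  have hac := (h.ac_apply i).mono (c := a) (d := s) (by
    rw [Set.uIcc_of_le hs.1, Set.uIcc_of_le (hs.1.trans hs.2)]
    exact Set.Icc_subset_Icc_right hs.2)
  rw [← intervalIntegral_congr_lebIcc hs (h.deriv_apply i), hac.integral_deriv_eq_sub]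
  ring

/-- Taylor's formula with integral remainder in `W^{2,n}`. -/
theorem IsSobolev.apply_eq₂ {n : ℕ} {a b : ℝ} {u v w : ℝ → EuclideanSpace ℝ (Fin n)}
    (h : IsSobolev a b u v) (h' : IsSobolev a b v w) {s : ℝ} (hs : s ∈ Set.Icc a b) (i : Fin n) :
    u s i = u a i + (s - a) * v a i + ∫ θ in a..s, (s - θ) * w θ i := by
  have hac := (h'.ac_apply i).mono (c := a) (d := s) (by
    rw [Set.uIcc_of_le hs.1, Set.uIcc_of_le (hs.1.trans hs.2)]
    exact Set.Icc_subset_Icc_right hs.2)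
  have hlin : AbsolutelyContinuousOnInterval (fun θ => s - θ) a s :=
    ContDiffOn.absolutelyContinuousOnInterval (by fun_prop)
  have hw : ∫ θ in a..s, (s - θ) * w θ i = ∫ θ in a..s, (s - θ) * deriv (fun s => v s i) θ :=
    intervalIntegral_congr_lebIcc hs ((h'.deriv_apply i).mono fun θ hθ => by rw [hθ])
  rw [h.apply_eq hs i, hw, hlin.integral_mul_deriv_eq_deriv_mul hac]
  have hd : ∀ θ, deriv (fun θ : ℝ => s - θ) θ = -1 := fun θ => by
    simp
  simp only [hd, neg_mul, one_mul, intervalIntegral.integral_neg]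
  ring

theorem L2Vec.sumElim {α β : Type} {a b : ℝ} {u : ℝ → α → ℝ} {v : ℝ → β → ℝ}
    (hu : L2Vec a b u) (hv : L2Vec a b v) : L2Vec a b fun s => Sum.elim (u s) (v s) := by
  rintro (i | i)
  · exact hu i
  · exact hv i

theorem IsSobolev.l2Vec {n : ℕ} {a b : ℝ} (hab : a ≤ b) {u v : ℝ → EuclideanSpace ℝ (Fin n)}
    (h : IsSobolev a b u v) : L2Vec a b fun s => (u s).ofLp :=
  L2Vec.of_continuousOn ((PiLp.continuous_ofLp 2 _).comp_continuousOn (h.continuousOn hab))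

theorem IsSobolev.l2Vec_deriv {n : ℕ} {a b : ℝ} {u v : ℝ → EuclideanSpace ℝ (Fin n)}
    (h : IsSobolev a b u v) : L2Vec a b fun s => (v s).ofLp :=
  fun j => h.memLp.eval_piLp j

namespace PrimalState

/-- The fundamental state `col(z₁, ∂ₛz₂, ∂ₛ²z₃)`. -/
def fund {n₁ n₂ n₃ : ℕ} {a b : ℝ} (ζ : PrimalState n₁ n₂ n₃ a b) (s : ℝ) : ZIdx n₁ n₂ n₃ → ℝ :=
  stack₃ (ζ.z₁ s) (ζ.z₂s s) (ζ.z₃ss s)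

/-- The boundary values `col(z₂(a), z₃(a), ∂ₛz₃(a))` at the left end point. -/
def left {n₁ n₂ n₃ : ℕ} {a b : ℝ} (ζ : PrimalState n₁ n₂ n₃ a b) : YIdx n₂ n₃ → ℝ :=
  stack₃ (ζ.z₂ a) (ζ.z₃ a) (ζ.z₃s a)

theorem l2Vec_fund {n₁ n₂ n₃ : ℕ} {a b : ℝ} (ζ : PrimalState n₁ n₂ n₃ a b) :
    L2Vec a b ζ.fund :=
  L2Vec.sumElim (fun j => ζ.memLp_z₁.eval_piLp j)
    (ζ.sobolev_z₂.l2Vec_deriv.sumElim ζ.sobolev_z₃s.l2Vec_deriv)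

theorem l2Vec_val {n₁ n₂ n₃ : ℕ} {a b : ℝ} (hab : a ≤ b) (ζ : PrimalState n₁ n₂ n₃ a b) :
    L2Vec a b ζ.val :=
  L2Vec.sumElim (fun j => ζ.memLp_z₁.eval_piLp j)
    ((ζ.sobolev_z₂.l2Vec hab).sumElim (ζ.sobolev_z₃.l2Vec hab))

theorem l2Vec_der {n₁ n₂ n₃ : ℕ} {a b : ℝ} (hab : a ≤ b) (ζ : PrimalState n₁ n₂ n₃ a b) :
    L2Vec a b ζ.der :=
  ζ.sobolev_z₂.l2Vec_deriv.sumElim (ζ.sobolev_z₃s.l2Vec hab)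

/-- The boundary values are determined by those at `a` and by the fundamental state. -/
theorem bdry_eq {n₁ n₂ n₃ : ℕ} {a b : ℝ} (hab : a ≤ b) (ζ : PrimalState n₁ n₂ n₃ a b) :
    ζ.bdry = (bdryT n₂ n₃ a b).mulVec ζ.left
      + fun i => ∫ θ, (bdryQ n₁ n₂ n₃ b θ).mulVec (ζ.fund θ) i ∂lebIcc a b := by
  funext i
  have hb : b ∈ Set.Icc a b := Set.right_mem_Icc.2 hab
  rw [Pi.add_apply, integral_lebIcc hab]
  rcases i with i | i | i | i | i | i
  · simp [bdry, bdryT, bdryQ, row₃, left, fund, stack₃, Matrix.fromRows_mulVec,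
      Matrix.fromCols_mulVec]
  · simpa [bdry, bdryT, bdryQ, row₃, left, fund, stack₃, Matrix.fromRows_mulVec,
      Matrix.fromCols_mulVec] using ζ.sobolev_z₂.apply_eq hb i
  · simp [bdry, bdryT, bdryQ, row₃, left, fund, stack₃, Matrix.fromRows_mulVec,
      Matrix.fromCols_mulVec]
  · simpa [bdry, bdryT, bdryQ, row₃, left, fund, stack₃, Matrix.fromRows_mulVec,
      Matrix.fromCols_mulVec, Matrix.smul_mulVec] using
      ζ.sobolev_z₃.apply_eq₂ ζ.sobolev_z₃s hb i
  · simp [bdry, bdryT, bdryQ, row₃, left, fund, stack₃, Matrix.fromRows_mulVec,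
      Matrix.fromCols_mulVec, Matrix.fromBlocks_mulVec]
  · simpa [bdry, bdryT, bdryQ, row₃, left, fund, stack₃, Matrix.fromRows_mulVec,
      Matrix.fromCols_mulVec, Matrix.fromBlocks_mulVec] using ζ.sobolev_z₃s.apply_eq hb i

end PrimalState

/-! ### The operators of the system -/

theorem integral_lebIcc_ite {a b s : ℝ} (hs : s ∈ Set.Icc a b) (f : ℝ → ℝ) :
    ∫ θ, (if θ ≤ s then f θ else 0) ∂lebIcc a b = ∫ θ in a..s, f θ := by
  have h : (fun θ => if θ ≤ s then f θ else 0) = (Set.Iic s).indicator f := by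
    funext θ
    simp [Set.indicator]
  rw [h, setIntegral_indicator measurableSet_Iic, intervalIntegral.integral_of_le hs.1,
    ← integral_Icc_eq_integral_Ioc]
  congr 2
  ext θ
  simp only [Set.mem_inter_iff, Set.mem_Icc, Set.mem_Iic]
  exact ⟨fun h => ⟨h.1.1, h.2⟩, fun h => ⟨⟨h.1, h.2.trans hs.2⟩, h.2⟩⟩

/-- A kernel `D(θ) - N L(θ)` for `θ ≤ s` and `- N L(θ)` for `θ > s`. -/
theorem integral_volterra_sub {α β γ : Type} [Fintype β] [Fintype γ] {a b s : ℝ}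
    (hs : s ∈ Set.Icc a b) {D : ℝ → Matrix α γ ℝ} (hD : Continuous D) (N : Matrix α β ℝ)
    {L : ℝ → Matrix β γ ℝ} (hL : Continuous L) {v : ℝ → γ → ℝ} (hv : L2Vec a b v) (i : α) :
    ∫ θ, (if θ ≤ s then D θ + -(N * L θ) else -(N * L θ)).mulVec (v θ) i ∂lebIcc a b
      = (∫ θ in a..s, (D θ).mulVec (v θ) i)
        - N.mulVec (fun j => ∫ θ, (L θ).mulVec (v θ) j ∂lebIcc a b) i := by
  have iD : Integrable (fun θ => if θ ≤ s then (D θ).mulVec (v θ) i else 0) (lebIcc a b) := by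
    have h : (fun θ => if θ ≤ s then (D θ).mulVec (v θ) i else 0)
        = (Set.Iic s).indicator fun θ => (D θ).mulVec (v θ) i := by
      funext θ
      simp [Set.indicator]
    rw [h]
    exact ((hv.mulVec hD).integrable i).indicator measurableSet_Iic
  have iL : Integrable (fun θ => N i ⬝ᵥ (L θ).mulVec (v θ)) (lebIcc a b) :=
    (L2Vec.of_continuous (continuous_const (y := N i))).dotProduct_integrable (hv.mulVec hL)
  have e : N.mulVec (fun j => ∫ θ, (L θ).mulVec (v θ) j ∂lebIcc a b) i
      = ∫ θ, N i ⬝ᵥ (L θ).mulVec (v θ) ∂lebIcc a b :=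
    dotProduct_integral _ (hv.mulVec hL).integrable
  rw [e, ← integral_lebIcc_ite hs, ← integral_sub iD iL]
  refine integral_congr_ae (Filter.Eventually.of_forall fun θ => ?_)
  beta_reduce
  split_ifs
  · rw [Matrix.add_mulVec, Matrix.neg_mulVec, Pi.add_apply, Pi.neg_apply, PQRS.mulVec_mul_apply]
    ring
  · rw [Matrix.neg_mulVec, Pi.neg_apply, PQRS.mulVec_mul_apply]
    ring

theorem Continuous.matrix_fromRows {X α β γ : Type} [TopologicalSpace X] {M : X → Matrix α γ ℝ}
    {N : X → Matrix β γ ℝ} (hM : Continuous M) (hN : Continuous N) :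
    Continuous fun x => Matrix.fromRows (M x) (N x) := by
  refine continuous_matrix ?_
  rintro (i | i) j
  · exact hM.matrix_elem i j
  · exact hN.matrix_elem i j

theorem Continuous.matrix_fromCols {X α β γ : Type} [TopologicalSpace X] {M : X → Matrix α β ℝ}
    {N : X → Matrix α γ ℝ} (hM : Continuous M) (hN : Continuous N) :
    Continuous fun x => Matrix.fromCols (M x) (N x) := by
  refine continuous_matrix ?_
  rintro i (j | j)
  · exact hM.matrix_elem i j
  · exact hN.matrix_elem i j

theorem Continuous.row₃ {X ρ α β γ : Type} [TopologicalSpace X] {L : X → Matrix ρ α ℝ}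
    {M : X → Matrix ρ β ℝ} {N : X → Matrix ρ γ ℝ} (hL : Continuous L) (hM : Continuous M)
    (hN : Continuous N) : Continuous fun x => row₃ (L x) (M x) (N x) :=
  hL.matrix_fromCols (hM.matrix_fromCols hN)

theorem continuous_bdryQ (n₁ n₂ n₃ : ℕ) (b : ℝ) : Continuous (bdryQ n₁ n₂ n₃ b) := by
  have c : Continuous fun θ : ℝ => (b - θ) • (1 : Matrix (Fin n₃) (Fin n₃) ℝ) :=
    (continuous_const.sub continuous_id).smul continuous_const
  exact continuous_const.matrix_fromRows (continuous_const.matrix_fromRows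
    (continuous_const.matrix_fromRows ((continuous_const.row₃ continuous_const c).matrix_fromRows
      continuous_const)))

theorem continuous_ftcK (n₁ n₂ n₃ : ℕ) (a : ℝ) : Continuous (ftcK n₁ n₂ n₃ a) := by
  have c : Continuous fun s : ℝ => (s - a) • (1 : Matrix (Fin n₃) (Fin n₃) ℝ) :=
    (continuous_id.sub continuous_const).smul continuous_const
  exact continuous_const.matrix_fromRows (continuous_const.matrix_fromRows
    (continuous_const.row₃ continuous_const c))

/-- `diag(0, I, t I)`, the kernel of the integral remainders of `z₂` and `z₃` for `t = s - θ`. -/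
def taylorKernel (n₁ n₂ n₃ : ℕ) (t : ℝ) : Matrix (ZIdx n₁ n₂ n₃) (ZIdx n₁ n₂ n₃) ℝ :=
  Matrix.fromRows (row₃ 0 0 0) (Matrix.fromRows (row₃ 0 1 0) (row₃ 0 0 (t • 1)))

theorem continuous_taylorKernel (n₁ n₂ n₃ : ℕ) : Continuous (taylorKernel n₁ n₂ n₃) := by
  have c : Continuous fun t : ℝ => t • (1 : Matrix (Fin n₃) (Fin n₃) ℝ) :=
    continuous_id.smul continuous_const
  exact continuous_const.matrix_fromRows (continuous_const.matrix_fromRows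
    (continuous_const.row₃ continuous_const c))

namespace ODEPDESystem

theorem continuous_bcKernel {nx nw ny n₁ n₂ n₃ : ℕ} (sys : ODEPDESystem nx nw ny n₁ n₂ n₃)
    (a b : ℝ) : Continuous (sys.bcKernel a b) :=
  continuous_const.matrix_mul (continuous_bdryQ n₁ n₂ n₃ b)

theorem continuous_G₂ {nx nw ny n₁ n₂ n₃ : ℕ} (sys : ODEPDESystem nx nw ny n₁ n₂ n₃)
    (a b : ℝ) : Continuous fun p : ℝ × ℝ => sys.G₂ a b p.1 p.2 :=
  (((continuous_ftcK n₁ n₂ n₃ a).comp continuous_fst).matrix_mul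
    ((sys.continuous_bcKernel a b).comp continuous_snd)).neg

theorem continuous_G₁ {nx nw ny n₁ n₂ n₃ : ℕ} (sys : ODEPDESystem nx nw ny n₁ n₂ n₃)
    (a b : ℝ) : Continuous fun p : ℝ × ℝ => sys.G₁ a b p.1 p.2 :=
  ((continuous_taylorKernel n₁ n₂ n₃).comp (continuous_fst.sub continuous_snd)).add
    (sys.continuous_G₂ a b)

theorem continuous_G₅ {nx nw ny n₁ n₂ n₃ : ℕ} (sys : ODEPDESystem nx nw ny n₁ n₂ n₃)
    (a b : ℝ) : Continuous fun p : ℝ × ℝ => sys.G₅ a b p.1 p.2 :=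
  (continuous_const.matrix_mul ((sys.continuous_bcKernel a b).comp continuous_snd)).neg

theorem continuous_H₀ {nx nw ny n₁ n₂ n₃ : ℕ} (sys : ODEPDESystem nx nw ny n₁ n₂ n₃)
    (a b : ℝ) : Continuous (sys.H₀ a b) :=
  (continuous_ftcK n₁ n₂ n₃ a).matrix_mul continuous_const

theorem isCont_primalTuple {nx nw ny n₁ n₂ n₃ : ℕ} (sys : ODEPDESystem nx nw ny n₁ n₂ n₃)
    (a b : ℝ) : (sys.primalTuple a b).IsCont :=
  ⟨continuous_const, sys.continuous_H₀ a b, continuous_const, sys.continuous_G₁ a b,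
    sys.continuous_G₂ a b⟩

theorem isCont_derivTuple {nx nw ny n₁ n₂ n₃ : ℕ} (sys : ODEPDESystem nx nw ny n₁ n₂ n₃)
    (a b : ℝ) : (sys.derivTuple a b).IsCont :=
  ⟨continuous_const, continuous_const, continuous_const,
    continuous_const.add (sys.continuous_G₅ a b), sys.continuous_G₅ a b⟩

theorem isCont_bdryTuple {nx nw ny n₁ n₂ n₃ : ℕ} (sys : ODEPDESystem nx nw ny n₁ n₂ n₃)
    (a b : ℝ) : (sys.bdryTuple a b).IsCont :=
  ⟨(continuous_bdryQ n₁ n₂ n₃ b).sub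
    (continuous_const.matrix_mul (sys.continuous_bcKernel a b)),
    continuous_const, continuous_const, continuous_const, continuous_const⟩

/-- The boundary condition determines the boundary values at the left end point. -/
theorem left_eq {nx nw ny n₁ n₂ n₃ : ℕ} {sys : ODEPDESystem nx nw ny n₁ n₂ n₃} {a b : ℝ}
    (hab : a ≤ b) (hBT : IsUnit (sys.B * bdryT n₂ n₃ a b)) {ζ : PrimalState n₁ n₂ n₃ a b}
    {x : Fin nx → ℝ} {w : Fin nw → ℝ}
    (hbc : sys.B.mulVec ζ.bdry = sys.B₁.mulVec x + sys.B₂.mulVec w) :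
    ζ.left = (sys.bcInput a b).mulVec (Sum.elim w x)
      - fun j => ∫ θ, (sys.bcKernel a b θ).mulVec (ζ.fund θ) j ∂lebIcc a b := by
  have hinv : (sys.B * bdryT n₂ n₃ a b)⁻¹ * (sys.B * bdryT n₂ n₃ a b) = 1 :=
    Matrix.nonsing_inv_mul _ ((Matrix.isUnit_iff_isUnit_det _).1 hBT)
  have h₁ : (fun j => ∫ θ, (sys.bcKernel a b θ).mulVec (ζ.fund θ) j ∂lebIcc a b)
      = ((sys.B * bdryT n₂ n₃ a b)⁻¹ * sys.B).mulVec
        fun i => ∫ θ, (bdryQ n₁ n₂ n₃ b θ).mulVec (ζ.fund θ) i ∂lebIcc a b := by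
    funext j
    refine Eq.trans ?_ (dotProduct_integral _
      (ζ.l2Vec_fund.mulVec (continuous_bdryQ n₁ n₂ n₃ b)).integrable).symm
    refine integral_congr_ae (Filter.Eventually.of_forall fun θ => ?_)
    exact PQRS.mulVec_mul_apply _ _ _ _
  have h₂ : (sys.bcInput a b).mulVec (Sum.elim w x)
      = (sys.B * bdryT n₂ n₃ a b)⁻¹.mulVec (sys.B.mulVec ζ.bdry) := by
    rw [hbc, bcInput, ← Matrix.mulVec_mulVec, Matrix.fromCols_mulVec_sumElim, add_comm]
  rw [h₁, h₂, ζ.bdry_eq hab, Matrix.mulVec_add, Matrix.mulVec_add, Matrix.mulVec_mulVec,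
    Matrix.mulVec_mulVec, Matrix.mul_assoc, hinv, Matrix.one_mulVec, Matrix.mulVec_mulVec]
  abel

/-- The tuple `[T₁, T₂, 0; 0, 0, 0]` recovers the boundary values. -/
theorem fst_bdryTuple {nx nw ny n₁ n₂ n₃ : ℕ} {sys : ODEPDESystem nx nw ny n₁ n₂ n₃} {a b : ℝ}
    (hab : a ≤ b) (hBT : IsUnit (sys.B * bdryT n₂ n₃ a b)) {ζ : PrimalState n₁ n₂ n₃ a b}
    {x : Fin nx → ℝ} {w : Fin nw → ℝ}
    (hbc : sys.B.mulVec ζ.bdry = sys.B₁.mulVec x + sys.B₂.mulVec w) :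
    (sys.bdryTuple a b).fst a b (Sum.elim w x) ζ.fund = ζ.bdry := by
  have hL := ζ.l2Vec_fund.mulVec (sys.continuous_bcKernel a b)
  rw [ζ.bdry_eq hab, left_eq hab hBT hbc, Matrix.mulVec_sub]
  funext i
  have e : (bdryT n₂ n₃ a b).mulVec
      (fun j => ∫ θ, (sys.bcKernel a b θ).mulVec (ζ.fund θ) j ∂lebIcc a b) i
      = ∫ θ, (bdryT n₂ n₃ a b * sys.bcKernel a b θ).mulVec (ζ.fund θ) i ∂lebIcc a b := by
    refine (dotProduct_integral _ hL.integrable).trans ?_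
    refine integral_congr_ae (Filter.Eventually.of_forall fun θ => ?_)
    exact (PQRS.mulVec_mul_apply _ _ _ _).symm
  have e' : ∫ θ, ((sys.bdryTuple a b).Q₁ θ).mulVec (ζ.fund θ) i ∂lebIcc a b
      = (∫ θ, (bdryQ n₁ n₂ n₃ b θ).mulVec (ζ.fund θ) i ∂lebIcc a b)
        - ∫ θ, (bdryT n₂ n₃ a b * sys.bcKernel a b θ).mulVec (ζ.fund θ) i ∂lebIcc a b := by
    rw [← integral_sub ((ζ.l2Vec_fund.mulVec (continuous_bdryQ n₁ n₂ n₃ b)).integrable i)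
      ((ζ.l2Vec_fund.mulVec
        (continuous_const.matrix_mul (sys.continuous_bcKernel a b))).integrable i)]
    refine integral_congr_ae (Filter.Eventually.of_forall fun θ => ?_)
    exact congrFun (Matrix.sub_mulVec _ _ _) i
  rw [PQRS.fst, e', Pi.add_apply, Pi.sub_apply, e, Matrix.mulVec_mulVec]
  simp only [bdryTuple]
  ring

/-- The tuple `[0, 0, H₀; G₀, G₁, G₂]` recovers the primal state. -/
theorem snd_primalTuple {nx nw ny n₁ n₂ n₃ : ℕ} {sys : ODEPDESystem nx nw ny n₁ n₂ n₃} {a b : ℝ}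
    (hBT : IsUnit (sys.B * bdryT n₂ n₃ a b)) {ζ : PrimalState n₁ n₂ n₃ a b}
    {x : Fin nx → ℝ} {w : Fin nw → ℝ}
    (hbc : sys.B.mulVec ζ.bdry = sys.B₁.mulVec x + sys.B₂.mulVec w) {s : ℝ}
    (hs : s ∈ Set.Icc a b) :
    (sys.primalTuple a b).snd a b (Sum.elim w x) ζ.fund s = ζ.val s := by
  have hleft := left_eq (hs.1.trans hs.2) hBT hbc
  have hD : Continuous fun θ : ℝ => taylorKernel n₁ n₂ n₃ (s - θ) :=
    (continuous_taylorKernel n₁ n₂ n₃).comp (continuous_const.sub continuous_id)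
  have hk : kernelInt a b (sys.primalTuple a b).kern ζ.fund s
      = (fun i => ∫ θ in a..s, (taylorKernel n₁ n₂ n₃ (s - θ)).mulVec
          (ζ.fund θ) i)
        - (ftcK n₁ n₂ n₃ a s).mulVec
          (fun j => ∫ θ, (sys.bcKernel a b θ).mulVec (ζ.fund θ) j ∂lebIcc a b) := by
    funext i
    exact integral_volterra_sub hs hD _ (sys.continuous_bcKernel a b) ζ.l2Vec_fund i
  have e : (sys.primalTuple a b).snd a b (Sum.elim w x) ζ.fund s
      = (ftcK n₁ n₂ n₃ a s).mulVec ζ.left + (G₀ n₁ n₂ n₃ s).mulVec (ζ.fund s)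
        + fun i => ∫ θ in a..s, (taylorKernel n₁ n₂ n₃ (s - θ)).mulVec
          (ζ.fund θ) i := by
    rw [PQRS.snd, hk, hleft, Matrix.mulVec_sub, Matrix.mulVec_mulVec]
    simp only [primalTuple, H₀]
    abel
  rw [e]
  funext i
  rcases i with i | i | i
  · simp [PrimalState.val, ftcK, G₀, row₃, taylorKernel, PrimalState.left, PrimalState.fund, stack₃,
      Matrix.fromRows_mulVec, Matrix.fromCols_mulVec]
  · simpa [PrimalState.val, ftcK, G₀, row₃, taylorKernel, PrimalState.left, PrimalState.fund,
      stack₃, Matrix.fromRows_mulVec, Matrix.fromCols_mulVec, Matrix.fromBlocks_mulVec] using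
        (ζ.sobolev_z₂.apply_eq hs i).symm
  · simpa [PrimalState.val, ftcK, G₀, row₃, taylorKernel, PrimalState.left, PrimalState.fund,
      stack₃, Matrix.fromRows_mulVec, Matrix.fromCols_mulVec, Matrix.fromBlocks_mulVec,
      Matrix.smul_mulVec] using
      (ζ.sobolev_z₃.apply_eq₂ ζ.sobolev_z₃s hs i).symm

/-- The tuple `[0, 0, H₁; G₃, G₄, G₅]` recovers the spatial derivatives. -/
theorem snd_derivTuple {nx nw ny n₁ n₂ n₃ : ℕ} {sys : ODEPDESystem nx nw ny n₁ n₂ n₃} {a b : ℝ}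
    (hBT : IsUnit (sys.B * bdryT n₂ n₃ a b)) {ζ : PrimalState n₁ n₂ n₃ a b}
    {x : Fin nx → ℝ} {w : Fin nw → ℝ}
    (hbc : sys.B.mulVec ζ.bdry = sys.B₁.mulVec x + sys.B₂.mulVec w) {s : ℝ}
    (hs : s ∈ Set.Icc a b) :
    (sys.derivTuple a b).snd a b (Sum.elim w x) ζ.fund s = ζ.der s := by
  have hleft := left_eq (hs.1.trans hs.2) hBT hbc
  have hk : kernelInt a b (sys.derivTuple a b).kern ζ.fund s
      = (fun i => ∫ θ in a..s, (Matrix.fromRows (row₃ 0 0 0) (row₃ 0 0 1) :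
          Matrix (DIdx n₂ n₃) (ZIdx n₁ n₂ n₃) ℝ).mulVec (ζ.fund θ) i)
        - (ftcV n₂ n₃).mulVec
          (fun j => ∫ θ, (sys.bcKernel a b θ).mulVec (ζ.fund θ) j ∂lebIcc a b) := by
    funext i
    exact integral_volterra_sub hs continuous_const _ (sys.continuous_bcKernel a b)
      ζ.l2Vec_fund i
  have e : (sys.derivTuple a b).snd a b (Sum.elim w x) ζ.fund s
      = (ftcV n₂ n₃).mulVec ζ.left + (G₃ n₁ n₂ n₃ s).mulVec (ζ.fund s)
        + fun i => ∫ θ in a..s, (Matrix.fromRows (row₃ 0 0 0) (row₃ 0 0 1) :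
          Matrix (DIdx n₂ n₃) (ZIdx n₁ n₂ n₃) ℝ).mulVec (ζ.fund θ) i := by
    rw [PQRS.snd, hk, hleft, Matrix.mulVec_sub, Matrix.mulVec_mulVec]
    simp only [derivTuple, H₁]
    abel
  rw [e]
  funext i
  rcases i with i | i
  · simp [PrimalState.der, ftcV, G₃, row₃, PrimalState.left, PrimalState.fund, stack₃, stack₂,
      Matrix.fromRows_mulVec, Matrix.fromCols_mulVec]
  · simpa [PrimalState.der, ftcV, G₃, row₃, PrimalState.left, PrimalState.fund, stack₃, stack₂,
      Matrix.fromRows_mulVec, Matrix.fromCols_mulVec] using (ζ.sobolev_z₃s.apply_eq hs i).symm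

end ODEPDESystem

/-! ### The right-hand sides in the fundamental state -/

theorem PQRS.form_congr {m q n r : Type} [Fintype m] [Fintype q] [Fintype n] [Fintype r]
    (X : PQRS m q n r) {a b : ℝ} (p : n → ℝ) {u u' : ℝ → r → ℝ} (x : m → ℝ) {z z' : ℝ → q → ℝ}
    (hu : ∀ᵐ s ∂lebIcc a b, u s = u' s) (hz : ∀ᵐ s ∂lebIcc a b, z s = z' s) :
    X.form a b p u x z = X.form a b p u' x z' := by
  have h₁ : X.fst a b x z = X.fst a b x z' := by
    funext i
    rw [fst, fst]
    congr 1
    exact integral_congr_ae (hz.mono fun s hs => by beta_reduce; rw [hs])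
  have h₂ : ∀ s, kernelInt a b X.kern z s = kernelInt a b X.kern z' s := by
    intro s
    funext i
    exact integral_congr_ae (hz.mono fun s hs => by beta_reduce; rw [hs])
  rw [form, form, h₁]
  congr 1
  refine integral_congr_ae ?_
  filter_upwards [hu, hz] with s hs hs'
  rw [snd, snd, hs, hs', h₂]

/-- A tuple whose operator is `(x, z) ↦ (∫_a^b M z ds, N z)`. -/
abbrev PQRS.ofCoeff {q n r : Type} (M : ℝ → Matrix n q ℝ) (N : ℝ → Matrix r q ℝ) :
    PQRS (Fin 0) q n r :=
  ⟨0, M, 0, N, 0, 0⟩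

theorem PQRS.isCont_ofCoeff {q n r : Type} {M : ℝ → Matrix n q ℝ} {N : ℝ → Matrix r q ℝ}
    (hM : Continuous M) (hN : Continuous N) : (PQRS.ofCoeff M N).IsCont :=
  ⟨hM, continuous_const, hN, continuous_const, continuous_const⟩

theorem kernelInt_zero {m q n r : Type} [Fintype q] (X : PQRS m q n r) (h₁ : X.R₁ = 0)
    (h₂ : X.R₂ = 0) (a b : ℝ) (z : ℝ → q → ℝ) (s : ℝ) : kernelInt a b X.kern z s = 0 := by
  funext i
  simp [kernelInt, PQRS.kern, h₁, h₂]

theorem fst_comp_ofCoeff {m q q' n r : Type} [Fintype m] [Fintype q] [Fintype q'] {a b : ℝ}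
    (hab : a ≤ b) {M : ℝ → Matrix n q ℝ} {N : ℝ → Matrix r q ℝ} (hM : Continuous M)
    (hN : Continuous N) {Y : PQRS m q' (Fin 0) q} (hY : Y.IsCont) (x : m → ℝ)
    {z : ℝ → q' → ℝ} (hz : L2Vec a b z) {v : ℝ → q → ℝ}
    (hv : ∀ s ∈ Set.Icc a b, Y.snd a b x z s = v s) :
    (PQRS.comp a b (PQRS.ofCoeff M N) Y).fst a b x z
      = fun i => ∫ s, (M s).mulVec (v s) i ∂lebIcc a b := by
  rw [PQRS.fst_comp hab (PQRS.isCont_ofCoeff hM hN) hY x hz]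
  funext i
  simp only [PQRS.fst, Matrix.zero_mulVec, Pi.zero_apply, zero_add]
  refine integral_congr_ae ?_
  filter_upwards [ae_restrict_mem measurableSet_Icc] with s hs
  rw [hv s hs]

theorem snd_comp_ofCoeff {m q q' n r : Type} [Fintype m] [Fintype q] [Fintype q'] [Finite r]
    {a b : ℝ} {M : ℝ → Matrix n q ℝ} {N : ℝ → Matrix r q ℝ} (hM : Continuous M)
    (hN : Continuous N) {Y : PQRS m q' (Fin 0) q} (hY : Y.IsCont) (x : m → ℝ)
    {z : ℝ → q' → ℝ} (hz : L2Vec a b z) {v : ℝ → q → ℝ}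
    (hv : ∀ s ∈ Set.Icc a b, Y.snd a b x z s = v s) {s : ℝ} (hs : s ∈ Set.Icc a b) :
    (PQRS.comp a b (PQRS.ofCoeff M N) Y).snd a b x z s = (N s).mulVec (v s) := by
  rw [PQRS.snd_comp (PQRS.isCont_ofCoeff hM hN) hY x hz hs, PQRS.snd,
    kernelInt_zero _ rfl rfl, hv s hs]
  simp

/-- A tuple with only a constant component. -/
abbrev PQRS.ofMatrix {m q n r : Type} (M : Matrix n m ℝ) : PQRS m q n r :=
  ⟨M, 0, 0, 0, 0, 0⟩

theorem PQRS.isCont_ofMatrix {m q n r : Type} (M : Matrix n m ℝ) :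
    (PQRS.ofMatrix M : PQRS m q n r).IsCont :=
  ⟨continuous_const, continuous_const, continuous_const, continuous_const, continuous_const⟩

theorem fst_ofMatrix {m q n r : Type} [Fintype m] [Fintype q] (M : Matrix n m ℝ) (a b : ℝ)
    (x : m → ℝ) (z : ℝ → q → ℝ) : (PQRS.ofMatrix M : PQRS m q n r).fst a b x z = M.mulVec x := by
  funext i
  simp [PQRS.fst]

theorem snd_ofMatrix {m q n r : Type} [Fintype m] [Fintype q] (M : Matrix n m ℝ) (a b : ℝ)
    (x : m → ℝ) (z : ℝ → q → ℝ) (s : ℝ) :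
    (PQRS.ofMatrix M : PQRS m q n r).snd a b x z s = 0 := by
  rw [PQRS.snd, kernelInt_zero _ rfl rfl]
  simp

namespace ODEPDESystem

theorem isCont_BHat {nx nw ny n₁ n₂ n₃ : ℕ} (sys : ODEPDESystem nx nw ny n₁ n₂ n₃) :
    sys.BHat.IsCont :=
  ⟨continuous_const, (continuous_polyEval _).matrix_fromCols continuous_const, continuous_const,
    continuous_const, continuous_const⟩

/-- The last summand `[[0 A], 0, [0 E]; [0 0 A₂], 0, 0]` of `Â`. -/
abbrev localTuple {nx nw ny n₁ n₂ n₃ : ℕ} (sys : ODEPDESystem nx nw ny n₁ n₂ n₃) :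
    PQRS (WIdx nw nx) (ZIdx n₁ n₂ n₃) (Fin nx) (ZIdx n₁ n₂ n₃) :=
  ⟨Matrix.fromCols 0 sys.A, 0, fun s => Matrix.fromCols 0 (polyEval sys.E s),
    fun s => row₃ 0 0 (polyEval sys.A₂ s), 0, 0⟩

theorem isCont_localTuple {nx nw ny n₁ n₂ n₃ : ℕ} (sys : ODEPDESystem nx nw ny n₁ n₂ n₃) :
    sys.localTuple.IsCont :=
  ⟨continuous_const, continuous_const.matrix_fromCols (continuous_polyEval _),
    continuous_const.row₃ continuous_const (continuous_polyEval _),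
    continuous_const, continuous_const⟩

theorem AHat_eq {nx nw ny n₁ n₂ n₃ : ℕ} (sys : ODEPDESystem nx nw ny n₁ n₂ n₃) (a b : ℝ) :
    sys.AHat a b
      = PQRS.comp a b (PQRS.ofCoeff (polyEval sys.Ea) (polyEval sys.A₀)) (sys.primalTuple a b)
        + PQRS.comp a b (PQRS.ofCoeff (polyEval sys.Eb) (polyEval sys.A₁)) (sys.derivTuple a b)
        + PQRS.comp a b (PQRS.ofMatrix sys.E₁) (sys.bdryTuple a b) + sys.localTuple :=
  rfl

theorem CHat_eq {nx nw ny n₁ n₂ n₃ : ℕ} (sys : ODEPDESystem nx nw ny n₁ n₂ n₃) (a b : ℝ) :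
    sys.CHat a b
      = PQRS.comp a b (PQRS.ofCoeff (polyEval sys.Ca) 0) (sys.primalTuple a b)
        + PQRS.comp a b (PQRS.ofCoeff (polyEval sys.Cb) 0) (sys.derivTuple a b)
        + PQRS.comp a b (PQRS.ofMatrix sys.C₁) (sys.bdryTuple a b)
        + PQRS.ofMatrix (Matrix.fromCols 0 sys.C) :=
  rfl

theorem isCont_comp_primal {nx nw ny n₁ n₂ n₃ : ℕ} (sys : ODEPDESystem nx nw ny n₁ n₂ n₃)
    (a b : ℝ) {n r : Type} {M : ℝ → Matrix n (ZIdx n₁ n₂ n₃) ℝ}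
    {N : ℝ → Matrix r (ZIdx n₁ n₂ n₃) ℝ} (hM : Continuous M) (hN : Continuous N) :
    (PQRS.comp a b (PQRS.ofCoeff M N) (sys.primalTuple a b)).IsCont :=
  (PQRS.isCont_ofCoeff hM hN).comp (sys.isCont_primalTuple a b) a b

theorem isCont_comp_deriv {nx nw ny n₁ n₂ n₃ : ℕ} (sys : ODEPDESystem nx nw ny n₁ n₂ n₃)
    (a b : ℝ) {n r : Type} {M : ℝ → Matrix n (DIdx n₂ n₃) ℝ}
    {N : ℝ → Matrix r (DIdx n₂ n₃) ℝ} (hM : Continuous M) (hN : Continuous N) :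
    (PQRS.comp a b (PQRS.ofCoeff M N) (sys.derivTuple a b)).IsCont :=
  (PQRS.isCont_ofCoeff hM hN).comp (sys.isCont_derivTuple a b) a b

theorem isCont_comp_bdry {nx nw ny n₁ n₂ n₃ : ℕ} (sys : ODEPDESystem nx nw ny n₁ n₂ n₃)
    (a b : ℝ) {n r : Type} (M : Matrix n (BIdx n₂ n₃) ℝ) :
    (PQRS.comp a b (PQRS.ofMatrix M : PQRS _ _ n r) (sys.bdryTuple a b)).IsCont :=
  (PQRS.isCont_ofMatrix M).comp (sys.isCont_bdryTuple a b) a b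

theorem isCont_AHat {nx nw ny n₁ n₂ n₃ : ℕ} (sys : ODEPDESystem nx nw ny n₁ n₂ n₃) (a b : ℝ) :
    (sys.AHat a b).IsCont := by
  rw [AHat_eq]
  exact (((sys.isCont_comp_primal a b (continuous_polyEval _) (continuous_polyEval _)).add
    (sys.isCont_comp_deriv a b (continuous_polyEval _) (continuous_polyEval _))).add
    (sys.isCont_comp_bdry a b _)).add sys.isCont_localTuple

theorem isCont_CHat {nx nw ny n₁ n₂ n₃ : ℕ} (sys : ODEPDESystem nx nw ny n₁ n₂ n₃) (a b : ℝ) :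
    (sys.CHat a b).IsCont := by
  rw [CHat_eq]
  exact (((sys.isCont_comp_primal a b (continuous_polyEval _) continuous_const).add
    (sys.isCont_comp_deriv a b (continuous_polyEval _) continuous_const)).add
    (sys.isCont_comp_bdry a b _)).add (PQRS.isCont_ofMatrix _)

/-- The common part of the ODE and of the output equation, in terms of the fundamental state. -/
theorem functional_eq {k n₁ n₂ n₃ : ℕ} {a b : ℝ} (hab : a ≤ b)
    (M₁ : Matrix (Fin k) (BIdx n₂ n₃) ℝ) (Ma : Matrix (Fin k) (ZIdx n₁ n₂ n₃) (Polynomial ℝ))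
    (Mb : Matrix (Fin k) (DIdx n₂ n₃) (Polynomial ℝ)) (ζ : PrimalState n₁ n₂ n₃ a b) :
    PrimalState.functional M₁ Ma Mb ζ
      = (fun i => ∫ s, (polyEval Ma s).mulVec (ζ.val s) i ∂lebIcc a b)
        + (fun i => ∫ s, (polyEval Mb s).mulVec (ζ.der s) i ∂lebIcc a b)
        + M₁.mulVec ζ.bdry := by
  funext i
  rw [PrimalState.functional, ← integral_lebIcc hab, integral_add
    (((ζ.l2Vec_val hab).mulVec (continuous_polyEval Ma)).integrable i)
    (((ζ.l2Vec_der hab).mulVec (continuous_polyEval Mb)).integrable i)]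
  simp only [Pi.add_apply]
  ring

/-- At `(w_r, z_f)` the first component of the operator `Â + B̂` is the right-hand side of the
ODE. -/
theorem fst_AHat_add_BHat {nx nw ny n₁ n₂ n₃ : ℕ} {sys : ODEPDESystem nx nw ny n₁ n₂ n₃}
    {a b : ℝ} (hab : a ≤ b) (hBT : IsUnit (sys.B * bdryT n₂ n₃ a b))
    {ζ : PrimalState n₁ n₂ n₃ a b} {x : EuclideanSpace ℝ (Fin nx)}
    {w : EuclideanSpace ℝ (Fin nw)}
    (hbc : sys.B.mulVec ζ.bdry = sys.B₁.mulVec x.ofLp + sys.B₂.mulVec w.ofLp) :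
    (sys.AHat a b + sys.BHat).fst a b (Sum.elim w.ofLp x.ofLp) ζ.fund
      = (sys.odeRHS x ζ w).ofLp := by
  have hz := ζ.l2Vec_fund
  have c₁ := sys.isCont_comp_primal a b (continuous_polyEval sys.Ea) (continuous_polyEval sys.A₀)
  have c₂ := sys.isCont_comp_deriv a b (continuous_polyEval sys.Eb) (continuous_polyEval sys.A₁)
  have c₃ := sys.isCont_comp_bdry a b (r := ZIdx n₁ n₂ n₃) sys.E₁
  have c₄ := sys.isCont_localTuple
  rw [PQRS.fst_add (sys.isCont_AHat a b) sys.isCont_BHat _ hz, AHat_eq,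
    PQRS.fst_add ((c₁.add c₂).add c₃) c₄ _ hz, PQRS.fst_add (c₁.add c₂) c₃ _ hz,
    PQRS.fst_add c₁ c₂ _ hz,
    fst_comp_ofCoeff hab (continuous_polyEval _) (continuous_polyEval _)
      (sys.isCont_primalTuple a b) _ hz (fun s hs => snd_primalTuple hBT hbc hs),
    fst_comp_ofCoeff hab (continuous_polyEval _) (continuous_polyEval _)
      (sys.isCont_derivTuple a b) _ hz (fun s hs => snd_derivTuple hBT hbc hs),
    PQRS.fst_comp hab (PQRS.isCont_ofMatrix _) (sys.isCont_bdryTuple a b) _ hz, fst_ofMatrix,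
    fst_bdryTuple hab hBT hbc]
  have h₁ : sys.localTuple.fst a b (Sum.elim w.ofLp x.ofLp) ζ.fund = sys.A.mulVec x.ofLp := by
    funext i
    simp [PQRS.fst, Matrix.fromCols_mulVec]
  have h₂ : sys.BHat.fst a b (Sum.elim w.ofLp x.ofLp) ζ.fund = sys.Bwo.mulVec w.ofLp := by
    funext i
    simp [PQRS.fst, BHat, Matrix.fromCols_mulVec]
  rw [h₁, h₂, odeRHS, WithLp.ofLp_toLp, functional_eq hab]
  funext i
  simp only [Pi.add_apply]
  ring

/-- At `(w_r, z_f)` the second component of the operator `Â + B̂` is the right-hand side of the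
PDE. -/
theorem snd_AHat_add_BHat {nx nw ny n₁ n₂ n₃ : ℕ} {sys : ODEPDESystem nx nw ny n₁ n₂ n₃}
    {a b : ℝ} (hBT : IsUnit (sys.B * bdryT n₂ n₃ a b))
    {ζ : PrimalState n₁ n₂ n₃ a b} {x : EuclideanSpace ℝ (Fin nx)}
    {w : EuclideanSpace ℝ (Fin nw)}
    (hbc : sys.B.mulVec ζ.bdry = sys.B₁.mulVec x.ofLp + sys.B₂.mulVec w.ofLp) {s : ℝ}
    (hs : s ∈ Set.Icc a b) :
    (sys.AHat a b + sys.BHat).snd a b (Sum.elim w.ofLp x.ofLp) ζ.fund s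
      = (sys.pdeRHS x ζ w s).ofLp := by
  have hz := ζ.l2Vec_fund
  have c₁ := sys.isCont_comp_primal a b (continuous_polyEval sys.Ea) (continuous_polyEval sys.A₀)
  have c₂ := sys.isCont_comp_deriv a b (continuous_polyEval sys.Eb) (continuous_polyEval sys.A₁)
  have c₃ := sys.isCont_comp_bdry a b (r := ZIdx n₁ n₂ n₃) sys.E₁
  have c₄ := sys.isCont_localTuple
  rw [PQRS.snd_add (sys.isCont_AHat a b) sys.isCont_BHat _ hz hs, AHat_eq,
    PQRS.snd_add ((c₁.add c₂).add c₃) c₄ _ hz hs, PQRS.snd_add (c₁.add c₂) c₃ _ hz hs,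
    PQRS.snd_add c₁ c₂ _ hz hs,
    snd_comp_ofCoeff (continuous_polyEval _) (continuous_polyEval _)
      (sys.isCont_primalTuple a b) _ hz (fun s hs => snd_primalTuple hBT hbc hs) hs,
    snd_comp_ofCoeff (continuous_polyEval _) (continuous_polyEval _)
      (sys.isCont_derivTuple a b) _ hz (fun s hs => snd_derivTuple hBT hbc hs) hs,
    PQRS.snd_comp (PQRS.isCont_ofMatrix _) (sys.isCont_bdryTuple a b) _ hz hs, snd_ofMatrix]
  have h₁ : sys.localTuple.snd a b (Sum.elim w.ofLp x.ofLp) ζ.fund s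
      = (polyEval sys.E s).mulVec x.ofLp + (polyEval sys.A₂ s).mulVec (ζ.z₃ss s).ofLp := by
    rw [PQRS.snd, kernelInt_zero _ rfl rfl]
    simp [Matrix.fromCols_mulVec, row₃, PrimalState.fund, stack₃]
  have h₂ : sys.BHat.snd a b (Sum.elim w.ofLp x.ofLp) ζ.fund s
      = (polyEval sys.Bwp s).mulVec w.ofLp := by
    rw [PQRS.snd, kernelInt_zero _ rfl rfl]
    simp [BHat, Matrix.fromCols_mulVec]
  rw [h₁, h₂, pdeRHS, WithLp.ofLp_toLp]
  funext i
  simp only [Pi.add_apply, Pi.zero_apply]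
  ring

/-- `Ĉ + D̂` at `(w_r, z_f)` is the output. -/
theorem fst_CHat {nx nw ny n₁ n₂ n₃ : ℕ} {sys : ODEPDESystem nx nw ny n₁ n₂ n₃}
    {a b : ℝ} (hab : a ≤ b) (hBT : IsUnit (sys.B * bdryT n₂ n₃ a b))
    {ζ : PrimalState n₁ n₂ n₃ a b} {x : EuclideanSpace ℝ (Fin nx)}
    {w : EuclideanSpace ℝ (Fin nw)}
    (hbc : sys.B.mulVec ζ.bdry = sys.B₁.mulVec x.ofLp + sys.B₂.mulVec w.ofLp) :
    (sys.CHat a b).fst a b (Sum.elim w.ofLp x.ofLp) ζ.fund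
        + sys.DHat.mulVec (Sum.elim w.ofLp x.ofLp)
      = (sys.output x ζ w).ofLp := by
  have hz := ζ.l2Vec_fund
  have c₁ := sys.isCont_comp_primal a b (r := Fin 0) (continuous_polyEval sys.Ca)
    (N := 0) continuous_const
  have c₂ := sys.isCont_comp_deriv a b (r := Fin 0) (continuous_polyEval sys.Cb)
    (N := 0) continuous_const
  have c₃ := sys.isCont_comp_bdry a b (r := Fin 0) sys.C₁
  have c₄ : (PQRS.ofMatrix (Matrix.fromCols 0 sys.C) :
    PQRS (WIdx nw nx) (ZIdx n₁ n₂ n₃) (Fin ny) (Fin 0)).IsCont := PQRS.isCont_ofMatrix _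
  rw [CHat_eq, PQRS.fst_add ((c₁.add c₂).add c₃) c₄ _ hz, PQRS.fst_add (c₁.add c₂) c₃ _ hz,
    PQRS.fst_add c₁ c₂ _ hz,
    fst_comp_ofCoeff hab (continuous_polyEval _) (N := 0) continuous_const
      (sys.isCont_primalTuple a b) _ hz (fun s hs => snd_primalTuple hBT hbc hs),
    fst_comp_ofCoeff hab (continuous_polyEval _) (N := 0) continuous_const
      (sys.isCont_derivTuple a b) _ hz (fun s hs => snd_derivTuple hBT hbc hs),
    PQRS.fst_comp hab (PQRS.isCont_ofMatrix _) (sys.isCont_bdryTuple a b) _ hz, fst_ofMatrix,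
    fst_ofMatrix, fst_bdryTuple hab hBT hbc, DHat, output, WithLp.ofLp_toLp, functional_eq hab,
    Matrix.fromCols_mulVec_sumElim, Matrix.fromCols_mulVec_sumElim, Matrix.zero_mulVec,
    Matrix.zero_mulVec]
  funext i
  simp only [Pi.add_apply, Pi.zero_apply]
  ring

end ODEPDESystem

/-! ### The power balance along solutions -/

namespace ODEPDESystem

/-- The tuple `[I₁, 0, H₀; G₀, G₁, G₂]`, taking `(w_r, z_f)` to `(x, z)`. -/
abbrev stateTuple {nx nw ny n₁ n₂ n₃ : ℕ} (sys : ODEPDESystem nx nw ny n₁ n₂ n₃) (a b : ℝ) :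
    PQRS (WIdx nw nx) (ZIdx n₁ n₂ n₃) (Fin nx) (ZIdx n₁ n₂ n₃) :=
  ⟨I₁ nw nx, 0, sys.H₀ a b, G₀ n₁ n₂ n₃, sys.G₁ a b, sys.G₂ a b⟩

theorem isCont_stateTuple {nx nw ny n₁ n₂ n₃ : ℕ} (sys : ODEPDESystem nx nw ny n₁ n₂ n₃)
    (a b : ℝ) : (sys.stateTuple a b).IsCont :=
  ⟨continuous_const, sys.continuous_H₀ a b, continuous_const, sys.continuous_G₁ a b,
    sys.continuous_G₂ a b⟩

/-- The tuple `[(Ĉ₀ + D̂₀)ᵀ I₀, 0, Ĉ₁ᵀ I₀; 0, 0, 0]` of the supply rate. -/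
abbrev supplyTuple {nx m n₁ n₂ n₃ : ℕ} (sys : ODEPDESystem nx m m n₁ n₂ n₃) (a b : ℝ) :
    PQRS (WIdx m nx) (ZIdx n₁ n₂ n₃) (WIdx m nx) (ZIdx n₁ n₂ n₃) :=
  ⟨((sys.CHat a b).P + sys.DHat).transpose * I₀ m nx, 0,
    fun s => ((sys.CHat a b).Q₁ s).transpose * I₀ m nx, 0, 0, 0⟩

theorem isCont_supplyTuple {nx m n₁ n₂ n₃ : ℕ} (sys : ODEPDESystem nx m m n₁ n₂ n₃)
    (a b : ℝ) : (sys.supplyTuple a b).IsCont :=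
  ⟨continuous_const, (sys.isCont_CHat a b).Q₁.matrix_transpose.matrix_mul continuous_const,
    continuous_const, continuous_const, continuous_const⟩

/-- The quadratic form of the supply tuple is `yᵀ w`. -/
theorem form_supplyTuple {nx m n₁ n₂ n₃ : ℕ} {sys : ODEPDESystem nx m m n₁ n₂ n₃}
    {a b : ℝ} (hab : a ≤ b) (hBT : IsUnit (sys.B * bdryT n₂ n₃ a b))
    {ζ : PrimalState n₁ n₂ n₃ a b} {x : EuclideanSpace ℝ (Fin nx)}
    {w : EuclideanSpace ℝ (Fin m)}
    (hbc : sys.B.mulVec ζ.bdry = sys.B₁.mulVec x.ofLp + sys.B₂.mulVec w.ofLp) :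
    (sys.supplyTuple a b).form a b (Sum.elim w.ofLp x.ofLp) ζ.fund (Sum.elim w.ofLp x.ofLp) ζ.fund
      = inner ℝ w (sys.output x ζ w) := by
  have hz := ζ.l2Vec_fund
  have hI : (I₀ m nx).mulVec (Sum.elim w.ofLp x.ofLp) = w.ofLp := by
    rw [I₀, Matrix.fromCols_mulVec_sumElim, Matrix.one_mulVec, Matrix.zero_mulVec, add_zero]
  have key : ∀ {α : Type} [Fintype α] (M : Matrix (Fin m) α ℝ) (v : α → ℝ),
      v ⬝ᵥ (M.transpose * I₀ m nx).mulVec (Sum.elim w.ofLp x.ofLp) = w.ofLp ⬝ᵥ M.mulVec v := by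
    intro α _ M v
    rw [← Matrix.mulVec_mulVec, hI, Matrix.mulVec_transpose, Matrix.dotProduct_mulVec,
      dotProduct_comm]
  have h₁ : ∫ s, w.ofLp ⬝ᵥ ((sys.CHat a b).Q₁ s).mulVec (ζ.fund s) ∂lebIcc a b
      = w.ofLp ⬝ᵥ fun i => ∫ s, ((sys.CHat a b).Q₁ s).mulVec (ζ.fund s) i ∂lebIcc a b :=
    (dotProduct_integral _ (hz.mulVec (sys.isCont_CHat a b).Q₁).integrable).symm
  rw [PQRS.form_eq (sys.isCont_supplyTuple a b) _ hz _ hz]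
  simp only [kernelInt_zero (sys.supplyTuple a b) rfl rfl, key, Pi.zero_apply, Matrix.zero_mulVec,
    dotProduct_zero, integral_zero, add_zero]
  rw [h₁, Matrix.add_mulVec, EuclideanSpace.inner_eq_star_dotProduct, ← fst_CHat hab hBT hbc,
    star_trivial, dotProduct_comm _ w.ofLp]
  have h₂ : (sys.CHat a b).fst a b (Sum.elim w.ofLp x.ofLp) ζ.fund
      = (sys.CHat a b).P.mulVec (Sum.elim w.ofLp x.ofLp)
        + fun i => ∫ s, ((sys.CHat a b).Q₁ s).mulVec (ζ.fund s) i ∂lebIcc a b := rfl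
  rw [h₂]
  simp only [dotProduct_add]
  ring

theorem isCont_JTuple {nx m n₁ n₂ n₃ : ℕ} (sys : ODEPDESystem nx m m n₁ n₂ n₃) (a b : ℝ)
    {X : PQRS (Fin nx) (ZIdx n₁ n₂ n₃) (Fin nx) (ZIdx n₁ n₂ n₃)} (hX : X.IsCont) :
    (sys.JTuple a b X).IsCont := by
  have h : sys.JTuple a b X = PQRS.comp a b (sys.KTuple a b X) (sys.AHat a b + sys.BHat)
      + -sys.supplyTuple a b := PQRS.sub_eq_add_neg _ _
  rw [h]
  exact (((sys.isCont_stateTuple a b).adj.comp hX a b).comp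
    ((sys.isCont_AHat a b).add sys.isCont_BHat) a b).add (sys.isCont_supplyTuple a b).neg

/-- Along solutions, the quadratic form of `J` is the power of the storage form minus the
supply rate. -/
theorem form_JTuple {nx m n₁ n₂ n₃ : ℕ} {sys : ODEPDESystem nx m m n₁ n₂ n₃}
    {a b : ℝ} (hab : a ≤ b) (hBT : IsUnit (sys.B * bdryT n₂ n₃ a b))
    {X : PQRS (Fin nx) (ZIdx n₁ n₂ n₃) (Fin nx) (ZIdx n₁ n₂ n₃)} (hX : X.IsCont)
    {ζ : PrimalState n₁ n₂ n₃ a b} {x : EuclideanSpace ℝ (Fin nx)}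
    {w : EuclideanSpace ℝ (Fin m)}
    (hbc : sys.B.mulVec ζ.bdry = sys.B₁.mulVec x.ofLp + sys.B₂.mulVec w.ofLp) :
    (sys.JTuple a b X).form a b (Sum.elim w.ofLp x.ofLp) ζ.fund (Sum.elim w.ofLp x.ofLp) ζ.fund
      = X.form a b x.ofLp ζ.val (sys.odeRHS x ζ w).ofLp (fun s => (sys.pdeRHS x ζ w s).ofLp)
        - inner ℝ w (sys.output x ζ w) := by
  have hz := ζ.l2Vec_fund
  have hG := sys.isCont_stateTuple a b
  have hAB := (sys.isCont_AHat a b).add sys.isCont_BHat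
  have hK : sys.KTuple a b X = PQRS.comp a b (sys.stateTuple a b).adj X := rfl
  have hJ : sys.JTuple a b X = PQRS.comp a b (sys.KTuple a b X) (sys.AHat a b + sys.BHat)
      + -sys.supplyTuple a b := PQRS.sub_eq_add_neg _ _
  have hKc : (sys.KTuple a b X).IsCont := hG.adj.comp hX a b
  have hu := hAB.snd (Sum.elim w.ofLp x.ofLp) hz
  have hfst : (sys.stateTuple a b).fst a b (Sum.elim w.ofLp x.ofLp) ζ.fund = x.ofLp := by
    funext i
    simp [PQRS.fst, I₁, Matrix.fromCols_mulVec]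
  have hsnd : ∀ s ∈ Set.Icc a b,
      (sys.stateTuple a b).snd a b (Sum.elim w.ofLp x.ofLp) ζ.fund s = ζ.val s :=
    fun s hs => snd_primalTuple hBT hbc hs
  rw [hJ, PQRS.form_add (hKc.comp hAB a b) (sys.isCont_supplyTuple a b).neg _ hz _ hz,
    PQRS.form_neg, form_supplyTuple hab hBT hbc, PQRS.form_comp hab hKc hAB _ _ _ hz, hK,
    PQRS.form_comp hab hG.adj hX _ _ _ hu, PQRS.form_adj hG _ (hX.snd _ hu) _ hz,
    ← fst_AHat_add_BHat hab hBT hbc,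
    PQRS.form_congr X x.ofLp _ (Filter.Eventually.of_forall fun s => rfl)
      ((ae_restrict_mem measurableSet_Icc).mono
        fun s hs => (snd_AHat_add_BHat hBT hbc hs).symm : ∀ᵐ s ∂lebIcc a b, _),
    _root_.sub_eq_add_neg]
  congr 1
  rw [PQRS.form, PQRS.form, hfst, dotProduct_comm]
  congr 1
  refine integral_congr_ae ?_
  filter_upwards [ae_restrict_mem measurableSet_Icc] with s hs
  rw [hsnd s hs, dotProduct_comm]

end ODEPDESystem

/-- The tuple of `c` times the identity has `c` times the inner product as its form. -/
theorem PQRS.form_one {m n : Type} [Fintype m] [Fintype n] [DecidableEq m] [DecidableEq n]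
    (a b c : ℝ) (y : m → ℝ) (u : ℝ → n → ℝ) (x : m → ℝ) (z : ℝ → n → ℝ) :
    (PQRS.symm (c • (1 : Matrix m m ℝ)) 0 (fun _ => c • (1 : Matrix n n ℝ)) 0 0).form a b y u x z
      = c * (y ⬝ᵥ x + ∫ s, u s ⬝ᵥ z s ∂lebIcc a b) := by
  have h₁ : (PQRS.symm (c • (1 : Matrix m m ℝ)) 0 (fun _ => c • (1 : Matrix n n ℝ)) 0 0).fst a b x z
      = c • x := by
    funext i
    simp [fst, symm, Matrix.smul_mulVec]
  have h₂ : ∀ s, (PQRS.symm (c • (1 : Matrix m m ℝ)) 0 (fun _ => c • (1 : Matrix n n ℝ)) 0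
      0).snd a b x z s = c • z s := by
    intro s
    rw [snd, kernelInt_zero _ rfl rfl]
    simp [symm, Matrix.smul_mulVec]
  simp only [form, h₁, h₂, dotProduct_smul, smul_eq_mul, integral_const_mul]
  ring

/-! ### Integrating the dissipation inequality -/

/-- The pair `(x, z)` as a point of the Hilbert space `ℝ^m × L₂^n[a,b]`. -/
abbrev StateSpace.mk {m n : Type} [Fintype m] [Fintype n] {a b : ℝ} (x : EuclideanSpace ℝ m)
    (z : L2 n a b) : StateSpace m n a b :=
  WithLp.toLp 2 (x, z)

theorem StateSpace.ac_mk {m n : Type} [Fintype m] [Fintype n] {a b c d : ℝ}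
    {x : ℝ → EuclideanSpace ℝ m} {z : ℝ → L2 n a b} (hx : AbsolutelyContinuousOnInterval x c d)
    (hz : AbsolutelyContinuousOnInterval z c d) :
    AbsolutelyContinuousOnInterval (fun t => StateSpace.mk (x t) (z t)) c d := by
  let e := (WithLp.prodContinuousLinearEquiv 2 ℝ (EuclideanSpace ℝ m)
    (L2 n a b)).symm.toContinuousLinearMap
  have h₁ := (e.comp
    (ContinuousLinearMap.inl ℝ _ _)).comp_absolutelyContinuousOnInterval hx
  have h₂ := (e.comp
    (ContinuousLinearMap.inr ℝ _ _)).comp_absolutelyContinuousOnInterval hz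
  have h : (fun t => StateSpace.mk (x t) (z t))
      = fun t => (e.comp (ContinuousLinearMap.inl ℝ _ _)) (x t)
        + (e.comp (ContinuousLinearMap.inr ℝ _ _)) (z t) := by
    funext t
    simp only [ContinuousLinearMap.comp_apply, ← map_add, ContinuousLinearMap.inl_apply,
      ContinuousLinearMap.inr_apply, Prod.mk_add_mk, add_zero, zero_add]
    rfl
  rw [h]
  exact h₁.add h₂

theorem StateSpace.hasDerivAt_mk {m n : Type} [Fintype m] [Fintype n] {a b t : ℝ}
    {x : ℝ → EuclideanSpace ℝ m} {z : ℝ → L2 n a b} {x' : EuclideanSpace ℝ m} {z' : L2 n a b}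
    (hx : HasDerivAt x x' t) (hz : HasDerivAt z z' t) :
    HasDerivAt (fun t => StateSpace.mk (x t) (z t)) (StateSpace.mk x' z') t :=
  (WithLp.prodContinuousLinearEquiv 2 ℝ (EuclideanSpace ℝ m)
    (L2 n a b)).symm.toContinuousLinearMap.hasFDerivAt.comp_hasDerivAt t (hx.prodMk hz)

theorem integrable_inner_of_memLp_two {m : ℕ} {μ : Measure ℝ}
    {w y : ℝ → EuclideanSpace ℝ (Fin m)} (hw : MemLp w 2 μ) (hy : MemLp y 2 μ) :
    Integrable (fun t => inner ℝ (w t) (y t)) μ := by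
  simp only [PiLp.inner_apply]
  exact integrable_finsetSum _ fun i _ => (hy.eval_piLp i).integrable_mul (hw.eval_piLp i)

/-- A storage function which vanishes at time `0`, is nonnegative and whose growth is bounded by
the supply rate forces the total supply to be nonnegative. -/
theorem integral_nonneg_of_storage {V σ : ℝ → ℝ} (hσ : IntegrableOn σ (Set.Ici 0))
    (hV : ∀ τ, 0 < τ → AbsolutelyContinuousOnInterval V 0 τ) (hV0 : V 0 = 0)
    (hVn : ∀ t, 0 ≤ V t) (hd : ∀ᵐ t ∂(volume : Measure ℝ).restrict (Set.Ici 0), deriv V t ≤ σ t) :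
    0 ≤ ∫ t in Set.Ici (0 : ℝ), σ t := by
  have hle : ∀ τ : ℝ, 0 < τ → 0 ≤ ∫ t in (0 : ℝ)..τ, σ t := by
    intro τ hτ
    have hsub : Set.Ioc 0 τ ⊆ Set.Ici (0 : ℝ) := fun t ht => ht.1.le
    have h₁ := (hV τ hτ).integral_deriv_eq_sub
    have h₂ : ∫ t in (0 : ℝ)..τ, deriv V t ≤ ∫ t in (0 : ℝ)..τ, σ t := by
      rw [intervalIntegral.integral_of_le hτ.le, intervalIntegral.integral_of_le hτ.le]
      exact integral_mono_ae
        ((intervalIntegrable_iff_integrableOn_Ioc_of_le hτ.le).1 (hV τ hτ).intervalIntegrable_deriv)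
        (hσ.mono_set hsub) (ae_restrict_of_ae_restrict_of_subset hsub hd)
    have := hVn τ
    linarith
  rw [integral_Ici_eq_integral_Ioi]
  refine ge_of_tendsto (intervalIntegral_tendsto_integral_Ioi 0
    (hσ.mono_set Set.Ioi_subset_Ici_self) Filter.tendsto_id) ?_
  filter_upwards [Filter.eventually_gt_atTop 0] with τ hτ
  exact hle τ hτ

theorem PQRS.symm_eq_add {m n : Type} [DecidableEq m] [DecidableEq n] (ε : ℝ)
    (P : Matrix m m ℝ) (Q : ℝ → Matrix m n ℝ) (S : ℝ → Matrix n n ℝ)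
    (R₁ R₂ : ℝ → ℝ → Matrix n n ℝ) :
    PQRS.symm P Q S R₁ R₂ = PQRS.symm (P - ε • (1 : Matrix m m ℝ)) Q
        (fun s => S s - ε • (1 : Matrix n n ℝ)) R₁ R₂
      + PQRS.symm (ε • (1 : Matrix m m ℝ)) 0 (fun _ => ε • (1 : Matrix n n ℝ)) 0 0 := by
  change PQRS.mk _ _ _ _ _ _ = PQRS.mk _ _ _ _ _ _
  congr 1
  · exact (sub_add_cancel _ _).symm
  · exact (add_zero _).symm
  · exact (add_zero _).symm
  · funext s
    exact (sub_add_cancel _ _).symm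
  · exact (add_zero _).symm
  · exact (add_zero _).symm

theorem PQRS.isCont_symm {m n : Type} (P : Matrix m m ℝ) {Q : ℝ → Matrix m n ℝ}
    {S : ℝ → Matrix n n ℝ} {R₁ R₂ : ℝ → ℝ → Matrix n n ℝ} (hQ : Continuous Q) (hS : Continuous S)
    (h₁ : Continuous fun p : ℝ × ℝ => R₁ p.1 p.2) (h₂ : Continuous fun p : ℝ × ℝ => R₂ p.1 p.2) :
    (PQRS.symm P Q S R₁ R₂).IsCont :=
  ⟨hQ, hQ.matrix_transpose, hS, h₁, h₂⟩

/-- If `-J - J^*` lies in the cone, then the quadratic form of `J` is nonpositive. -/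
theorem form_nonpos_of_neg_sub_adj_mem {m n : Type} [Fintype m] [Fintype n] [DecidableEq n]
    {a b : ℝ} (hab : a ≤ b) {d : ℕ} {J : PQRS m n m n} (hJ : J.IsCont)
    (h : -J - J.adj ∈ PhiCone m n a b d) (x : m → ℝ) {z : ℝ → n → ℝ} (hz : L2Vec a b z) :
    J.form a b x z x z ≤ 0 := by
  have h₁ := form_nonneg_of_mem_phiCone hab h x hz
  rw [PQRS.sub_eq_add_neg, PQRS.form_add hJ.neg hJ.adj.neg _ hz _ hz, PQRS.form_neg,
    PQRS.form_neg, PQRS.form_adj hJ _ hz _ hz] at h₁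
  linarith

end

theorem mainTheorem2 {nx m n₁ n₂ n₃ : ℕ} {a b : ℝ} (hab : a < b)
    (sys : ODEPDESystem nx m m n₁ n₂ n₃)
    (hBT : IsUnit (sys.B * bdryT n₂ n₃ a b))
    (ε : ℝ) (hε : 0 < ε) (d₁ d₂ : ℕ)
    (P : Matrix (Fin nx) (Fin nx) ℝ) (hP : P.IsSymm)
    (Q : Matrix (Fin nx) (ZIdx n₁ n₂ n₃) (Polynomial ℝ))
    (S : Matrix (ZIdx n₁ n₂ n₃) (ZIdx n₁ n₂ n₃) (Polynomial ℝ)) (hS : S.IsSymm)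
    (R₁ R₂ : Matrix (ZIdx n₁ n₂ n₃) (ZIdx n₁ n₂ n₃) (Polynomial (Polynomial ℝ)))
    (hpos : PQRS.symm (P - ε • (1 : Matrix (Fin nx) (Fin nx) ℝ)) (polyEval Q)
        (fun s => polyEval S s - ε • (1 : Matrix (ZIdx n₁ n₂ n₃) (ZIdx n₁ n₂ n₃) ℝ))
        (polyEval₂ R₁) (polyEval₂ R₂)
      ∈ PhiCone (Fin nx) (ZIdx n₁ n₂ n₃) a b d₁)
    (J : PQRS (Fin m ⊕ Fin nx) (ZIdx n₁ n₂ n₃) (Fin m ⊕ Fin nx) (ZIdx n₁ n₂ n₃))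
    (hJ : J = sys.JTuple a b
      (PQRS.symm P (polyEval Q) (polyEval S) (polyEval₂ R₁) (polyEval₂ R₂)))
    (hneg : -J - J.adj ∈ PhiCone (Fin m ⊕ Fin nx) (ZIdx n₁ n₂ n₃) a b d₂)
    (w y : ℝ → EuclideanSpace ℝ (Fin m))
    (hw : MemLp w 2 ((volume : Measure ℝ).restrict (Set.Ici 0)))
    (hy : MemLp y 2 ((volume : Measure ℝ).restrict (Set.Ici 0)))
    (x : ℝ → EuclideanSpace ℝ (Fin nx)) (z : ℝ → L2 (ZIdx n₁ n₂ n₃) a b)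
    (htraj : sys.IsTrajectory a b w y x z) :
    0 ≤ ∫ t in Set.Ici (0 : ℝ), inner ℝ (w t) (y t) := by
  set X := PQRS.symm P (polyEval Q) (polyEval S) (polyEval₂ R₁) (polyEval₂ R₂) with hXdef
  have hX : X.IsCont := PQRS.isCont_symm P (continuous_polyEval Q) (continuous_polyEval S)
    (continuous_polyEval₂ R₁) (continuous_polyEval₂ R₂)
  -- the form of `X` is that of a member of `Φ_d` plus `ε` times the inner product
  have hXform : ∀ (p : Fin nx → ℝ) (u : ℝ → ZIdx n₁ n₂ n₃ → ℝ) (q : Fin nx → ℝ)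
      (v : ℝ → ZIdx n₁ n₂ n₃ → ℝ), L2Vec a b u → L2Vec a b v →
      X.form a b p u q v = (PQRS.symm (P - ε • (1 : Matrix (Fin nx) (Fin nx) ℝ)) (polyEval Q)
        (fun s => polyEval S s - ε • (1 : Matrix (ZIdx n₁ n₂ n₃) (ZIdx n₁ n₂ n₃) ℝ))
        (polyEval₂ R₁) (polyEval₂ R₂)).form a b p u q v
        + ε * (p ⬝ᵥ q + ∫ s, u s ⬝ᵥ v s ∂lebIcc a b) := by
    intro p u q v hu hv
    rw [hXdef, PQRS.symm_eq_add ε, PQRS.form_add _ _ _ hu _ hv, PQRS.form_one]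
    · exact PQRS.isCont_symm _ (continuous_polyEval Q)
        ((continuous_polyEval S).sub continuous_const) (continuous_polyEval₂ R₁)
        (continuous_polyEval₂ R₂)
    · exact PQRS.isCont_symm _ continuous_const continuous_const continuous_const continuous_const
  have hXsymm : ∀ (p : Fin nx → ℝ) (u : ℝ → ZIdx n₁ n₂ n₃ → ℝ) (q : Fin nx → ℝ)
      (v : ℝ → ZIdx n₁ n₂ n₃ → ℝ), L2Vec a b u → L2Vec a b v →
      X.form a b p u q v = X.form a b q v p u := by
    intro p u q v hu hv
    rw [hXform p u q v hu hv, hXform q v p u hv hu,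
      form_comm_of_mem_phiCone hab.le hpos p hu q hv, dotProduct_comm p q]
    simp only [dotProduct_comm (u _)]
  have hXnonneg : ∀ (p : Fin nx → ℝ) (u : ℝ → ZIdx n₁ n₂ n₃ → ℝ), L2Vec a b u →
      0 ≤ X.form a b p u p u := by
    intro p u hu
    rw [hXform p u p u hu hu]
    have hself : ∀ {α : Type} [Fintype α] (v : α → ℝ), 0 ≤ v ⬝ᵥ v :=
      fun v => Finset.sum_nonneg fun i _ => mul_self_nonneg (v i)
    exact add_nonneg (form_nonneg_of_mem_phiCone hab.le hpos p hu) (mul_nonneg hε.le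
      (add_nonneg (hself p)
        (integral_nonneg fun s => hself (u s))))
  obtain ⟨T, hT⟩ := exists_continuousLinearMap_of_form_comm hX hXsymm
  have hTsymm : ∀ u v, inner ℝ u (T v) = inner ℝ v (T u) := fun u v => by
    rw [hT, hT]
    exact hXsymm _ _ _ _ (L2.l2Vec_rep _) (L2.l2Vec_rep _)
  have hac : ∀ τ, 0 < τ → AbsolutelyContinuousOnInterval
      (fun t => StateSpace.mk (x t) (z t)) 0 τ :=
    fun τ hτ => StateSpace.ac_mk (htraj.x_ac τ hτ) (htraj.z_ac τ hτ)
  refine integral_nonneg_of_storage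
    (V := fun t => (1 / 2 : ℝ) * inner ℝ (StateSpace.mk (x t) (z t))
      (T (StateSpace.mk (x t) (z t))))
    (integrable_inner_of_memLp_two hw hy) (fun τ hτ => ((hac τ hτ).inner_clm T).const_mul _) ?_
    (fun t => ?_) ?_
  · have h0 : StateSpace.mk (x 0) (z 0) = (0 : StateSpace (Fin nx) (ZIdx n₁ n₂ n₃) a b) := by
      rw [htraj.x_zero, htraj.z_zero]
      rfl
    simp only [h0, inner_zero_left, mul_zero]
  · rw [hT]
    exact mul_nonneg (by norm_num) (hXnonneg _ _ (L2.l2Vec_rep _))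
  · filter_upwards [htraj.dynamics] with t ht
    obtain ⟨ζ, z', hζ, hbc, hx', hz', hpde, hyt⟩ := ht
    have hu := StateSpace.hasDerivAt_mk hx' hz'
    have hV := (hu.inner ℝ (T.hasFDerivAt.comp_hasDerivAt t hu)).const_mul (1 / 2 : ℝ)
    have hJ0 := form_nonpos_of_neg_sub_adj_mem hab.le (hJ ▸ sys.isCont_JTuple a b hX) hneg
      (Sum.elim (w t).ofLp (x t).ofLp) ζ.l2Vec_fund
    rw [hJ, ODEPDESystem.form_JTuple hab.le hBT hX hbc, ← hyt] at hJ0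
    have hpow : inner ℝ (StateSpace.mk (x t) (z t))
        (T (StateSpace.mk (sys.odeRHS (x t) ζ (w t)) z'))
        = X.form a b (x t).ofLp ζ.val (sys.odeRHS (x t) ζ (w t)).ofLp
          (fun s => (sys.pdeRHS (x t) ζ (w t) s).ofLp) := by
      rw [hT]
      exact PQRS.form_congr X _ _ hζ (hpde.mono fun s hs => congrArg WithLp.ofLp hs)
    have hV' := hV.deriv
    refine hV'.trans_le ?_
    rw [Function.comp_apply, hTsymm (StateSpace.mk (sys.odeRHS (x t) ζ (w t)) z'), hpow]
    linarith
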